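/- There is an absolute constant $C>0$ such that the following holds. Let $n\ge 2$ and let $X=(X_1,\dots,X_n)$ be a random vector in $\mathbb R^n$ with $\mathbb E X_i=0$ and $\mathbb E X_iX_j=\delta_{ij}$ for all $i,j\le n$ (isotropic with mean zero). Let $\lambda_1=\lambda_1(X)$ be the Poincaré constant of $X$, that is, the largest constant such that $$\lambda_1\operatorname{Var}(u(X))\le \mathbb E|\nabla u(X)|^2$$ for all smooth functions $u:\mathbb R^n\to\mathbb R$ (both sides with values in $[0,\infty]$), and assume $\lambda_1>0$. For $\theta$ in the unit sphere $S^{n-1}$ of $\mathbb R^n$ put $F_\theta(x)=\mathbb P\{\theta_1X_1+\dots+\theta_nX_n\le x\}$, let $\Phi$ be the standard normal distribution function, let $\rho(F_\theta,\Phi)=\sup_{x\in\mathbb R}|F_\theta(x)-\Phi(x)|$, and let $\sigma_{n-1}$ be the uniform probability measure on $S^{n-1}$. Then for every $\beta>0$, $$\rho(F_\theta,\Phi)\le \frac{C\beta^2(\log n)^3}{n\,\lambda_1}$$ for all $\theta\in S^{n-1}$ outside a set of $\sigma_{n-1}$-measure at most $3n^{-\beta}$. -/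

import Mathlib

open MeasureTheory ProbabilityTheory
open scoped ENNReal

/-- The uniform probability measure on the unit sphere of `ℝⁿ`: normalized surface measure. -/
noncomputable def sphereProb (n : ℕ) :
    Measure (Metric.sphere (0 : EuclideanSpace ℝ (Fin n)) 1) :=
  ((volume : Measure (EuclideanSpace ℝ (Fin n))).toSphere Set.univ)⁻¹ •
    (volume : Measure (EuclideanSpace ℝ (Fin n))).toSphere

/-- `X` is isotropic: its second moments are finite and `E Xᵢ Xⱼ = δᵢⱼ`. -/
def IsIsotropic {n : ℕ} {Ω : Type*} [MeasurableSpace Ω] (P : Measure Ω)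
    (X : Ω → EuclideanSpace ℝ (Fin n)) : Prop :=
  MemLp X 2 P ∧ ∀ i j : Fin n, ∫ ω, X ω i * X ω j ∂P = if i = j then 1 else 0

/-- The Poincaré constant `λ₁(X)`: the optimal (largest) constant `l ∈ [0, ∞]` in
`l * Var (u(X)) ≤ E |∇u(X)|²` for all smooth `u : ℝⁿ → ℝ`. Both sides are taken in `[0, ∞]`;
`evariance` is infinite exactly when `u(X)` is not square integrable. -/
noncomputable def poincareConstant {n : ℕ} {Ω : Type*} [MeasurableSpace Ω] (P : Measure Ω)
    (X : Ω → EuclideanSpace ℝ (Fin n)) : ℝ≥0∞ :=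
  sSup {l : ℝ≥0∞ | ∀ u : EuclideanSpace ℝ (Fin n) → ℝ, ContDiff ℝ (⊤ : ℕ∞) u →
    l * evariance (fun ω => u (X ω)) P ≤ ∫⁻ ω, ‖gradient u (X ω)‖ₑ ^ 2 ∂P}

/-- The distribution function `F_θ(x) = P {θ₁ X₁ + ⋯ + θₙ Xₙ ≤ x}` of the weighted sum. -/
noncomputable def weightedSumCDF {n : ℕ} {Ω : Type*} [MeasurableSpace Ω] (P : Measure Ω)
    (X : Ω → EuclideanSpace ℝ (Fin n)) (θ : EuclideanSpace ℝ (Fin n)) (x : ℝ) : ℝ :=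
  P.real {ω | ∑ i, θ i * X ω i ≤ x}

/-- The standard normal distribution function `Φ`. -/
noncomputable def stdNormalCDF (x : ℝ) : ℝ :=
  (gaussianReal 0 1).real (Set.Iic x)

/-- The Kolmogorov distance of two distribution functions. -/
noncomputable def kolmogorovDist (F G : ℝ → ℝ) : ℝ :=
  ⨆ x : ℝ, |F x - G x|

/-!
The argument compares characteristic functions. Let `μ` be the law of `X`, `γ` the standard
Gaussian measure on `ℝⁿ`, `N = n λ₁`, `s = β log n`, and `D = charFun μ - exp (-‖·‖² / 2)`. For a
unit vector `θ` the weighted sum has characteristic function `t ↦ charFun μ (t θ)`, and a smoothing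
inequality with a Gaussian kernel of width `1 / N` (`abs_real_Iic_sub_stdNormalCDF_le`) bounds its
Kolmogorov distance to the normal law by `∫ |D (t θ)| / |t| exp (-t² / (2 N²)) dt + 3 / N`. A uniform
direction is the direction of a Gaussian vector `x` (`sphereProb_eq_stdGaussian`), whose length is
at least `√n / 2` with large probability, and this reduces the problem to tail bounds for the
integral of `|D (t x / √n)| / |t|` over low and over high frequencies, under `γ`.

**Low frequencies**, `t² ≲ s + log n`. Put `δ = |t| / √n`. The moments
`∫ |D (δ x)| ^ (2 k) dγ ≤ (1400 k t² / N) ^ (2 k)` (`IsIsotropicPoincare.integral_charDiff_pow_le`)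
come from Gaussian concentration in Maurey–Pisier form. Since `|∇D|` is controlled in moments by
its mean square and by its Lipschitz constant, everything rests on three facts, all of them
consequences of the Poincaré inequality for `μ`. The mean of `D (δ ·)` under `γ` is an integral of
`exp (-δ² ‖y‖² / 2)` over `μ` compared with its Gaussian value, and `‖y‖²` has variance at most
`4 n / λ₁`. The mean of `∇D (δ ·)` is, up to sign, a multiple of `∫ exp (-δ² ‖y‖² / 2) y dμ`, of
squared length at most `δ² / λ₁`. The Hessian of `D` has real part, up to small terms,
`-∫ cos ⟨x, y⟩ (y ⊗ y - 1) dμ`, and a similar imaginary part, each of squared Hilbert–Schmidt norm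
at most `4 / λ₁`: apply the Poincaré inequality to quadratic forms
(`IsIsotropicPoincare.sum_integral_mul_sq_le`). With `k ≈ s`, Jensen's inequality in `t` and
Markov's inequality, the low frequencies contribute `O(s² log n / N)` off an event of probability
`exp (-s)`.

**High frequencies.** `∫ |charFun μ (δ x)|² dγ = ∫∫ exp (-δ² ‖y - y'‖² / 2) dμ dμ`, and a measure
with a Poincaré inequality gives mass at most `O(exp (-(3/10) √N))` to every ball of radius `√n / 2`
(`IsIsotropicPoincare.measureReal_ball_le`, by iterating the Poincaré inequality for exponentials of
the distance). Markov's inequality then makes this contribution at most `1 / N`, again off an event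
of probability `exp (-s)`.

The three exceptional events have total probability at most `3 exp (-s) = 3 n ^ (-β)`. The
estimates need `s ≥ 1` and `N ≥ C s² log n`; in the remaining cases the claim is trivial.
-/

/-! ### Gaussian moment and Maurey–Pisier inequalities -/

lemma pow_lintegral_le {α : Type*} [MeasurableSpace α] {ν : Measure α} {g : α → ℝ≥0∞}
    (hg : AEMeasurable g ν) (q : ℕ) :
    (∫⁻ a, g a ∂ν) ^ (q + 1) ≤ ν Set.univ ^ q * ∫⁻ a, g a ^ (q + 1) ∂ν := by
  have h := eLpNorm'_le_eLpNorm'_mul_rpow_measure_univ (μ := ν) (f := g) (p := 1)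
    (q := (q + 1 : ℝ)) one_pos (by simp) hg.aestronglyMeasurable
  have h2 := pow_le_pow_left' h (q + 1)
  have hq : (q + 1 : ℝ) ≠ 0 := by positivity
  simp only [eLpNorm', enorm_eq_self, ENNReal.rpow_one, div_one] at h2
  refine h2.trans (le_of_eq ?_)
  rw [mul_pow, mul_comm, ← ENNReal.rpow_natCast, ← ENNReal.rpow_natCast, ← ENNReal.rpow_mul,
    ← ENNReal.rpow_mul]
  congr 1
  · rw [← ENNReal.rpow_natCast]
    congr 1
    push_cast
    field_simp
    ring
  · push_cast
    rw [one_div, inv_mul_cancel₀ hq, ENNReal.rpow_one]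
    congr with a
    rw [← ENNReal.rpow_natCast]
    push_cast
    rfl

section Gaussian

variable {E : Type*} [NormedAddCommGroup E] [InnerProductSpace ℝ E] [FiniteDimensional ℝ E]
  [MeasurableSpace E] [BorelSpace E]

lemma stdGaussian_prod_map_rotation (s : ℝ) :
    ((stdGaussian E).prod (stdGaussian E)).map (ContinuousLinearMap.rotation s) =
      (stdGaussian E).prod (stdGaussian E) :=
  IsGaussian.map_rotation_eq_self (by simp) s

/-- **Maurey–Pisier inequality.** The two points are joined by the rotation path
`cos s • x + sin s • y`, along which position and velocity are again independent standard Gaussian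
vectors. -/
theorem maurey_pisier {F : Type*} [NormedAddCommGroup F] [NormedSpace ℝ F] [CompleteSpace F]
    {f : E → F} {f' : E → E →L[ℝ] F}
    (hf : ∀ x, HasFDerivAt f (f' x) x) (hf' : Continuous f') (q : ℕ) :
    ∫⁻ z, ‖f z.1 - f z.2‖ₑ ^ (q + 1) ∂((stdGaussian E).prod (stdGaussian E)) ≤
      ENNReal.ofReal (Real.pi / 2) ^ (q + 1) *
        ∫⁻ z, ‖f' z.1 z.2‖ₑ ^ (q + 1) ∂((stdGaussian E).prod (stdGaussian E)) := by
  set γ2 := (stdGaussian E).prod (stdGaussian E)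
  have hpi := Real.pi_pos
  have hcont : Continuous fun z : E × E => f' z.1 z.2 := by fun_prop
  have hrot : Continuous fun p : (E × E) × ℝ => ContinuousLinearMap.rotation p.2 p.1 := by
    simp only [ContinuousLinearMap.rotation_apply]
    fun_prop
  obtain ⟨g, hgdef⟩ : ∃ g : E × E → ℝ → F, ∀ z s, g z s =
    f' (ContinuousLinearMap.rotation s z).1 (ContinuousLinearMap.rotation s z).2 :=
    ⟨_, fun _ _ => rfl⟩
  have hg : Continuous (Function.uncurry g) := by
    have h := hcont.comp hrot
    refine h.congr fun p => ?_
    rw [Function.uncurry, hgdef]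
    rfl
  let ν : Measure ℝ := volume.restrict (Set.Ioc 0 (Real.pi / 2))
  have hν : ν Set.univ = ENNReal.ofReal (Real.pi / 2) := by simp [ν]
  have hpt (z : E × E) : ‖f z.1 - f z.2‖ₑ ≤ ∫⁻ s, ‖g z s‖ₑ ∂ν := by
    have hder : ∀ s ∈ Set.uIcc 0 (Real.pi / 2),
        HasDerivAt (fun s => f (Real.cos s • z.1 + Real.sin s • z.2)) (g z s) s := by
      intro s _
      have h1 : HasDerivAt (fun s => Real.cos s • z.1 + Real.sin s • z.2)
          (-Real.sin s • z.1 + Real.cos s • z.2) s :=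
        ((Real.hasDerivAt_cos s).smul_const z.1).add ((Real.hasDerivAt_sin s).smul_const z.2)
      have := (hf (Real.cos s • z.1 + Real.sin s • z.2)).comp_hasDerivAt s h1
      rw [hgdef, ContinuousLinearMap.rotation_apply]
      exact this
    have hgc : Continuous (g z) := hg.uncurry_left z
    have := intervalIntegral.integral_eq_sub_of_hasDerivAt hder (hgc.intervalIntegrable _ _)
    simp only [Real.cos_pi_div_two, Real.sin_pi_div_two, Real.cos_zero, Real.sin_zero, zero_smul,
      one_smul, zero_add, add_zero] at this
    rw [← enorm_neg, neg_sub, ← this, intervalIntegral.integral_of_le (by positivity)]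
    exact enorm_integral_le_lintegral_enorm _
  calc ∫⁻ z, ‖f z.1 - f z.2‖ₑ ^ (q + 1) ∂γ2
      ≤ ∫⁻ z, (ENNReal.ofReal (Real.pi / 2) ^ q * ∫⁻ s, ‖g z s‖ₑ ^ (q + 1) ∂ν) ∂γ2 := by
        refine lintegral_mono fun z => (pow_le_pow_left' (hpt z) _).trans ?_
        rw [← hν]
        refine pow_lintegral_le ?_ q
        have hgc : Continuous (g z) := hg.uncurry_left z
        exact hgc.enorm.measurable.aemeasurable
    _ = ENNReal.ofReal (Real.pi / 2) ^ q * ∫⁻ s, ∫⁻ z, ‖g z s‖ₑ ^ (q + 1) ∂γ2 ∂ν := by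
        have hm : Measurable fun p : (E × E) × ℝ => ‖g p.1 p.2‖ₑ ^ (q + 1) := by
          exact (hg.enorm.measurable).pow_const _
        rw [lintegral_const_mul' _ _ (by simp), lintegral_lintegral_swap hm.aemeasurable]
    _ = ENNReal.ofReal (Real.pi / 2) ^ q * ∫⁻ _s, ∫⁻ z, ‖f' z.1 z.2‖ₑ ^ (q + 1) ∂γ2 ∂ν := by
        congr 1
        refine lintegral_congr fun s => ?_
        have hm : Measurable fun z : E × E => ‖f' z.1 z.2‖ₑ ^ (q + 1) :=
          (hcont.enorm.measurable).pow_const _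
        have := lintegral_map (μ := γ2) hm
          (ContinuousLinearMap.rotation (E := E) s).continuous.measurable
        rw [stdGaussian_prod_map_rotation s] at this
        simp only [hgdef]
        exact this.symm
    _ = _ := by
        rw [lintegral_const, hν, pow_succ]
        ring

lemma stdGaussian_map_dual (L : StrongDual ℝ E) :
    (stdGaussian E).map L = gaussianReal 0 (‖L‖₊ ^ 2) := by
  rw [IsGaussian.map_eq_gaussianReal, integral_strongDual_stdGaussian, variance_dual_stdGaussian]
  congr
  ext
  simp

lemma integral_pow_gaussianReal_le (v : NNReal) (k : ℕ) (hk : 1 ≤ k) :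
    Integrable (fun x : ℝ => x ^ (2 * k)) (gaussianReal 0 v) ∧
    ∫ x, x ^ (2 * k) ∂(gaussianReal 0 v) ≤ (12 * k * v) ^ k := by
  have hk0 : (0 : ℝ) < k := by exact_mod_cast hk
  have hint : Integrable (fun x : ℝ => x ^ (2 * k)) (gaussianReal 0 v) := by
    have h := (memLp_id_gaussianReal (μ := 0) (v := v) ((2 * k : ℕ) : NNReal)).integrable_norm_pow
      (by positivity)
    simpa [Even.pow_abs (even_two_mul k)] using h
  refine ⟨hint, ?_⟩
  rcases eq_or_ne v 0 with rfl | hv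
  · have : 2 * k ≠ 0 := by omega
    simp [this]
  have hv0 : (0 : ℝ) < v := by
    have := pos_iff_ne_zero.2 hv
    exact_mod_cast this
  -- The optimal exponent in the exponential Markov inequality.
  set τ : ℝ := √(2 * k / v)
  have hτ : 0 < τ := by positivity
  have hτ2 : τ ^ 2 = 2 * k / v := Real.sq_sqrt (by positivity)
  have hmgf (t : ℝ) : ∫ x, Real.exp (t * x) ∂(gaussianReal 0 v) = Real.exp (v * t ^ 2 / 2) := by
    have := congrFun (mgf_id_gaussianReal (μ := 0) (v := v)) t
    simpa [mgf] using this
  have hpt (x : ℝ) : x ^ (2 * k) ≤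
      (2 * k) ^ (2 * k) * (v / (2 * k)) ^ k * (Real.exp (τ * x) + Real.exp (-τ * x)) := by
    have h1 : |τ * x| ^ (2 * k) / (2 * k).factorial ≤ Real.exp |τ * x| :=
      Real.pow_div_factorial_le_exp _ (abs_nonneg _) _
    have h2 : Real.exp |τ * x| ≤ Real.exp (τ * x) + Real.exp (-τ * x) := by
      rcases abs_cases (τ * x) with h | h <;> rw [h.1]
      · linarith [Real.exp_pos (-τ * x)]
      · rw [neg_mul]
        linarith [Real.exp_pos (τ * x)]
    have h3 : ((2 * k).factorial : ℝ) ≤ (2 * k) ^ (2 * k) := by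
      exact_mod_cast Nat.factorial_le_pow (2 * k)
    have h4 : |τ * x| ^ (2 * k) = (2 * k / v) ^ k * x ^ (2 * k) := by
      rw [Even.pow_abs (even_two_mul k), mul_pow, pow_mul τ, hτ2]
    rw [h4, div_le_iff₀ (by positivity)] at h1
    have h5 : (2 * k / v : ℝ) ^ k * (v / (2 * k)) ^ k = 1 := by
      rw [← mul_pow]
      field_simp
      simp
    calc x ^ (2 * k) = (v / (2 * k)) ^ k * ((2 * k / v) ^ k * x ^ (2 * k)) := by
          rw [← mul_assoc, mul_comm ((v / (2 * k) : ℝ) ^ k), h5, one_mul]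
      _ ≤ (v / (2 * k)) ^ k * ((Real.exp (τ * x) + Real.exp (-τ * x)) * (2 * k) ^ (2 * k)) := by
          refine mul_le_mul_of_nonneg_left (h1.trans ?_) (by positivity)
          exact mul_le_mul h2 h3 (by positivity) (by positivity)
      _ = _ := by ring
  calc ∫ x, x ^ (2 * k) ∂(gaussianReal 0 v)
      ≤ ∫ x, (2 * k) ^ (2 * k) * (v / (2 * k)) ^ k * (Real.exp (τ * x) + Real.exp (-τ * x))
        ∂(gaussianReal 0 v) := by
        refine integral_mono hint ?_ hpt
        exact ((integrable_exp_mul_gaussianReal τ).add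
          (integrable_exp_mul_gaussianReal (-τ))).const_mul _
    _ = (2 * k) ^ (2 * k) * (v / (2 * k)) ^ k * (2 * Real.exp k) := by
        rw [integral_const_mul, integral_add (integrable_exp_mul_gaussianReal τ)
          (integrable_exp_mul_gaussianReal (-τ)), hmgf, hmgf, neg_sq, hτ2]
        have : (v : ℝ) * (2 * k / v) / 2 = k := by field_simp
        rw [this]
        ring
    _ = 2 * (2 * k * v * Real.exp 1) ^ k := by
        rw [pow_mul, mul_pow _ (Real.exp 1), ← Real.exp_nat_mul, mul_one, ← mul_assoc, ← mul_pow]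
        have : ((2 * k : ℝ) ^ 2 * (v / (2 * k))) = 2 * k * v := by field_simp
        rw [this]
        ring
    _ ≤ 2 ^ k * (2 * k * v * Real.exp 1) ^ k := by
        gcongr
        exact le_self_pow₀ (by norm_num) (by omega)
    _ ≤ _ := by
        rw [← mul_pow]
        have h3 : Real.exp 1 ≤ 3 := by linarith [Real.exp_one_lt_d9]
        refine pow_le_pow_left₀ (by positivity) ?_ _
        nlinarith [mul_le_mul_of_nonneg_left h3 (mul_pos hk0 hv0).le]

lemma lintegral_dual_pow_le (L : StrongDual ℝ E) (k : ℕ) (hk : 1 ≤ k) :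
    ∫⁻ y, ‖L y‖ₑ ^ (2 * k) ∂(stdGaussian E) ≤ ENNReal.ofReal ((12 * k) ^ k * ‖L‖ ^ (2 * k)) := by
  have h := integral_pow_gaussianReal_le (‖L‖₊ ^ 2) k hk
  have h1 : ∫⁻ y, ‖L y‖ₑ ^ (2 * k) ∂(stdGaussian E) =
      ∫⁻ x, ENNReal.ofReal (x ^ (2 * k)) ∂(gaussianReal 0 (‖L‖₊ ^ 2)) := by
    rw [← stdGaussian_map_dual, lintegral_map (by fun_prop) (by fun_prop)]
    refine lintegral_congr fun y => ?_
    rw [← Even.pow_abs (even_two_mul k), ENNReal.ofReal_pow (abs_nonneg _), ← Real.norm_eq_abs,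
      ofReal_norm]
  rw [h1, ← ofReal_integral_eq_lintegral_ofReal h.1
    (ae_of_all _ fun x => Even.pow_nonneg (even_two_mul k) x)]
  refine ENNReal.ofReal_le_ofReal (h.2.trans (le_of_eq ?_))
  push_cast
  rw [mul_pow _ (‖L‖ ^ 2), ← pow_mul]

lemma integral_dual_sq (L : StrongDual ℝ E) :
    Integrable (fun y => (L y) ^ 2) (stdGaussian E) ∧
      ∫ y, (L y) ^ 2 ∂(stdGaussian E) = ‖L‖ ^ 2 := by
  have hmem : MemLp L 2 (stdGaussian E) :=
    L.comp_memLp' (IsGaussian.memLp_id (stdGaussian E) 2 (by simp))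
  refine ⟨hmem.integrable_sq, ?_⟩
  rw [← variance_dual_stdGaussian, variance_of_integral_eq_zero hmem.1.aemeasurable
    (integral_strongDual_stdGaussian L)]

/-- Centring at the mean costs nothing compared with symmetrization (Jensen's inequality). -/
lemma lintegral_sub_integral_pow_le {α F : Type*} [MeasurableSpace α] [NormedAddCommGroup F]
    [NormedSpace ℝ F] [CompleteSpace F] {ν : Measure α} [IsProbabilityMeasure ν] {f : α → F}
    (hf : Integrable f ν) (q : ℕ) :
    ∫⁻ x, ‖f x - ∫ y, f y ∂ν‖ₑ ^ (q + 1) ∂ν ≤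
      ∫⁻ z, ‖f z.1 - f z.2‖ₑ ^ (q + 1) ∂(ν.prod ν) := by
  have hm : AEMeasurable (fun z : α × α => ‖f z.1 - f z.2‖ₑ ^ (q + 1)) (ν.prod ν) :=
    ((hf.1.comp_fst.sub hf.1.comp_snd).enorm).pow_const _
  rw [lintegral_prod _ hm]
  refine lintegral_mono fun x => ?_
  have h1 : f x - ∫ y, f y ∂ν = ∫ y, (f x - f y) ∂ν := by
    rw [integral_sub (integrable_const _) hf]
    simp
  have hm2 : AEMeasurable (fun y => ‖f x - f y‖ₑ) ν :=
    (aestronglyMeasurable_const.sub hf.1).enorm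
  calc ‖f x - ∫ y, f y ∂ν‖ₑ ^ (q + 1) ≤ (∫⁻ y, ‖f x - f y‖ₑ ∂ν) ^ (q + 1) := by
        rw [h1]
        exact pow_le_pow_left' (enorm_integral_le_lintegral_enorm _) _
    _ ≤ _ := by simpa using pow_lintegral_le hm2 q

/-- Gaussian moment inequality: the `2k`-th central moment of `f` is at most
`(π/2)^(2k) (12 k)^k` times the `2k`-th moment of its gradient. -/
theorem integral_centered_pow_le {f : E → ℝ} {f' : E → E →L[ℝ] ℝ} {B M : ℝ}
    (hf : ∀ x, HasFDerivAt f (f' x) x) (hf' : Continuous f') (hB : ∀ x, |f x| ≤ B)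
    (hM : ∀ x, ‖f' x‖ ≤ M) (k : ℕ) (hk : 1 ≤ k) :
    ∫ x, (f x - ∫ y, f y ∂(stdGaussian E)) ^ (2 * k) ∂(stdGaussian E) ≤
      ((Real.pi / 2) ^ 2 * (12 * k)) ^ k * ∫ x, ‖f' x‖ ^ (2 * k) ∂(stdGaussian E) := by
  set γ := stdGaussian E
  have hfc : Continuous f := continuous_iff_continuousAt.2 fun x => (hf x).continuousAt
  have hint : Integrable f γ :=
    Integrable.of_bound hfc.aestronglyMeasurable B (ae_of_all _ hB)
  have hint' : Integrable (fun x => ‖f' x‖ ^ (2 * k)) γ := by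
    refine Integrable.of_bound (by fun_prop) (M ^ (2 * k)) (ae_of_all _ fun x => ?_)
    rw [norm_pow, norm_norm]
    exact pow_le_pow_left₀ (norm_nonneg _) (hM x) _
  obtain ⟨q, hq⟩ : ∃ q, 2 * k = q + 1 := ⟨2 * k - 1, by omega⟩
  have hcont : Continuous fun z : E × E => f' z.1 z.2 := by fun_prop
  have key : ∫⁻ x, ‖f x - ∫ y, f y ∂γ‖ₑ ^ (2 * k) ∂γ ≤
      ENNReal.ofReal (((Real.pi / 2) ^ 2 * (12 * k)) ^ k * ∫ x, ‖f' x‖ ^ (2 * k) ∂γ) := by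
    calc _ ≤ ENNReal.ofReal (Real.pi / 2) ^ (2 * k) * ∫⁻ z, ‖f' z.1 z.2‖ₑ ^ (2 * k) ∂(γ.prod γ) := by
          rw [hq]
          exact (lintegral_sub_integral_pow_le hint q).trans (maurey_pisier hf hf' q)
      _ ≤ ENNReal.ofReal (Real.pi / 2) ^ (2 * k) *
          ∫⁻ x, ENNReal.ofReal ((12 * k) ^ k * ‖f' x‖ ^ (2 * k)) ∂γ := by
          gcongr
          rw [lintegral_prod _ (hcont.enorm.measurable.pow_const _).aemeasurable]
          exact lintegral_mono fun x => lintegral_dual_pow_le (f' x) k hk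
      _ = _ := by
          rw [← ofReal_integral_eq_lintegral_ofReal (hint'.const_mul _)
            (ae_of_all _ fun x => by positivity), ← ENNReal.ofReal_pow (by positivity),
            ← ENNReal.ofReal_mul (by positivity), integral_const_mul, ← mul_assoc,
            mul_pow ((Real.pi / 2) ^ 2), ← pow_mul]
  have hint2 : Integrable (fun x => (f x - ∫ y, f y ∂γ) ^ (2 * k)) γ := by
    refine Integrable.of_bound (by fun_prop) ((B + |∫ y, f y ∂γ|) ^ (2 * k))
      (ae_of_all _ fun x => ?_)
    rw [norm_pow]
    refine pow_le_pow_left₀ (norm_nonneg _) ?_ _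
    exact (norm_sub_le _ _).trans (add_le_add (hB x) le_rfl)
  have heq : ∫⁻ x, ‖f x - ∫ y, f y ∂γ‖ₑ ^ (2 * k) ∂γ =
      ENNReal.ofReal (∫ x, (f x - ∫ y, f y ∂γ) ^ (2 * k) ∂γ) := by
    rw [ofReal_integral_eq_lintegral_ofReal hint2
      (ae_of_all _ fun x => Even.pow_nonneg (even_two_mul k) _)]
    refine lintegral_congr fun x => ?_
    rw [← Even.pow_abs (even_two_mul k), ENNReal.ofReal_pow (abs_nonneg _), ← Real.norm_eq_abs,
      ofReal_norm]
  rw [heq] at key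
  exact (ENNReal.ofReal_le_ofReal_iff (mul_nonneg (by positivity)
    (integral_nonneg fun x => by positivity))).1 key

/-- Gaussian Poincaré inequality for vector-valued maps. The hypothesis `hh` bounds the squared
Hilbert–Schmidt norm of the derivative. -/
theorem integral_centered_norm_sq_le {F : Type*} [NormedAddCommGroup F] [InnerProductSpace ℝ F]
    [CompleteSpace F] [SecondCountableTopology F]
    {f : E → F} {f' : E → E →L[ℝ] F} {h : E → ℝ} {B : ℝ}
    (hf : ∀ x, HasFDerivAt f (f' x) x) (hf' : Continuous f') (hB : ∀ x, ‖f x‖ ≤ B)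
    (hint : Integrable h (stdGaussian E))
    (hh : ∀ x, ∫ y, ‖f' x y‖ ^ 2 ∂(stdGaussian E) ≤ h x) :
    ∫ x, ‖f x - ∫ y, f y ∂(stdGaussian E)‖ ^ 2 ∂(stdGaussian E) ≤
      (Real.pi / 2) ^ 2 * ∫ x, h x ∂(stdGaussian E) := by
  set γ := stdGaussian E
  have hfc : Continuous f := continuous_iff_continuousAt.2 fun x => (hf x).continuousAt
  have hfi : Integrable f γ :=
    Integrable.of_bound hfc.aestronglyMeasurable B (ae_of_all _ hB)
  have hcont : Continuous fun z : E × E => f' z.1 z.2 := by fun_prop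
  have hh0 (x : E) : 0 ≤ h x := (integral_nonneg fun y => by positivity).trans (hh x)
  have key : ∫⁻ x, ‖f x - ∫ y, f y ∂γ‖ₑ ^ 2 ∂γ ≤
      ENNReal.ofReal ((Real.pi / 2) ^ 2 * ∫ x, h x ∂γ) := by
    calc _ ≤ ENNReal.ofReal (Real.pi / 2) ^ 2 * ∫⁻ z, ‖f' z.1 z.2‖ₑ ^ 2 ∂(γ.prod γ) :=
          (lintegral_sub_integral_pow_le hfi 1).trans (maurey_pisier hf hf' 1)
      _ ≤ ENNReal.ofReal (Real.pi / 2) ^ 2 * ∫⁻ x, ENNReal.ofReal (h x) ∂γ := by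
          gcongr
          rw [lintegral_prod _ (hcont.enorm.measurable.pow_const _).aemeasurable]
          refine lintegral_mono fun x => ?_
          have hmem : MemLp (f' x) 2 γ :=
            (f' x).comp_memLp' (IsGaussian.memLp_id γ 2 (by simp))
          have : ∫⁻ y, ‖f' x y‖ₑ ^ 2 ∂γ = ENNReal.ofReal (∫ y, ‖f' x y‖ ^ 2 ∂γ) := by
            rw [ofReal_integral_eq_lintegral_ofReal (hmem.integrable_norm_pow two_ne_zero)
              (ae_of_all _ fun y => by positivity)]
            refine lintegral_congr fun y => ?_
            rw [ENNReal.ofReal_pow (norm_nonneg _), ofReal_norm]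
          simpa [this] using ENNReal.ofReal_le_ofReal (hh x)
      _ = _ := by
          rw [← ofReal_integral_eq_lintegral_ofReal hint (ae_of_all _ hh0),
            ← ENNReal.ofReal_pow (by positivity), ← ENNReal.ofReal_mul (by positivity)]
  have hint2 : Integrable (fun x => ‖f x - ∫ y, f y ∂γ‖ ^ 2) γ := by
    refine Integrable.of_bound (by fun_prop) ((B + ‖∫ y, f y ∂γ‖) ^ 2) (ae_of_all _ fun x => ?_)
    rw [norm_pow, norm_norm]
    refine pow_le_pow_left₀ (norm_nonneg _) ?_ _
    exact (norm_sub_le _ _).trans (add_le_add (hB x) le_rfl)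
  have heq : ∫⁻ x, ‖f x - ∫ y, f y ∂γ‖ₑ ^ 2 ∂γ =
      ENNReal.ofReal (∫ x, ‖f x - ∫ y, f y ∂γ‖ ^ 2 ∂γ) := by
    rw [ofReal_integral_eq_lintegral_ofReal hint2 (ae_of_all _ fun x => by positivity)]
    refine lintegral_congr fun y => ?_
    rw [ENNReal.ofReal_pow (norm_nonneg _), ofReal_norm]
  rw [heq] at key
  exact (ENNReal.ofReal_le_ofReal_iff (mul_nonneg (by positivity)
    (integral_nonneg hh0))).1 key

end Gaussian

/-! ### Isotropic measures with a Poincaré inequality -/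

/-- A centred isotropic law `μ` on `ℝⁿ` satisfying the Poincaré inequality with constant `l > 0`. -/
structure IsIsotropicPoincare {n : ℕ} (μ : Measure (EuclideanSpace ℝ (Fin n))) (l : ℝ) : Prop where
  memLp : MemLp id 2 μ
  mean : ∀ v : EuclideanSpace ℝ (Fin n), ∫ x, inner ℝ v x ∂μ = 0
  secondMoment : ∀ i j : Fin n, ∫ x, x i * x j ∂μ = if i = j then 1 else 0
  pos : 0 < l
  poincare : ∀ u : EuclideanSpace ℝ (Fin n) → ℝ, ContDiff ℝ (⊤ : ℕ∞) u →
    ENNReal.ofReal l * evariance u μ ≤ ∫⁻ x, ‖gradient u x‖ₑ ^ 2 ∂μ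

lemma mul_exp_neg_le_one (z : ℝ) : z * Real.exp (-z) ≤ 1 := by
  rw [Real.exp_neg, ← div_eq_mul_inv, div_le_one (Real.exp_pos _)]
  linarith [Real.add_one_le_exp z]

namespace IsIsotropicPoincare

variable {n : ℕ} {μ : Measure (EuclideanSpace ℝ (Fin n))} {l : ℝ}

lemma memLp_apply (h : IsIsotropicPoincare μ l) (i : Fin n) :
    MemLp (fun x : EuclideanSpace ℝ (Fin n) => x i) 2 μ :=
  (EuclideanSpace.proj (𝕜 := ℝ) i).comp_memLp' h.memLp

lemma integrable_mul (h : IsIsotropicPoincare μ l) (i j : Fin n) :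
    Integrable (fun x : EuclideanSpace ℝ (Fin n) => x i * x j) μ :=
  (h.memLp_apply i).integrable_mul (h.memLp_apply j)

lemma integrable_norm_sq (h : IsIsotropicPoincare μ l) :
    Integrable (fun x : EuclideanSpace ℝ (Fin n) => ‖x‖ ^ 2) μ :=
  h.memLp.integrable_norm_pow two_ne_zero

lemma memLp_inner (h : IsIsotropicPoincare μ l) (v : EuclideanSpace ℝ (Fin n)) :
    MemLp (fun x => inner ℝ v x) 2 μ :=
  (innerSL ℝ v).comp_memLp' h.memLp

lemma integral_norm_sq (h : IsIsotropicPoincare μ l) :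
    ∫ x, ‖x‖ ^ 2 ∂μ = n := by
  simp_rw [EuclideanSpace.real_norm_sq_eq]
  rw [integral_finsetSum _ fun i _ => by simpa [sq] using h.integrable_mul i i]
  simp [sq, h.secondMoment]

lemma integral_sum_mul_sq (h : IsIsotropicPoincare μ l) (b : Fin n → ℝ) :
    Integrable (fun x : EuclideanSpace ℝ (Fin n) => (∑ j, b j * x j) ^ 2) μ ∧
    ∫ x, (∑ j, b j * x j) ^ 2 ∂μ = ∑ j, b j ^ 2 := by
  have hexp (x : EuclideanSpace ℝ (Fin n)) :
      (∑ j, b j * x j) ^ 2 = ∑ i, ∑ j, b i * b j * (x i * x j) := by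
    rw [sq, Finset.sum_mul_sum]
    refine Finset.sum_congr rfl fun i _ => Finset.sum_congr rfl fun j _ => by ring
  have hi (i j : Fin n) := (h.integrable_mul i j).const_mul (b i * b j)
  simp_rw [hexp]
  refine ⟨integrable_finsetSum _ fun i _ => integrable_finsetSum _ fun j _ => hi i j, ?_⟩
  rw [integral_finsetSum _ fun i _ => integrable_finsetSum _ fun j _ => hi i j]
  refine Finset.sum_congr rfl fun i _ => ?_
  rw [integral_finsetSum _ fun j _ => hi i j]
  simp [integral_const_mul, h.secondMoment, sq]

lemma integral_inner_sq (h : IsIsotropicPoincare μ l) (v : EuclideanSpace ℝ (Fin n)) :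
    ∫ x, inner ℝ v x ^ 2 ∂μ = ‖v‖ ^ 2 := by
  have := (h.integral_sum_mul_sq (fun j => v j)).2
  rw [EuclideanSpace.real_norm_sq_eq, ← this]
  congr with x
  simp [PiLp.inner_apply, mul_comm]

variable [IsProbabilityMeasure μ]

lemma variance_le (h : IsIsotropicPoincare μ l) {u : EuclideanSpace ℝ (Fin n) → ℝ}
    {G : EuclideanSpace ℝ (Fin n) → EuclideanSpace ℝ (Fin n)} (hu : ContDiff ℝ (⊤ : ℕ∞) u)
    (hG : ∀ x, HasGradientAt u (G x) x) (hint : Integrable (fun x => ‖G x‖ ^ 2) μ) :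
    MemLp u 2 μ ∧ ∫ x, (u x - ∫ y, u y ∂μ) ^ 2 ∂μ ≤ (∫ x, ‖G x‖ ^ 2 ∂μ) / l := by
  have hp := h.poincare u hu
  have h1 : ∫⁻ x, ‖gradient u x‖ₑ ^ 2 ∂μ = ENNReal.ofReal (∫ x, ‖G x‖ ^ 2 ∂μ) := by
    rw [ofReal_integral_eq_lintegral_ofReal hint (ae_of_all _ fun x => by positivity)]
    refine lintegral_congr fun x => ?_
    rw [(hG x).gradient, ENNReal.ofReal_pow (norm_nonneg _), ofReal_norm]
  rw [h1] at hp
  have hm : AEStronglyMeasurable u μ := hu.continuous.aestronglyMeasurable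
  have hlt : evariance u μ < ∞ := by
    by_contra hc
    rw [not_lt, top_le_iff] at hc
    rw [hc, ENNReal.mul_top (by simpa using h.pos)] at hp
    exact absurd hp (by simp)
  have hmem := (evariance_lt_top_iff_memLp hm).1 hlt
  refine ⟨hmem, ?_⟩
  rw [← variance_eq_integral hm.aemeasurable, le_div_iff₀ h.pos, mul_comm]
  rw [← hmem.ofReal_variance_eq, ← ENNReal.ofReal_mul h.pos.le] at hp
  exact (ENNReal.ofReal_le_ofReal_iff (integral_nonneg fun x => by positivity)).1 hp

lemma integrable_norm (h : IsIsotropicPoincare μ l) :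
    Integrable (fun x : EuclideanSpace ℝ (Fin n) => ‖x‖) μ :=
  (h.memLp.integrable (by norm_num)).norm

/-- Linear functions show that the Poincaré constant of an isotropic law is at most one. -/
lemma le_one (h : IsIsotropicPoincare μ l) (hn : 1 ≤ n) : l ≤ 1 := by
  let e : EuclideanSpace ℝ (Fin n) := EuclideanSpace.single ⟨0, hn⟩ 1
  have he : ‖e‖ = 1 := by simp [e]
  have hG (x : EuclideanSpace ℝ (Fin n)) : HasGradientAt (fun x => inner ℝ e x) e x := by
    rw [hasGradientAt_iff_hasFDerivAt]
    exact (innerSL ℝ e).hasFDerivAt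
  have := (h.variance_le (u := fun x => inner ℝ e x) (G := fun _ => e)
    (innerSL ℝ e).contDiff hG (integrable_const _)).2
  rw [h.mean e] at this
  simp only [sub_zero, h.integral_inner_sq e, he] at this
  have hl := h.pos
  rw [le_div_iff₀ hl] at this
  simpa using this

lemma integral_norm_sq_sub_sq (h : IsIsotropicPoincare μ l) :
    Integrable (fun x : EuclideanSpace ℝ (Fin n) => (‖x‖ ^ 2 - n) ^ 2) μ ∧
      ∫ x, (‖x‖ ^ 2 - n) ^ 2 ∂μ ≤ 4 * n / l := by
  have hG (x : EuclideanSpace ℝ (Fin n)) :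
      HasGradientAt (fun x => ‖x‖ ^ 2) ((2 : ℝ) • x) x := by
    rw [hasGradientAt_iff_hasFDerivAt]
    convert! (hasFDerivAt_id x).norm_sq using 1
    ext v
    simp
  have hn (x : EuclideanSpace ℝ (Fin n)) : ‖(2 : ℝ) • x‖ ^ 2 = 4 * ‖x‖ ^ 2 := by
    rw [norm_smul, mul_pow]
    norm_num
  have := h.variance_le (u := fun x => ‖x‖ ^ 2) (G := fun x => (2 : ℝ) • x)
    (contDiff_norm_sq ℝ) hG (by simpa only [hn] using h.integrable_norm_sq.const_mul 4)
  simp only [hn, integral_const_mul, h.integral_norm_sq] at this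
  exact ⟨(this.1.sub (memLp_const _)).integrable_sq, this.2⟩

/-- The covariance between the position and a function is controlled by the variance of the
function; for the Gaussian profile the Poincaré inequality bounds the latter. -/
lemma norm_integral_exp_smul_sq_le (h : IsIsotropicPoincare μ l) {c : ℝ} (hc : 0 ≤ c) :
    ‖∫ x, Real.exp (-c * ‖x‖ ^ 2 / 2) • x ∂μ‖ ^ 2 ≤ c / l := by
  set φ : EuclideanSpace ℝ (Fin n) → ℝ := fun x => Real.exp (-c * ‖x‖ ^ 2 / 2)
  have hG (x : EuclideanSpace ℝ (Fin n)) : HasGradientAt φ (-(c * φ x) • x) x := by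
    rw [hasGradientAt_iff_hasFDerivAt]
    convert! ((((hasFDerivAt_id x).norm_sq).const_mul (-c)).mul_const (1 / 2)).exp using 1
    · ext y
      simp [φ]
      ring_nf
    · ext v
      simp [φ]
      ring_nf
  have hφ : ContDiff ℝ (⊤ : ℕ∞) φ := by
    have := contDiff_norm_sq (E := EuclideanSpace ℝ (Fin n)) ℝ (n := (⊤ : ℕ∞))
    exact Real.contDiff_exp.comp ((contDiff_const.mul this).div_const 2)
  have hb (x : EuclideanSpace ℝ (Fin n)) : ‖-(c * φ x) • x‖ ^ 2 ≤ c := by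
    have h1 : ‖-(c * φ x) • x‖ ^ 2 = c * ((c * ‖x‖ ^ 2) * Real.exp (-(c * ‖x‖ ^ 2))) := by
      have : Real.exp (-(c * ‖x‖ ^ 2)) = φ x ^ 2 := by
        simp only [φ]
        rw [← Real.exp_nat_mul]
        congr 1
        push_cast
        ring
      rw [this, norm_smul, mul_pow, Real.norm_eq_abs, sq_abs]
      ring
    rw [h1]
    exact mul_le_of_le_one_right hc (mul_exp_neg_le_one _)
  have hφc := hφ.continuous
  have hint : Integrable (fun x => ‖-(c * φ x) • x‖ ^ 2) μ :=
    Integrable.of_bound (by fun_prop) c (ae_of_all _ fun x => by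
      rw [norm_pow, norm_norm]
      exact hb x)
  have hvar := h.variance_le hφ hG hint
  have hφ1 (x : EuclideanSpace ℝ (Fin n)) : ‖φ x‖ ≤ 1 := by
    rw [Real.norm_of_nonneg (Real.exp_pos _).le]
    exact Real.exp_le_one_iff.2 (by nlinarith [mul_nonneg hc (sq_nonneg ‖x‖)])
  have hi : Integrable (fun x => φ x • x) μ :=
    (h.memLp.integrable (by norm_num)).bdd_smul 1 hφc.aestronglyMeasurable (ae_of_all _ hφ1)
  set v := ∫ x, φ x • x ∂μ
  set m := ∫ x, φ x ∂μ
  have hvx := h.memLp_inner v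
  have hvi := hvx.integrable (by norm_num)
  have hφi : Integrable φ μ := Integrable.of_bound hφc.aestronglyMeasurable 1 (ae_of_all _ hφ1)
  have h2 : ‖v‖ ^ 2 = ∫ x, (φ x - m) * inner ℝ v x ∂μ := by
    rw [← real_inner_self_eq_norm_sq]
    have h3 : inner ℝ v v = ∫ x, inner ℝ v (φ x • x) ∂μ :=
      (integral_inner hi v).symm
    have h4 : ∫ x, (φ x - m) * inner ℝ v x ∂μ =
        ∫ x, φ x * inner ℝ v x ∂μ - ∫ x, m * inner ℝ v x ∂μ := by
      rw [← integral_sub _ (hvi.const_mul m)]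
      · simp_rw [sub_mul]
      · exact hvi.bdd_mul hφc.aestronglyMeasurable (ae_of_all _ hφ1)
    rw [h3, h4, integral_const_mul, h.mean v, mul_zero, sub_zero]
    simp_rw [inner_smul_right]
  have hsq : Integrable (fun x => (φ x - m) ^ 2) μ := (hvar.1.sub (memLp_const m)).integrable_sq
  have h5 : ∫ x, (φ x - m) * inner ℝ v x ∂μ ≤
      ∫ x, ((φ x - m) ^ 2 / 2 + inner ℝ v x ^ 2 / 2) ∂μ := by
    refine integral_mono ?_ ((hsq.div_const 2).add (hvx.integrable_sq.div_const 2)) fun x => ?_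
    · exact (hvar.1.sub (memLp_const m)).integrable_mul hvx
    · simp only
      nlinarith [sq_nonneg (φ x - m - inner ℝ v x)]
  rw [integral_add (hsq.div_const 2) (hvx.integrable_sq.div_const 2), integral_div, integral_div,
    h.integral_inner_sq v] at h5
  have h6 : ∫ x, ‖-(c * φ x) • x‖ ^ 2 ∂μ ≤ c := by
    have := integral_mono hint (integrable_const c) hb
    simpa using this
  have h7 := hvar.2.trans (div_le_div_of_nonneg_right h6 h.pos.le)
  linarith

/-- Hilbert–Schmidt bound: the matrix `∫ ψ (x ⊗ x - I) dμ` has squared Hilbert–Schmidt norm at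
most `4 / l` whenever `|ψ| ≤ 1`. The matrix is tested against the quadratic form it defines. -/
lemma sum_integral_mul_sq_le (h : IsIsotropicPoincare μ l) {ψ : EuclideanSpace ℝ (Fin n) → ℝ}
    (hψ : Continuous ψ) (hψ1 : ∀ x, |ψ x| ≤ 1) :
    ∑ i, ∑ j, (∫ x, ψ x * (x i * x j - if i = j then 1 else 0) ∂μ) ^ 2 ≤ 4 / l := by
  set b : Fin n → Fin n → ℝ := fun i j => ∫ x, ψ x * (x i * x j - if i = j then 1 else 0) ∂μ
    with hb
  have hsymm (i j : Fin n) : b i j = b j i := by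
    simp only [hb]
    congr with x
    simp only [mul_comm (x i), eq_comm (a := i)]
  have hcoord (i : Fin n) : ContDiff ℝ (⊤ : ℕ∞) fun x : EuclideanSpace ℝ (Fin n) => x i :=
    (EuclideanSpace.proj (𝕜 := ℝ) i).contDiff
  set q : EuclideanSpace ℝ (Fin n) → ℝ :=
    fun x => ∑ i, ∑ j, b i j * (x i * x j - if i = j then 1 else 0)
  have hq : ContDiff ℝ (⊤ : ℕ∞) q :=
    ContDiff.sum fun i _ => ContDiff.sum fun j _ =>
      contDiff_const.mul (((hcoord i).mul (hcoord j)).sub contDiff_const)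
  set G : EuclideanSpace ℝ (Fin n) → EuclideanSpace ℝ (Fin n) :=
    fun x => WithLp.toLp 2 fun i => 2 * ∑ j, b i j * x j
  have hG (x : EuclideanSpace ℝ (Fin n)) : HasGradientAt q (G x) x := by
    rw [hasGradientAt_iff_hasFDerivAt]
    have hc (i : Fin n) : HasFDerivAt (fun x : EuclideanSpace ℝ (Fin n) => x i)
        (EuclideanSpace.proj (𝕜 := ℝ) i) x := (EuclideanSpace.proj (𝕜 := ℝ) i).hasFDerivAt
    have hd : HasFDerivAt q (∑ i, ∑ j, b i j • (x i • (EuclideanSpace.proj (𝕜 := ℝ) j :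
        EuclideanSpace ℝ (Fin n) →L[ℝ] ℝ) + x j • EuclideanSpace.proj (𝕜 := ℝ) i)) x :=
      HasFDerivAt.fun_sum fun i _ => HasFDerivAt.fun_sum fun j _ =>
        (((hc i).mul (hc j)).sub_const _).const_mul _
    convert! hd using 1
    ext v
    simp only [InnerProductSpace.toDual_apply_apply, PiLp.inner_apply, G, RCLike.inner_apply,
      conj_trivial, FunLike.coe_sum, Finset.sum_apply, FunLike.coe_smul, Pi.smul_apply,
      FunLike.coe_add, Pi.add_apply, smul_eq_mul, PiLp.proj_apply, mul_add,
      Finset.sum_add_distrib]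
    have h1 : ∑ i, ∑ j, b i j * (x i * v j) = ∑ i, ∑ j, b i j * (x j * v i) := by
      rw [Finset.sum_comm]
      simp_rw [fun i j => hsymm j i]
    rw [h1, ← Finset.sum_add_distrib]
    refine Finset.sum_congr rfl fun i _ => ?_
    rw [← two_mul, mul_left_comm, Finset.mul_sum]
    congr 1
    refine Finset.sum_congr rfl fun j _ => by ring
  have hGn (x : EuclideanSpace ℝ (Fin n)) : ‖G x‖ ^ 2 = ∑ i, 4 * (∑ j, b i j * x j) ^ 2 := by
    rw [EuclideanSpace.real_norm_sq_eq]
    refine Finset.sum_congr rfl fun i _ => ?_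
    simp only [G]
    ring
  have hGi (i : Fin n) := (h.integral_sum_mul_sq (b i)).1.const_mul 4
  have hGint : Integrable (fun x => ‖G x‖ ^ 2) μ := by
    simp_rw [hGn]
    exact integrable_finsetSum _ fun i _ => hGi i
  set S := ∑ i, ∑ j, b i j ^ 2
  have hGS : ∫ x, ‖G x‖ ^ 2 ∂μ = 4 * S := by
    simp_rw [hGn]
    rw [integral_finsetSum _ fun i _ => hGi i]
    simp_rw [integral_const_mul, (h.integral_sum_mul_sq _).2]
    rw [← Finset.mul_sum]
  have hqi (i j : Fin n) : Integrable
      (fun x : EuclideanSpace ℝ (Fin n) => x i * x j - if i = j then 1 else 0) μ :=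
    (h.integrable_mul i j).sub (integrable_const _)
  have hq0 : ∫ x, q x ∂μ = 0 := by
    rw [integral_finsetSum _ fun i _ => integrable_finsetSum _ fun j _ => (hqi i j).const_mul _]
    refine Finset.sum_eq_zero fun i _ => ?_
    rw [integral_finsetSum _ fun j _ => (hqi i j).const_mul _]
    refine Finset.sum_eq_zero fun j _ => ?_
    rw [integral_const_mul, integral_sub (h.integrable_mul i j) (integrable_const _),
      h.secondMoment]
    simp
  have hvar := h.variance_le hq hG hGint
  rw [hq0, hGS] at hvar
  simp only [sub_zero] at hvar
  have hψi (i j : Fin n) : Integrable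
      (fun x : EuclideanSpace ℝ (Fin n) => ψ x * (x i * x j - if i = j then 1 else 0)) μ :=
    (hqi i j).bdd_mul hψ.aestronglyMeasurable (ae_of_all _ hψ1)
  have hS : S = ∫ x, ψ x * q x ∂μ := by
    have h1 (x : EuclideanSpace ℝ (Fin n)) : ψ x * q x =
        ∑ i, ∑ j, b i j * (ψ x * (x i * x j - if i = j then 1 else 0)) := by
      simp only [q, Finset.mul_sum]
      refine Finset.sum_congr rfl fun i _ => Finset.sum_congr rfl fun j _ => by ring
    simp_rw [h1]
    rw [integral_finsetSum _ fun i _ => integrable_finsetSum _ fun j _ => (hψi i j).const_mul _]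
    refine Finset.sum_congr rfl fun i _ => ?_
    rw [integral_finsetSum _ fun j _ => (hψi i j).const_mul _]
    refine Finset.sum_congr rfl fun j _ => ?_
    rw [integral_const_mul, sq]
  have hl := h.pos
  have hle : S ≤ ∫ x, (2 / l + l / 8 * q x ^ 2) ∂μ := by
    rw [hS]
    refine integral_mono ?_ ((integrable_const _).add (hvar.1.integrable_sq.const_mul _))
      fun x => ?_
    · exact (hvar.1.integrable (by norm_num)).bdd_mul hψ.aestronglyMeasurable (ae_of_all _ hψ1)
    · have h1 : ψ x * q x ≤ |q x| := by
        calc ψ x * q x ≤ |ψ x * q x| := le_abs_self _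
          _ = |ψ x| * |q x| := abs_mul _ _
          _ ≤ 1 * |q x| := by gcongr; exact hψ1 x
          _ = |q x| := one_mul _
      have h2 : 2 / l + l / 8 * q x ^ 2 - |q x| = l / 8 * (|q x| - 4 / l) ^ 2 := by
        rw [← sq_abs (q x)]
        field_simp
        ring
      have h3 : 0 ≤ l / 8 * (|q x| - 4 / l) ^ 2 := by positivity
      linarith
  rw [integral_add (integrable_const _) (hvar.1.integrable_sq.const_mul _),
    integral_const_mul] at hle
  simp only [integral_const, probReal_univ, smul_eq_mul, one_mul] at hle
  have h4 : l / 8 * ∫ x, q x ^ 2 ∂μ ≤ l / 8 * (4 * S / l) := by gcongr; exact hvar.2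
  have h5 : l / 8 * (4 * S / l) = S / 2 := by field_simp; ring
  have h6 : 4 / l = 2 * (2 / l) := by ring
  rw [h6]
  linarith

end IsIsotropicPoincare

/-! ### Small balls -/

namespace IsIsotropicPoincare

variable {n : ℕ} {μ : Measure (EuclideanSpace ℝ (Fin n))} [IsProbabilityMeasure μ] {l : ℝ}

lemma hasGradientAt_sqrt_one_add (y x : EuclideanSpace ℝ (Fin n)) :
    HasGradientAt (fun x => √(1 + ‖x - y‖ ^ 2)) ((√(1 + ‖x - y‖ ^ 2))⁻¹ • (x - y)) x := by
  rw [hasGradientAt_iff_hasFDerivAt]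
  have hpos : 1 + ‖x - y‖ ^ 2 ≠ 0 := by positivity
  convert! ((((hasFDerivAt_id x).sub_const y).norm_sq).const_add 1).sqrt hpos using 1
  ext v
  have : √(1 + ‖x - y‖ ^ 2) ≠ 0 := by positivity
  simp
  field_simp

lemma contDiff_sqrt_one_add (y : EuclideanSpace ℝ (Fin n)) :
    ContDiff ℝ (⊤ : ℕ∞) fun x => √(1 + ‖x - y‖ ^ 2) :=
  ContDiff.sqrt (contDiff_const.add ((contDiff_norm_sq ℝ).comp (contDiff_id.sub contDiff_const)))
    fun x => by positivity

lemma norm_inv_sqrt_smul_sq_le (x y : EuclideanSpace ℝ (Fin n)) :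
    ‖(√(1 + ‖x - y‖ ^ 2))⁻¹ • (x - y)‖ ^ 2 ≤ 1 := by
  rw [norm_smul, mul_pow, norm_inv, inv_pow, Real.norm_eq_abs, sq_abs,
    Real.sq_sqrt (by positivity), inv_mul_le_iff₀ (by positivity)]
  linarith

lemma integrable_norm_sub_sq (h : IsIsotropicPoincare μ l) (y : EuclideanSpace ℝ (Fin n)) :
    Integrable (fun x => ‖x - y‖ ^ 2) μ :=
  (h.memLp.sub (memLp_const y)).integrable_norm_pow two_ne_zero

lemma integral_norm_sub_sq (h : IsIsotropicPoincare μ l) (y : EuclideanSpace ℝ (Fin n)) :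
    ∫ x, ‖x - y‖ ^ 2 ∂μ = n + ‖y‖ ^ 2 := by
  have h1 (x : EuclideanSpace ℝ (Fin n)) :
      ‖x - y‖ ^ 2 = ‖x‖ ^ 2 - 2 * inner ℝ y x + ‖y‖ ^ 2 := by
    rw [norm_sub_sq_real, real_inner_comm]
  have hi := ((h.memLp_inner y).integrable (by norm_num)).const_mul 2
  simp_rw [h1]
  rw [integral_add (by exact h.integrable_norm_sq.sub hi) (integrable_const _),
    integral_sub h.integrable_norm_sq hi, integral_const_mul, h.mean y, h.integral_norm_sq]
  simp

/-- One step of the Gromov–Milman iteration for the Laplace transform of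
`u = √(1 + ‖x - y‖²)`. -/
lemma integral_exp_le_sq (h : IsIsotropicPoincare μ l) (y : EuclideanSpace ℝ (Fin n)) {τ : ℝ}
    (hτ0 : 0 ≤ τ) (hτ : τ ^ 2 ≤ l) :
    ∫ x, Real.exp (-τ * √(1 + ‖x - y‖ ^ 2)) ∂μ ≤
      Real.exp (τ ^ 2 / (2 * l)) *
        (∫ x, Real.exp (-(τ / 2) * √(1 + ‖x - y‖ ^ 2)) ∂μ) ^ 2 := by
  set u : EuclideanSpace ℝ (Fin n) → ℝ := fun x => √(1 + ‖x - y‖ ^ 2)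
  have hl := h.pos
  have hu : ContDiff ℝ (⊤ : ℕ∞) u := contDiff_sqrt_one_add y
  set f : EuclideanSpace ℝ (Fin n) → ℝ := fun x => Real.exp (-(τ / 2) * u x)
  have hf : ContDiff ℝ (⊤ : ℕ∞) f := Real.contDiff_exp.comp (contDiff_const.mul hu)
  have hf2 (x : EuclideanSpace ℝ (Fin n)) : f x ^ 2 = Real.exp (-τ * u x) := by
    simp only [f]
    rw [← Real.exp_nat_mul]
    congr 1
    push_cast
    ring
  have hG (x : EuclideanSpace ℝ (Fin n)) :
      HasGradientAt f ((f x * -(τ / 2)) • ((u x)⁻¹ • (x - y))) x := by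
    have h0 := hasGradientAt_sqrt_one_add y x
    rw [hasGradientAt_iff_hasFDerivAt] at h0 ⊢
    convert! (h0.const_mul (-(τ / 2))).exp using 1
    ext v
    simp [f, u]
    ring
  have hb (x : EuclideanSpace ℝ (Fin n)) :
      ‖(f x * -(τ / 2)) • ((u x)⁻¹ • (x - y))‖ ^ 2 ≤ τ ^ 2 / 4 * f x ^ 2 := by
    rw [norm_smul, mul_pow, Real.norm_eq_abs, sq_abs]
    have := norm_inv_sqrt_smul_sq_le x y
    calc _ ≤ (f x * -(τ / 2)) ^ 2 * 1 := by gcongr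
      _ = _ := by ring
  have hfc := hf.continuous
  have huc := hu.continuous
  have hf1 (x : EuclideanSpace ℝ (Fin n)) : ‖f x‖ ≤ 1 := by
    rw [Real.norm_of_nonneg (Real.exp_pos _).le]
    refine Real.exp_le_one_iff.2 ?_
    have : 0 ≤ u x := Real.sqrt_nonneg _
    nlinarith
  have hf2i : Integrable (fun x => f x ^ 2) μ :=
    Integrable.of_bound (by fun_prop) 1 (ae_of_all _ fun x => by
      rw [norm_pow]; exact pow_le_one₀ (norm_nonneg _) (hf1 x))
  have hfi : Integrable f μ := Integrable.of_bound (by fun_prop) 1 (ae_of_all _ hf1)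
  have hGi : Integrable (fun x => ‖(f x * -(τ / 2)) • ((u x)⁻¹ • (x - y))‖ ^ 2) μ := by
    refine (hf2i.const_mul (τ ^ 2 / 4)).mono' ?_ (ae_of_all _ fun x => ?_)
    · have h0 (x : EuclideanSpace ℝ (Fin n)) : u x ≠ 0 := by positivity
      have : Continuous fun x => (u x)⁻¹ := huc.inv₀ h0
      fun_prop
    · rw [norm_pow, norm_norm]
      exact hb x
  have hvar := (h.variance_le hf hG hGi).2
  have h1 : ∫ x, ‖(f x * -(τ / 2)) • ((u x)⁻¹ • (x - y))‖ ^ 2 ∂μ ≤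
      τ ^ 2 / 4 * ∫ x, f x ^ 2 ∂μ := by
    rw [← integral_const_mul]
    exact integral_mono hGi (hf2i.const_mul _) hb
  have h2 : ∫ x, (f x - ∫ y, f y ∂μ) ^ 2 ∂μ = ∫ x, f x ^ 2 ∂μ - (∫ x, f x ∂μ) ^ 2 := by
    have hm : MemLp f 2 μ := by
      rw [memLp_two_iff_integrable_sq hfc.aestronglyMeasurable]
      exact hf2i
    rw [← variance_eq_integral hfc.aemeasurable, variance_eq_sub hm]
    simp
  rw [h2] at hvar
  have h3 := hvar.trans (div_le_div_of_nonneg_right h1 hl.le)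
  change ∫ x, Real.exp (-τ * u x) ∂μ ≤ _ * (∫ x, f x ∂μ) ^ 2
  rw [show ∫ x, Real.exp (-τ * u x) ∂μ = ∫ x, f x ^ 2 ∂μ by simp only [hf2]]
  set M := ∫ x, f x ^ 2 ∂μ
  have hM : 0 ≤ M := integral_nonneg fun x => by positivity
  set z := τ ^ 2 / (4 * l)
  have hz : τ ^ 2 / 4 * M / l = z * M := by
    simp only [z]; field_simp
  have hz0 : 0 ≤ z := by positivity
  have hz1 : z ≤ 1 / 4 := by
    simp only [z]
    rw [div_le_iff₀ (by positivity)]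
    linarith
  rw [hz] at h3
  have h4 : τ ^ 2 / (2 * l) = 2 * z := by simp only [z]; field_simp; norm_num
  rw [h4]
  -- `(1 - z)⁻¹ ≤ exp (2 z)`, since `z ≤ 1 / 4`
  have h5 : 1 ≤ Real.exp (2 * z) * (1 - z) := by
    have := Real.add_one_le_exp (2 * z)
    nlinarith
  calc M ≤ Real.exp (2 * z) * (1 - z) * M := le_mul_of_one_le_left hM h5
    _ = Real.exp (2 * z) * ((1 - z) * M) := by ring
    _ ≤ _ := by gcongr; linarith

/-- Iteration of `integral_exp_le_sq`. After `k` halvings of `τ` the Laplace transform is expanded to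
second order; the last term of the exponent is the error of this expansion and vanishes as `k`
tends to infinity. -/
lemma integral_exp_le (h : IsIsotropicPoincare μ l) (y : EuclideanSpace ℝ (Fin n)) (k : ℕ) :
    ∀ τ : ℝ, 0 ≤ τ → τ ^ 2 ≤ l → ∫ x, Real.exp (-τ * √(1 + ‖x - y‖ ^ 2)) ∂μ ≤
      Real.exp (-τ * (∫ x, √(1 + ‖x - y‖ ^ 2) ∂μ) + τ ^ 2 / l +
        τ ^ 2 * (∫ x, (√(1 + ‖x - y‖ ^ 2)) ^ 2 ∂μ) / 2 ^ k) := by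
  have hl := h.pos
  set u : EuclideanSpace ℝ (Fin n) → ℝ := fun x => √(1 + ‖x - y‖ ^ 2)
  have huc : Continuous u := (contDiff_sqrt_one_add y).continuous
  have hu0 (x : EuclideanSpace ℝ (Fin n)) : 0 ≤ u x := Real.sqrt_nonneg _
  have hu2 : Integrable (fun x => u x ^ 2) μ := by
    refine ((integrable_const 1).add (h.integrable_norm_sub_sq y)).congr (ae_of_all _ fun x => ?_)
    exact (Real.sq_sqrt (by positivity : (0 : ℝ) ≤ 1 + ‖x - y‖ ^ 2)).symm
  have hu1 : Integrable u μ :=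
    ((memLp_two_iff_integrable_sq huc.aestronglyMeasurable).2 hu2).integrable (by norm_num)
  induction k with
  | zero =>
    intro τ hτ0 hτ
    have hpt (x : EuclideanSpace ℝ (Fin n)) :
        Real.exp (-τ * u x) ≤ 1 - τ * u x + τ ^ 2 * u x ^ 2 := by
      have hy : 0 ≤ τ * u x := mul_nonneg hτ0 (hu0 x)
      have h1 := Real.add_one_le_exp (τ * u x)
      rw [neg_mul, Real.exp_neg, inv_le_iff_one_le_mul₀ (Real.exp_pos _)]
      have h2 : 0 ≤ 1 - τ * u x + τ ^ 2 * u x ^ 2 := by nlinarith [sq_nonneg (τ * u x - 1)]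
      nlinarith [mul_le_mul_of_nonneg_left h1 h2, pow_nonneg hy 3]
    have h1 : ∫ x, Real.exp (-τ * u x) ∂μ ≤ ∫ x, (1 - τ * u x + τ ^ 2 * u x ^ 2) ∂μ := by
      refine integral_mono ?_ ?_ hpt
      · refine Integrable.of_bound (by fun_prop) 1 (ae_of_all _ fun x => ?_)
        rw [Real.norm_of_nonneg (Real.exp_pos _).le]
        exact Real.exp_le_one_iff.2 (by nlinarith [mul_nonneg hτ0 (hu0 x)])
      · exact ((integrable_const _).sub (hu1.const_mul _)).add (hu2.const_mul _)
    rw [integral_add (by exact (integrable_const _).sub (hu1.const_mul _)) (hu2.const_mul _),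
      integral_sub (integrable_const _) (hu1.const_mul _), integral_const_mul,
      integral_const_mul] at h1
    simp only [integral_const, probReal_univ, smul_eq_mul, mul_one] at h1
    refine h1.trans ?_
    refine le_trans ?_ (Real.add_one_le_exp _)
    have : 0 ≤ τ ^ 2 / l := by positivity
    simp only [pow_zero, div_one]
    linarith
  | succ k ih =>
    intro τ hτ0 hτ
    refine (h.integral_exp_le_sq y hτ0 hτ).trans ?_
    have h1 := ih (τ / 2) (by positivity) (by nlinarith [sq_nonneg τ])
    have h0 : 0 ≤ ∫ x, Real.exp (-(τ / 2) * u x) ∂μ := integral_nonneg fun x => (Real.exp_pos _).le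
    calc _ ≤ Real.exp (τ ^ 2 / (2 * l)) * _ :=
          mul_le_mul_of_nonneg_left (pow_le_pow_left₀ h0 h1 2) (Real.exp_pos _).le
      _ = _ := by
          rw [← Real.exp_nat_mul, ← Real.exp_add]
          congr 1
          push_cast
          field_simp
          ring

/-- Under a Poincaré inequality every ball of radius `√n / 2` has exponentially small mass. -/
theorem measureReal_ball_le (h : IsIsotropicPoincare μ l) (hN : 10 ≤ n * l)
    (y : EuclideanSpace ℝ (Fin n)) :
    μ.real {x | ‖x - y‖ ^ 2 ≤ n / 4} ≤ Real.exp 2 * Real.exp (-(3 / 10) * √(n * l)) := by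
  have hl := h.pos
  have hn1 : 1 ≤ n := by
    rcases Nat.eq_zero_or_pos n with h0 | h0
    · rw [h0] at hN; norm_num at hN
    · exact h0
  have hl1 := h.le_one hn1
  have hn10 : (10 : ℝ) ≤ n := by nlinarith [Nat.cast_nonneg (α := ℝ) n]
  set u : EuclideanSpace ℝ (Fin n) → ℝ := fun x => √(1 + ‖x - y‖ ^ 2)
  have hcd : ContDiff ℝ (⊤ : ℕ∞) u := contDiff_sqrt_one_add y
  have huc : Continuous u := hcd.continuous
  have hu0 (x : EuclideanSpace ℝ (Fin n)) : 0 ≤ u x := Real.sqrt_nonneg _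
  have husq (x : EuclideanSpace ℝ (Fin n)) : u x ^ 2 = 1 + ‖x - y‖ ^ 2 :=
    Real.sq_sqrt (by positivity)
  set m := ∫ x, u x ∂μ
  set V := ∫ x, u x ^ 2 ∂μ
  have hV : (n : ℝ) ≤ V := by
    have : V = 1 + (n + ‖y‖ ^ 2) := by
      simp only [V, husq]
      rw [integral_add (integrable_const _) (h.integrable_norm_sub_sq y),
        h.integral_norm_sub_sq y]
      simp
    rw [this]
    nlinarith [sq_nonneg ‖y‖]
  have hGi : Integrable (fun x => ‖(u x)⁻¹ • (x - y)‖ ^ 2) μ := by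
    have h0 (x : EuclideanSpace ℝ (Fin n)) : u x ≠ 0 := by positivity
    have : Continuous fun x => (u x)⁻¹ := huc.inv₀ h0
    refine Integrable.of_bound (by fun_prop) 1 (ae_of_all _ fun x => ?_)
    rw [norm_pow, norm_norm]
    exact norm_inv_sqrt_smul_sq_le x y
  have hvar := h.variance_le hcd (hasGradientAt_sqrt_one_add y) hGi
  have hvar2 : V - m ^ 2 ≤ 1 / l := by
    have h2 : ∫ x, (u x - ∫ y, u y ∂μ) ^ 2 ∂μ = V - m ^ 2 := by
      rw [← variance_eq_integral huc.aemeasurable, variance_eq_sub hvar.1]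
      simp [V, m]
    rw [← h2]
    refine hvar.2.trans (div_le_div_of_nonneg_right ?_ hl.le)
    have := integral_mono hGi (integrable_const 1) fun x => norm_inv_sqrt_smul_sq_le x y
    simpa using this
  have hm0 : 0 ≤ m := integral_nonneg hu0
  have hlinv : 1 / l ≤ n / 10 := by
    rw [div_le_div_iff₀ hl (by norm_num)]
    linarith
  have hm : 9 / 10 * √n ≤ m := by
    refine abs_le_of_sq_le_sq' ?_ hm0 |>.2
    rw [mul_pow, Real.sq_sqrt (by positivity)]
    linarith
  -- `k` is taken so large that the expansion error in `integral_exp_le` is at most one.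
  obtain ⟨k, hk⟩ := pow_unbounded_of_one_lt (l * V) (by norm_num : (1 : ℝ) < 2)
  set τ := √l
  have hτ0 : 0 ≤ τ := Real.sqrt_nonneg _
  have hτ2 : τ ^ 2 = l := Real.sq_sqrt hl.le
  have hM := h.integral_exp_le y k τ hτ0 hτ2.le
  change ∫ x, Real.exp (-τ * u x) ∂μ ≤ Real.exp (-τ * m + τ ^ 2 / l + τ ^ 2 * V / 2 ^ k) at hM
  have hMle : ∫ x, Real.exp (-τ * u x) ∂μ ≤ Real.exp 2 * Real.exp (-τ * m) := by
    rw [← Real.exp_add]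
    refine hM.trans (Real.exp_le_exp.2 ?_)
    rw [hτ2, div_self hl.ne']
    have : l * V / 2 ^ k ≤ 1 := by
      rw [div_le_one (by positivity)]
      exact hk.le
    linarith
  have hint : Integrable (fun x => Real.exp (-τ * u x)) μ := by
    refine Integrable.of_bound (by fun_prop) 1 (ae_of_all _ fun x => ?_)
    rw [Real.norm_of_nonneg (Real.exp_pos _).le]
    exact Real.exp_le_one_iff.2 (by nlinarith [mul_nonneg hτ0 (hu0 x)])
  have hsub : {x | ‖x - y‖ ^ 2 ≤ n / 4} ⊆
      {x | Real.exp (-τ * (6 / 10 * √n)) ≤ Real.exp (-τ * u x)} := by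
    intro x hx
    simp only [Set.mem_ofPred_eq] at hx ⊢
    refine Real.exp_le_exp.2 ?_
    have : u x ≤ 6 / 10 * √n := by
      refine Real.sqrt_le_iff.2 ⟨by positivity, ?_⟩
      rw [mul_pow, Real.sq_sqrt (by positivity)]
      linarith
    nlinarith
  have hmk := mul_meas_ge_le_integral_of_nonneg (μ := μ)
    (ae_of_all _ fun x => (Real.exp_pos (-τ * u x)).le) hint (Real.exp (-τ * (6 / 10 * √n)))
  have hle := measureReal_mono (μ := μ) hsub
  rw [Real.sqrt_mul (by positivity), mul_comm (√(n : ℝ))]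
  set p := μ.real {x | ‖x - y‖ ^ 2 ≤ n / 4}
  have h1 : Real.exp (-τ * (6 / 10 * √n)) * p ≤ Real.exp 2 * Real.exp (-τ * m) :=
    (mul_le_mul_of_nonneg_left hle (Real.exp_pos _).le).trans (hmk.trans hMle)
  have h2 : p = Real.exp (τ * (6 / 10 * √n)) * (Real.exp (-τ * (6 / 10 * √n)) * p) := by
    rw [← mul_assoc, ← Real.exp_add]
    simp
  rw [h2]
  calc _ ≤ Real.exp (τ * (6 / 10 * √n)) * (Real.exp 2 * Real.exp (-τ * m)) := by gcongr
    _ = Real.exp 2 * Real.exp (τ * (6 / 10 * √n) + -τ * m) := by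
        rw [Real.exp_add]; ring
    _ ≤ _ := by
        gcongr
        nlinarith

end IsIsotropicPoincare

/-! ### The Gaussian density and the uniform measure on the sphere -/

section Density

variable {E : Type*} [NormedAddCommGroup E] [InnerProductSpace ℝ E] [FiniteDimensional ℝ E]
  [MeasurableSpace E] [BorelSpace E]

/-- The density of the standard Gaussian measure as a function of the norm. -/
noncomputable def stdGaussianDensity (d : ℕ) (r : ℝ) : ℝ :=
  (2 * Real.pi) ^ (-(d / 2 : ℝ)) * Real.exp (-(1 / 2) * r ^ 2)

lemma stdGaussianDensity_nonneg (d : ℕ) (r : ℝ) : 0 ≤ stdGaussianDensity d r := by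
  have := Real.pi_pos
  unfold stdGaussianDensity
  positivity

@[fun_prop]
lemma continuous_stdGaussianDensity (d : ℕ) : Continuous (stdGaussianDensity d) := by
  unfold stdGaussianDensity
  fun_prop

lemma integral_exp_neg_mul_norm_sq_mul_density {b : ℝ} (hb : 0 ≤ b) :
    ∫ x : E, Real.exp (-b * ‖x‖ ^ 2 / 2) * stdGaussianDensity (Module.finrank ℝ E) ‖x‖ =
      (1 + b) ^ (-(Module.finrank ℝ E / 2 : ℝ)) := by
  have hpi := Real.pi_pos
  set d := Module.finrank ℝ E
  have h1 (x : E) : Real.exp (-b * ‖x‖ ^ 2 / 2) * stdGaussianDensity d ‖x‖ =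
      (2 * Real.pi) ^ (-(d / 2 : ℝ)) * Real.exp (-((1 + b) / 2) * ‖x‖ ^ 2) := by
    rw [stdGaussianDensity, mul_left_comm, ← Real.exp_add]
    congr 2
    ring
  simp_rw [h1]
  rw [integral_const_mul, GaussianFourier.integral_rexp_neg_mul_sq_norm (by positivity)]
  have h2 : Real.pi / ((1 + b) / 2) = (2 * Real.pi) * (1 + b)⁻¹ := by field_simp
  rw [h2, Real.mul_rpow (x := 2 * Real.pi) (by positivity) (by positivity), ← mul_assoc,
    ← Real.rpow_add (by positivity), neg_add_cancel, Real.rpow_zero, one_mul,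
    Real.inv_rpow (by positivity), Real.rpow_neg (by positivity)]

lemma integrable_stdGaussianDensity :
    Integrable fun x : E => stdGaussianDensity (Module.finrank ℝ E) ‖x‖ := by
  have h := integral_exp_neg_mul_norm_sq_mul_density (E := E) (le_refl 0)
  by_contra hc
  simp [integral_undef hc] at h

lemma lintegral_stdGaussianDensity :
    ∫⁻ x : E, ENNReal.ofReal (stdGaussianDensity (Module.finrank ℝ E) ‖x‖) = 1 := by
  rw [← ofReal_integral_eq_lintegral_ofReal integrable_stdGaussianDensity
    (ae_of_all _ fun x => stdGaussianDensity_nonneg _ _)]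
  have h := integral_exp_neg_mul_norm_sq_mul_density (E := E) (le_refl 0)
  simp at h
  simp [h]

lemma stdGaussian_eq_withDensity :
    stdGaussian E = volume.withDensity
      fun x => ENNReal.ofReal (stdGaussianDensity (Module.finrank ℝ E) ‖x‖) := by
  have hpi := Real.pi_pos
  set d := Module.finrank ℝ E
  have hprob : IsProbabilityMeasure ((volume : Measure E).withDensity
      fun x => ENNReal.ofReal (stdGaussianDensity d ‖x‖)) :=
    ⟨by rw [withDensity_apply _ .univ, Measure.restrict_univ, lintegral_stdGaussianDensity]⟩
  refine Measure.ext_of_charFun (funext fun t => ?_)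
  rw [charFun_stdGaussian, charFun_apply, integral_withDensity_eq_integral_toReal_smul
    (by fun_prop) (ae_of_all _ fun x => by simp)]
  have h1 (x : E) : (ENNReal.ofReal (stdGaussianDensity d ‖x‖)).toReal •
      Complex.exp (inner ℝ x t * Complex.I) = ((2 * Real.pi : ℝ) ^ (-(d / 2 : ℝ)) : ℝ) *
        Complex.exp (-(1 / 2 : ℂ) * ‖x‖ ^ 2 + Complex.I * inner ℝ t x) := by
    rw [ENNReal.toReal_ofReal (stdGaussianDensity_nonneg _ _), stdGaussianDensity,
      Complex.real_smul, Complex.ofReal_mul, mul_assoc, Complex.ofReal_exp, ← Complex.exp_add,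
      real_inner_comm]
    congr 2
    push_cast
    ring
  simp_rw [h1]
  rw [integral_const_mul, GaussianFourier.integral_cexp_neg_mul_sq_norm_add (by norm_num)]
  have h2 : (Real.pi / (1 / 2 : ℂ)) ^ (d / 2 : ℂ) = ((2 * Real.pi : ℝ) ^ (d / 2 : ℝ) : ℝ) := by
    rw [Complex.ofReal_cpow (by positivity)]
    push_cast
    congr 1
    ring
  rw [h2, ← mul_assoc, ← Complex.ofReal_mul, ← Real.rpow_add (by positivity), neg_add_cancel]
  simp only [Real.rpow_zero, Complex.ofReal_one, one_mul, Complex.I_sq]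
  congr 1
  ring

lemma integral_exp_neg_mul_norm_sq_stdGaussian {b : ℝ} (hb : 0 ≤ b) :
    ∫ x, Real.exp (-b * ‖x‖ ^ 2 / 2) ∂(stdGaussian E) =
      (1 + b) ^ (-(Module.finrank ℝ E / 2 : ℝ)) := by
  rw [stdGaussian_eq_withDensity, integral_withDensity_eq_integral_toReal_smul
    (by fun_prop) (ae_of_all _ fun x => by simp), ← integral_exp_neg_mul_norm_sq_mul_density hb]
  congr with x
  rw [ENNReal.toReal_ofReal (stdGaussianDensity_nonneg _ _), smul_eq_mul, mul_comm]

/-- Polar coordinates for the standard Gaussian measure. -/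
lemma stdGaussian_direction [Nontrivial E] {B : Set E} (hB : MeasurableSet B) :
    stdGaussian E {x | ‖x‖⁻¹ • x ∈ B} =
      (volume : Measure E).toSphere {θ | (θ : E) ∈ B} *
        ∫⁻ r, ENNReal.ofReal (stdGaussianDensity (Module.finrank ℝ E) r.1)
          ∂(Measure.volumeIoiPow (Module.finrank ℝ E - 1)) := by
  set d := Module.finrank ℝ E
  set ρ : ℝ → ℝ≥0∞ := fun r => ENNReal.ofReal (stdGaussianDensity d r)
  have hρ : Measurable ρ := by
    simp only [ρ]
    fun_prop
  have hBm : MeasurableSet {x : E | ‖x‖⁻¹ • x ∈ B} :=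
    (by fun_prop : Measurable fun x : E => ‖x‖⁻¹ • x) hB
  have hBs : MeasurableSet {θ : Metric.sphere (0 : E) 1 | (θ : E) ∈ B} :=
    measurable_subtype_coe hB
  have hf : Measurable ({θ : Metric.sphere (0 : E) 1 | (θ : E) ∈ B}.indicator (1 : Metric.sphere (0 : E) 1 → ℝ≥0∞)) :=
    measurable_one.indicator hBs
  have hr : Measurable fun r : Set.Ioi (0 : ℝ) => ρ r.1 := hρ.comp measurable_subtype_coe
  have h2 (x : ({0}ᶜ : Set E)) :
      {x : E | ‖x‖⁻¹ • x ∈ B}.indicator (fun x => ρ ‖x‖) x.1 =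
        {θ : Metric.sphere (0 : E) 1 | (θ : E) ∈ B}.indicator 1 (homeomorphUnitSphereProd E x).1 *
          ρ (homeomorphUnitSphereProd E x).2.1 := by
    rw [homeomorphUnitSphereProd_apply_snd_coe]
    by_cases h : ‖x.1‖⁻¹ • x.1 ∈ B
    · rw [Set.indicator_of_mem (by exact h), Set.indicator_of_mem
        (by simpa [homeomorphUnitSphereProd_apply_fst_coe] using h), Pi.one_apply, one_mul]
    · rw [Set.indicator_of_notMem (by exact h), Set.indicator_of_notMem
        (by simpa [homeomorphUnitSphereProd_apply_fst_coe] using h), zero_mul]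
  rw [stdGaussian_eq_withDensity, withDensity_apply _ hBm, ← lintegral_indicator hBm]
  calc ∫⁻ x, {x : E | ‖x‖⁻¹ • x ∈ B}.indicator (fun x => ρ ‖x‖) x
      = ∫⁻ x : ({0}ᶜ : Set E), {x : E | ‖x‖⁻¹ • x ∈ B}.indicator (fun x => ρ ‖x‖) x.1
          ∂((volume : Measure E).comap Subtype.val) := by
        rw [lintegral_subtype_comap (measurableSet_singleton _).compl
          ({x : E | ‖x‖⁻¹ • x ∈ B}.indicator (fun x => ρ ‖x‖)), restrict_compl_singleton]
    _ = ∫⁻ p : Metric.sphere (0 : E) 1 × Set.Ioi (0 : ℝ),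
          {θ : Metric.sphere (0 : E) 1 | (θ : E) ∈ B}.indicator 1 p.1 * ρ p.2.1
          ∂((volume : Measure E).toSphere.prod (Measure.volumeIoiPow (d - 1))) := by
        refine Eq.trans ?_ ((volume : Measure E).measurePreserving_homeomorphUnitSphereProd
          |>.lintegral_comp ((hf.comp measurable_fst).mul (hr.comp measurable_snd)))
        exact lintegral_congr h2
    _ = _ := by
        rw [lintegral_prod_mul hf.aemeasurable hr.aemeasurable, lintegral_indicator_one hBs]

end Density

/-- The direction of a standard Gaussian vector is uniformly distributed on the sphere. -/
theorem sphereProb_eq_stdGaussian {n : ℕ} (hn : 1 ≤ n) {A : Set (EuclideanSpace ℝ (Fin n))}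
    (hA : MeasurableSet A) :
    sphereProb n {θ | (θ : EuclideanSpace ℝ (Fin n)) ∈ A} =
      stdGaussian (EuclideanSpace ℝ (Fin n)) {x | ‖x‖⁻¹ • x ∈ A} := by
  have : Nontrivial (EuclideanSpace ℝ (Fin n)) := by
    refine Module.nontrivial_of_finrank_pos (R := ℝ) ?_
    rw [finrank_euclideanSpace_fin]
    omega
  have huniv := stdGaussian_direction (E := EuclideanSpace ℝ (Fin n)) .univ
  simp only [Set.mem_univ, Set.ofPred_true, measure_univ] at huniv
  rw [stdGaussian_direction hA, sphereProb, Measure.smul_apply, smul_eq_mul, mul_comm]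
  congr 1
  rw [mul_comm] at huniv
  exact (ENNReal.eq_inv_of_mul_eq_one_left huniv.symm).symm

lemma stdGaussian_real_ball_le (n : ℕ) :
    (stdGaussian (EuclideanSpace ℝ (Fin n))).real {x | ‖x‖ ^ 2 < n / 4} ≤
      Real.exp (-(3 / 10) * n) := by
  set γ := stdGaussian (EuclideanSpace ℝ (Fin n))
  have h := integral_exp_neg_mul_norm_sq_stdGaussian (E := EuclideanSpace ℝ (Fin n)) (b := 3)
    (by norm_num)
  have hint : Integrable (fun x => Real.exp (-3 * ‖x‖ ^ 2 / 2)) γ := by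
    refine Integrable.of_bound (by fun_prop) 1 (ae_of_all _ fun x => ?_)
    rw [Real.norm_of_nonneg (Real.exp_pos _).le]
    exact Real.exp_le_one_iff.2 (by nlinarith [sq_nonneg ‖x‖])
  have hmk := mul_meas_ge_le_integral_of_nonneg (μ := γ)
    (ae_of_all _ fun x => (Real.exp_pos (-3 * ‖x‖ ^ 2 / 2)).le) hint (Real.exp (-(3 / 8) * n))
  rw [h, finrank_euclideanSpace_fin] at hmk
  have hsub : {x : EuclideanSpace ℝ (Fin n) | ‖x‖ ^ 2 < n / 4} ⊆
      {x | Real.exp (-(3 / 8) * n) ≤ Real.exp (-3 * ‖x‖ ^ 2 / 2)} := by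
    intro x hx
    simp only [Set.mem_ofPred_eq] at hx ⊢
    exact Real.exp_le_exp.2 (by linarith)
  have hle := measureReal_mono (μ := γ) hsub
  set p := γ.real {x | ‖x‖ ^ 2 < n / 4}
  have h4 : (1 + 3 : ℝ) ^ (-(n / 2 : ℝ)) ≤ Real.exp (-(27 / 40) * n) := by
    rw [Real.rpow_def_of_pos (by norm_num)]
    refine Real.exp_le_exp.2 ?_
    have : Real.log (1 + 3) = 2 * Real.log 2 := by
      rw [← Real.log_rpow (by norm_num)]
      norm_num
    rw [this]
    have := Real.log_two_gt_d9
    nlinarith [Nat.cast_nonneg (α := ℝ) n]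
  have h5 : Real.exp (-(3 / 8) * n) * p ≤ Real.exp (-(27 / 40) * n) :=
    (mul_le_mul_of_nonneg_left hle (Real.exp_pos _).le).trans (hmk.trans h4)
  have h6 : Real.exp (-(27 / 40) * n) = Real.exp (-(3 / 8) * n) * Real.exp (-(3 / 10) * n) := by
    rw [← Real.exp_add]
    congr 1
    ring
  rw [h6] at h5
  exact le_of_mul_le_mul_left h5 (Real.exp_pos _)

/-! ### The characteristic function compared with the Gaussian one -/

/-- Second-order Taylor estimate for `exp (-a z)` at `z = 1`, uniform in `a`. -/
lemma abs_exp_neg_mul_sub_le {a z : ℝ} (ha : 0 ≤ a) (hz : 0 ≤ z) :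
    |Real.exp (-(a * z)) - Real.exp (-a) + a * Real.exp (-a) * (z - 1)| ≤
      4 * min 1 a * (z - 1) ^ 2 := by
  have he : Real.exp (-(a * z)) = Real.exp (-a) * Real.exp (-(a * (z - 1))) := by
    rw [← Real.exp_add]
    congr 1
    ring
  have hea := Real.exp_pos (-a)
  set x := -(a * (z - 1))
  have h0 : Real.exp (-(a * z)) - Real.exp (-a) + a * Real.exp (-a) * (z - 1) =
      Real.exp (-a) * (Real.exp x - 1 - x) := by
    rw [he]
    simp only [x]
    ring
  have hnn : 0 ≤ Real.exp x - 1 - x := by linarith [Real.add_one_le_exp x]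
  rw [h0, abs_of_nonneg (by positivity)]
  -- The case of small `z` is trivial, since then `(z - 1)²` is bounded below.
  rcases lt_or_ge z (1 / 2) with hz2 | hz2
  · have h1 : Real.exp (-a) * (Real.exp x - 1 - x) ≤ 1 - Real.exp (-a) := by
      rw [← h0]
      have : Real.exp (-(a * z)) ≤ 1 := Real.exp_le_one_iff.2 (by nlinarith)
      have : 0 ≤ a * Real.exp (-a) * (1 - z) := by
        have : 0 ≤ 1 - z := by linarith
        positivity
      linarith
    have h2 : 1 - Real.exp (-a) ≤ min 1 a := by
      refine le_min (by linarith) ?_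
      linarith [Real.add_one_le_exp (-a)]
    have h3 : (1 : ℝ) ≤ 4 * (z - 1) ^ 2 := by nlinarith
    have h4 : 0 ≤ min 1 a := le_min one_pos.le ha
    nlinarith
  · have hb : Real.exp (-a) * (Real.exp x - 1 - x) ≤ x ^ 2 * Real.exp (-(a / 2)) := by
      rcases le_or_gt 0 x with hx | hx
      · have hxa : x ≤ a / 2 := by simp only [x]; nlinarith
        have h1 : Real.exp x - 1 - x ≤ x ^ 2 * Real.exp x := by
          have h2 := Real.add_one_le_exp (-x)
          have h3 : Real.exp x * Real.exp (-x) = 1 := by rw [← Real.exp_add]; simp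
          nlinarith [Real.exp_pos x, mul_le_mul_of_nonneg_left h2 (Real.exp_pos x).le,
            mul_nonneg hx hnn]
        calc _ ≤ Real.exp (-a) * (x ^ 2 * Real.exp x) := by gcongr
          _ = x ^ 2 * Real.exp (-a + x) := by rw [Real.exp_add]; ring
          _ ≤ _ := by gcongr; linarith
      · have h1 : Real.exp x - 1 - x ≤ x ^ 2 := by
          have h2 := Real.add_one_le_exp (-x)
          have h3 : Real.exp x * Real.exp (-x) = 1 := by rw [← Real.exp_add]; simp
          have h4 : 0 ≤ 1 + x + x ^ 2 := by nlinarith [sq_nonneg (x + 1)]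
          have h5 : 1 ≤ (1 + x + x ^ 2) * Real.exp (-x) := by
            nlinarith [mul_le_mul_of_nonneg_left h2 h4, pow_pos (neg_pos.2 hx) 3]
          nlinarith [mul_le_mul_of_nonneg_left h5 (Real.exp_pos x).le]
        calc _ ≤ Real.exp (-a) * x ^ 2 := by gcongr
          _ = x ^ 2 * Real.exp (-a) := by ring
          _ ≤ _ := by gcongr; linarith
    have h1 : a ^ 2 * Real.exp (-(a / 2)) ≤ 4 * min 1 a := by
      have h2 : a / 4 * Real.exp (-(a / 4)) ≤ 1 := mul_exp_neg_le_one _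
      have h3 : a / 2 * Real.exp (-(a / 2)) ≤ 1 := mul_exp_neg_le_one _
      have hexp : Real.exp 1 * (a / 4 * Real.exp (-(a / 4))) ≤ 1 := by
        have := Real.add_one_le_exp (a / 4 - 1)
        have h5 : Real.exp (a / 4) * Real.exp (-(a / 4)) = 1 := by rw [← Real.exp_add]; simp
        have h6 : Real.exp 1 * Real.exp (a / 4 - 1) = Real.exp (a / 4) := by
          rw [← Real.exp_add]; congr 1; ring
        have h7 : Real.exp 1 * (a / 4) ≤ Real.exp (a / 4) := by
          rw [← h6]; gcongr; linarith
        nlinarith [Real.exp_pos (-(a / 4))]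
      rcases min_choice 1 a with hm | hm <;> rw [hm]
      · have h4 : a ^ 2 * Real.exp (-(a / 2)) = 16 * (a / 4 * Real.exp (-(a / 4))) ^ 2 := by
          rw [mul_pow, ← Real.exp_nat_mul]
          push_cast
          ring_nf
        rw [h4]
        have h5 : 0 ≤ a / 4 * Real.exp (-(a / 4)) := by positivity
        have h6 : 2 * (a / 4 * Real.exp (-(a / 4))) ≤ 1 := by
          have : 2 ≤ Real.exp 1 := by linarith [Real.exp_one_gt_d9]
          nlinarith
        nlinarith
      · nlinarith
    have hx2 : x ^ 2 = a ^ 2 * (z - 1) ^ 2 := by simp only [x]; ring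
    calc _ ≤ x ^ 2 * Real.exp (-(a / 2)) := hb
      _ = a ^ 2 * Real.exp (-(a / 2)) * (z - 1) ^ 2 := by rw [hx2]; ring
      _ ≤ _ := by gcongr

/-- The Laplace transform of a normalized `χ²` variable with `d` degrees of freedom is close to that of
the constant `1`. -/
lemma abs_one_add_rpow_sub_exp_le {d a : ℝ} (hd : 0 < d) (ha : 0 ≤ a) (had : a ^ 2 ≤ d) :
    |(1 + 2 * a / d) ^ (-(d / 2)) - Real.exp (-a)| ≤ 2 * min 1 a / d := by
  have hx : 0 ≤ 2 * a / d := by positivity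
  set x := 2 * a / d with hxdef
  have hdx : d / 2 * x = a := by rw [hxdef]; field_simp
  rw [Real.rpow_def_of_pos (by positivity)]
  have h1 : Real.log (1 + x) ≤ x := by
    have := Real.log_le_sub_one_of_pos (by positivity : 0 < 1 + x)
    linarith
  have h2 : x - x ^ 2 / 2 ≤ Real.log (1 + x) := by
    refine le_trans ?_ (Real.le_log_one_add_of_nonneg hx)
    rw [le_div_iff₀ (by positivity)]
    nlinarith [pow_nonneg hx 3]
  have h3 : -a ≤ Real.log (1 + x) * -(d / 2) := by nlinarith
  have h4 : Real.log (1 + x) * -(d / 2) ≤ -a + a ^ 2 / d := by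
    have : d / 2 * (x ^ 2 / 2) = a ^ 2 / d := by rw [hxdef]; field_simp
    nlinarith
  rw [abs_of_nonneg (by linarith [Real.exp_le_exp.2 h3])]
  set y := a ^ 2 / d
  have hy0 : 0 ≤ y := by positivity
  have hy1 : y ≤ 1 := by
    simp only [y]
    rw [div_le_one hd]
    exact had
  have h5 : Real.exp y ≤ 1 + 2 * y := by
    have hb := Real.abs_exp_sub_one_le (x := y) (by rwa [abs_of_nonneg hy0])
    rw [abs_of_nonneg hy0] at hb
    linarith [le_abs_self (Real.exp y - 1)]
  have h6 : Real.exp (Real.log (1 + x) * -(d / 2)) ≤ Real.exp (-a) * (1 + 2 * y) := by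
    calc _ ≤ Real.exp (-a + y) := Real.exp_le_exp.2 h4
      _ = Real.exp (-a) * Real.exp y := Real.exp_add _ _
      _ ≤ _ := by gcongr
  have h7 : a ^ 2 * Real.exp (-a) ≤ min 1 a := by
    have h8 : a * Real.exp (-a) ≤ 1 := mul_exp_neg_le_one _
    refine le_min ?_ (by nlinarith)
    have h9 : a ^ 2 * Real.exp (-a) = 4 * (a / 2 * Real.exp (-(a / 2))) ^ 2 := by
      rw [mul_pow, ← Real.exp_nat_mul]
      push_cast
      ring_nf
    have h10 : 2 * (a / 2 * Real.exp (-(a / 2))) ≤ 1 := by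
      have := Real.add_one_le_exp (a / 2 - 1)
      have h5 : Real.exp (a / 2) * Real.exp (-(a / 2)) = 1 := by rw [← Real.exp_add]; simp
      have h6 : Real.exp 1 * Real.exp (a / 2 - 1) = Real.exp (a / 2) := by
        rw [← Real.exp_add]; congr 1; ring
      have h7 : Real.exp 1 * (a / 2) ≤ Real.exp (a / 2) := by
        rw [← h6]; gcongr; linarith
      have : 2 ≤ Real.exp 1 := by linarith [Real.exp_one_gt_d9]
      nlinarith [Real.exp_pos (-(a / 2)), mul_le_mul_of_nonneg_right h7 (Real.exp_pos (-(a / 2))).le,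
        mul_nonneg ha (Real.exp_pos (-(a / 2))).le]
    rw [h9]
    have : 0 ≤ a / 2 * Real.exp (-(a / 2)) := by positivity
    nlinarith
  rw [le_div_iff₀ hd]
  have h8 : y * d = a ^ 2 := by simp only [y]; field_simp
  calc _ ≤ (Real.exp (-a) * (1 + 2 * y) - Real.exp (-a)) * d := by gcongr
    _ = 2 * ((y * d) * Real.exp (-a)) := by ring
    _ ≤ _ := by rw [h8]; linarith

namespace IsIsotropicPoincare

variable {n : ℕ} {μ : Measure (EuclideanSpace ℝ (Fin n))} [IsProbabilityMeasure μ] {l : ℝ}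

/-- The Gaussian average of the characteristic function of `μ` agrees with that of the standard
Gaussian law up to the variance of `‖x‖² / n`. -/
lemma abs_integral_exp_sub_le (h : IsIsotropicPoincare μ l) (hn : 1 ≤ n) {δ : ℝ}
    (hδ : n * δ ^ 4 ≤ 1 / 40) :
    |∫ x, Real.exp (-δ ^ 2 * ‖x‖ ^ 2 / 2) ∂μ - (1 + δ ^ 2) ^ (-(n / 2 : ℝ))| ≤
      18 * min 1 (n * δ ^ 2 / 2) / (n * l) := by
  have hl := h.pos
  have hl1 := h.le_one hn
  have hn0 : (0 : ℝ) < n := by exact_mod_cast hn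
  set a := n * δ ^ 2 / 2 with hadef
  have ha : 0 ≤ a := by positivity
  have had : a ^ 2 ≤ n := by
    rw [hadef]
    nlinarith
  have h1 := abs_one_add_rpow_sub_exp_le hn0 ha had
  have h2 : 2 * a / n = δ ^ 2 := by rw [hadef]; field_simp
  rw [h2] at h1
  have hexp (x : EuclideanSpace ℝ (Fin n)) :
      Real.exp (-δ ^ 2 * ‖x‖ ^ 2 / 2) = Real.exp (-(a * (‖x‖ ^ 2 / n))) := by
    congr 1
    rw [hadef]
    field_simp
  have hi1 : Integrable (fun x => Real.exp (-δ ^ 2 * ‖x‖ ^ 2 / 2)) μ := by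
    refine Integrable.of_bound (by fun_prop) 1 (ae_of_all _ fun x => ?_)
    rw [Real.norm_of_nonneg (Real.exp_pos _).le]
    exact Real.exp_le_one_iff.2 (by nlinarith [mul_nonneg (sq_nonneg δ) (sq_nonneg ‖x‖)])
  have hi2 : Integrable (fun x => a * Real.exp (-a) * (‖x‖ ^ 2 / n - 1)) μ :=
    ((h.integrable_norm_sq.div_const _).sub (integrable_const _)).const_mul _
  have hz : ∫ x, a * Real.exp (-a) * (‖x‖ ^ 2 / n - 1) ∂μ = 0 := by
    rw [integral_const_mul, integral_sub (h.integrable_norm_sq.div_const _) (integrable_const _),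
      integral_div, h.integral_norm_sq]
    simp [hn0.ne']
  have h3 : ∫ x, Real.exp (-δ ^ 2 * ‖x‖ ^ 2 / 2) ∂μ - Real.exp (-a) =
      ∫ x, (Real.exp (-δ ^ 2 * ‖x‖ ^ 2 / 2) - Real.exp (-a) +
        a * Real.exp (-a) * (‖x‖ ^ 2 / n - 1)) ∂μ := by
    rw [integral_add (by exact hi1.sub (integrable_const _)) hi2, hz,
      integral_sub hi1 (integrable_const _)]
    simp
  have hsq (x : EuclideanSpace ℝ (Fin n)) :
      (‖x‖ ^ 2 / n - 1) ^ 2 = (‖x‖ ^ 2 - n) ^ 2 / n ^ 2 := by field_simp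
  have h4 : |∫ x, Real.exp (-δ ^ 2 * ‖x‖ ^ 2 / 2) ∂μ - Real.exp (-a)| ≤
      16 * min 1 a / (n * l) := by
    rw [h3]
    refine (abs_integral_le_integral_abs).trans ?_
    calc _ ≤ ∫ x, 4 * min 1 a * ((‖x‖ ^ 2 - n) ^ 2 / n ^ 2) ∂μ := by
          refine integral_mono ?_ ((h.integral_norm_sq_sub_sq.1.div_const _).const_mul _) fun x => ?_
          · exact ((hi1.sub (integrable_const _)).add hi2).abs
          · simp only
            rw [hexp, ← hsq]
            exact abs_exp_neg_mul_sub_le ha (by positivity)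
      _ = 4 * min 1 a * ((∫ x, (‖x‖ ^ 2 - n) ^ 2 ∂μ) / n ^ 2) := by
          rw [integral_const_mul, integral_div]
      _ ≤ 4 * min 1 a * ((4 * n / l) / n ^ 2) := by
          have : 0 ≤ min 1 a := le_min one_pos.le ha
          gcongr
          exact h.integral_norm_sq_sub_sq.2
      _ = _ := by field_simp; ring
  have h5 : 2 * min 1 a / n ≤ 2 * min 1 a / (n * l) := by
    have : 0 ≤ min 1 a := le_min one_pos.le ha
    gcongr
    nlinarith
  have h6 : 18 * min 1 a / (n * l) = 16 * min 1 a / (n * l) + 2 * min 1 a / (n * l) := by ring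
  rw [h6]
  calc _ ≤ _ := abs_sub_le _ (Real.exp (-a)) _
    _ ≤ _ := add_le_add h4 (by rw [abs_sub_comm]; exact h1.trans h5)

end IsIsotropicPoincare

/-! ### Second-order analysis of the characteristic function -/

section CharDiff

variable {n : ℕ}

/-- A real trace of the difference between the characteristic function of `μ` and the standard
Gaussian one: the phase `α = 0` gives the real part, and `α = π / 2` minus the imaginary part. -/
noncomputable def charDiff (μ : Measure (EuclideanSpace ℝ (Fin n))) (α : ℝ)
    (x : EuclideanSpace ℝ (Fin n)) : ℝ :=
  ∫ y, Real.cos (inner ℝ x y + α) ∂μ - Real.cos α * Real.exp (-‖x‖ ^ 2 / 2)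

/-- The gradient of `charDiff μ α`. -/
noncomputable def charDiffGrad (μ : Measure (EuclideanSpace ℝ (Fin n))) (α : ℝ)
    (x : EuclideanSpace ℝ (Fin n)) : EuclideanSpace ℝ (Fin n) :=
  -(∫ y, Real.sin (inner ℝ x y + α) • y ∂μ) + (Real.cos α * Real.exp (-‖x‖ ^ 2 / 2)) • x

/-- The Hessian of `charDiff μ α`. -/
noncomputable def charDiffHess (μ : Measure (EuclideanSpace ℝ (Fin n))) (α : ℝ)
    (x : EuclideanSpace ℝ (Fin n)) : EuclideanSpace ℝ (Fin n) →L[ℝ] EuclideanSpace ℝ (Fin n) :=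
  -(∫ y, Real.cos (inner ℝ x y + α) • (innerSL ℝ y).smulRight y ∂μ) +
    (Real.cos α * Real.exp (-‖x‖ ^ 2 / 2)) •
      (ContinuousLinearMap.id ℝ _ - (innerSL ℝ x).smulRight x)

end CharDiff

lemma integral_norm_sq_stdGaussian (n : ℕ) :
    Integrable (fun x => ‖x‖ ^ 2) (stdGaussian (EuclideanSpace ℝ (Fin n))) ∧
      ∫ x, ‖x‖ ^ 2 ∂(stdGaussian (EuclideanSpace ℝ (Fin n))) = n := by
  have h (i : Fin n) := integral_dual_sq (E := EuclideanSpace ℝ (Fin n))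
    (innerSL ℝ (EuclideanSpace.single i (1 : ℝ)))
  have h1 (i : Fin n) (x : EuclideanSpace ℝ (Fin n)) :
      innerSL ℝ (EuclideanSpace.single i (1 : ℝ)) x = x i := by
    simp [EuclideanSpace.inner_single_left]
  simp only [h1] at h
  simp_rw [EuclideanSpace.real_norm_sq_eq]
  refine ⟨integrable_finsetSum _ fun i _ => (h i).1, ?_⟩
  rw [integral_finsetSum _ fun i _ => (h i).1]
  simp_rw [fun i => (h i).2]
  simp

lemma integral_inner_sq_stdGaussian {n : ℕ} (b : EuclideanSpace ℝ (Fin n)) :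
    Integrable (fun x => inner ℝ b x ^ 2) (stdGaussian (EuclideanSpace ℝ (Fin n))) ∧
      ∫ x, inner ℝ b x ^ 2 ∂(stdGaussian (EuclideanSpace ℝ (Fin n))) = ‖b‖ ^ 2 := by
  simpa using integral_dual_sq (E := EuclideanSpace ℝ (Fin n)) (innerSL ℝ b)

lemma integral_cos_inner_add_stdGaussian {n : ℕ} (v : EuclideanSpace ℝ (Fin n)) (α : ℝ) :
    ∫ x, Real.cos (inner ℝ x v + α) ∂(stdGaussian (EuclideanSpace ℝ (Fin n))) =
      Real.cos α * Real.exp (-‖v‖ ^ 2 / 2) := by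
  have h := charFun_stdGaussian (E := EuclideanSpace ℝ (Fin n)) v
  rw [charFun_apply] at h
  have hint : Integrable (fun x => Complex.exp (Complex.I * α) *
      Complex.exp (inner ℝ x v * Complex.I)) (stdGaussian (EuclideanSpace ℝ (Fin n))) := by
    refine Integrable.of_bound (by fun_prop) 1 (ae_of_all _ fun x => ?_)
    rw [norm_mul, mul_comm Complex.I, Complex.norm_exp_ofReal_mul_I, Complex.norm_exp_ofReal_mul_I,
      one_mul]
  have h2 : ∫ x, Complex.exp (Complex.I * α) * Complex.exp (inner ℝ x v * Complex.I)
      ∂(stdGaussian (EuclideanSpace ℝ (Fin n))) =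
      Complex.exp (Complex.I * α) * Complex.exp (-‖v‖ ^ 2 / 2) := by
    rw [integral_const_mul, h]
  have h3 := congrArg Complex.re h2
  have h4 := integral_re hint
  simp only [RCLike.re_to_complex] at h4
  rw [← h4] at h3
  have h5 : (Complex.exp (Complex.I * α) * Complex.exp (-‖v‖ ^ 2 / 2)).re =
      Real.cos α * Real.exp (-‖v‖ ^ 2 / 2) := by
    have : Complex.exp (-‖v‖ ^ 2 / 2) = (Real.exp (-‖v‖ ^ 2 / 2) : ℝ) := by
      push_cast
      rfl
    rw [this, Complex.re_mul_ofReal, mul_comm Complex.I, Complex.exp_ofReal_mul_I_re]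
  rw [h5] at h3
  rw [← h3]
  congr with x
  rw [← Complex.exp_add, mul_comm Complex.I, ← add_mul, ← Complex.ofReal_add,
    Complex.exp_ofReal_mul_I_re, add_comm]

namespace IsIsotropicPoincare

variable {n : ℕ} {μ : Measure (EuclideanSpace ℝ (Fin n))} {l : ℝ}

lemma hasFDerivAt_exp_neg_norm_sq (x : EuclideanSpace ℝ (Fin n)) :
    HasFDerivAt (fun x => Real.exp (-‖x‖ ^ 2 / 2))
      (-(Real.exp (-‖x‖ ^ 2 / 2)) • innerSL ℝ x) x := by
  convert! (((hasFDerivAt_id x).norm_sq.neg).mul_const (1 / 2)).exp using 1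
  · ext y
    simp
    ring_nf
  · ext v
    simp
    ring_nf
    simp

lemma integrable_smulRight (h : IsIsotropicPoincare μ l) {ψ : EuclideanSpace ℝ (Fin n) → ℝ}
    (hψ : Continuous ψ) (hψ1 : ∀ x, |ψ x| ≤ 1) :
    Integrable (fun y => ψ y • (innerSL ℝ y).smulRight y) μ := by
  refine h.integrable_norm_sq.mono' ?_ (ae_of_all _ fun y => ?_)
  · have : Continuous fun y : EuclideanSpace ℝ (Fin n) => (innerSL ℝ y).smulRight y :=
      (by fun_prop : Continuous fun p : (StrongDual ℝ (EuclideanSpace ℝ (Fin n))) ×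
        EuclideanSpace ℝ (Fin n) => p.1.smulRight p.2).comp
        ((innerSL ℝ).continuous.prodMk continuous_id)
    exact (hψ.smul this).aestronglyMeasurable
  · rw [norm_smul, ContinuousLinearMap.norm_smulRight_apply, innerSL_apply_norm, ← sq]
    exact mul_le_of_le_one_left (by positivity) (hψ1 y)

lemma integrable_cos_mul_inner_smul (h : IsIsotropicPoincare μ l) (α : ℝ)
    (x v : EuclideanSpace ℝ (Fin n)) :
    Integrable (fun y => (Real.cos (inner ℝ x y + α) * inner ℝ y v) • y) μ := by
  refine (h.integrable_norm_sq.const_mul ‖v‖).mono' (by fun_prop) (ae_of_all _ fun y => ?_)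
  rw [norm_smul, norm_mul]
  have h1 := Real.abs_cos_le_one (inner ℝ x y + α)
  have h2 := norm_inner_le_norm (𝕜 := ℝ) y v
  rw [← Real.norm_eq_abs] at h1
  calc _ ≤ 1 * (‖y‖ * ‖v‖) * ‖y‖ := by gcongr
    _ = _ := by ring

lemma continuous_charDiffHess (h : IsIsotropicPoincare μ l) (α : ℝ) :
    Continuous (charDiffHess μ α) := by
  unfold charDiffHess
  have h1 : Continuous fun x : EuclideanSpace ℝ (Fin n) =>
      ∫ y, Real.cos (inner ℝ x y + α) • (innerSL ℝ y).smulRight y ∂μ := by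
    refine continuous_of_dominated (bound := fun y => ‖y‖ ^ 2) (fun x => ?_) (fun x => ?_)
      h.integrable_norm_sq (ae_of_all _ fun y => by fun_prop)
    · exact (h.integrable_smulRight (by fun_prop) fun y => Real.abs_cos_le_one _).1
    · refine ae_of_all _ fun y => ?_
      rw [norm_smul, ContinuousLinearMap.norm_smulRight_apply, innerSL_apply_norm, ← sq]
      exact mul_le_of_le_one_left (by positivity) (Real.abs_cos_le_one _)
  have h2 : Continuous fun y : EuclideanSpace ℝ (Fin n) => (innerSL ℝ y).smulRight y :=
    (by fun_prop : Continuous fun p : (StrongDual ℝ (EuclideanSpace ℝ (Fin n))) ×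
      EuclideanSpace ℝ (Fin n) => p.1.smulRight p.2).comp
      ((innerSL ℝ).continuous.prodMk continuous_id)
  exact h1.neg.add ((by fun_prop : Continuous fun x : EuclideanSpace ℝ (Fin n) =>
    Real.cos α * Real.exp (-‖x‖ ^ 2 / 2)).smul (continuous_const.sub h2))

lemma charDiffHess_apply (h : IsIsotropicPoincare μ l) (α : ℝ) (x v : EuclideanSpace ℝ (Fin n)) :
    charDiffHess μ α x v = -(∫ y, (Real.cos (inner ℝ x y + α) * inner ℝ y v) • y ∂μ) +
      (Real.cos α * Real.exp (-‖x‖ ^ 2 / 2)) • (v - inner ℝ x v • x) := by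
  unfold charDiffHess
  simp only [FunLike.coe_add, FunLike.coe_neg, FunLike.coe_smul, FunLike.coe_sub, Pi.add_apply,
    Pi.neg_apply, Pi.smul_apply, Pi.sub_apply, ContinuousLinearMap.coe_id', id_eq,
    ContinuousLinearMap.smulRight_apply, innerSL_apply_apply]
  rw [ContinuousLinearMap.integral_apply
    (h.integrable_smulRight (by fun_prop) fun y => Real.abs_cos_le_one _)]
  simp [smul_smul]

/-- The Hessian is bounded independently of the dimension, since `y ⊗ y` has mean the identity. -/
lemma norm_charDiffHess_le (h : IsIsotropicPoincare μ l) (α : ℝ) (x : EuclideanSpace ℝ (Fin n)) :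
    ‖charDiffHess μ α x‖ ≤ 3 := by
  refine ContinuousLinearMap.opNorm_le_bound _ (by norm_num) fun v => ?_
  rw [h.charDiffHess_apply]
  set T := ∫ y, (Real.cos (inner ℝ x y + α) * inner ℝ y v) • y ∂μ
  have hT : ‖T‖ ≤ ‖v‖ := by
    have h1 : ‖T‖ ^ 2 = ∫ y, (Real.cos (inner ℝ x y + α) * inner ℝ y v) * inner ℝ T y ∂μ := by
      rw [← real_inner_self_eq_norm_sq]
      have : inner ℝ T T = ∫ y, inner ℝ T ((Real.cos (inner ℝ x y + α) * inner ℝ y v) • y) ∂μ :=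
        (integral_inner (h.integrable_cos_mul_inner_smul α x v) T).symm
      rw [this]
      simp_rw [inner_smul_right]
    have hiv := (h.memLp_inner v).integrable_sq
    have hiT := (h.memLp_inner T).integrable_sq
    have h2 : ‖T‖ ^ 2 ≤ ∫ y, (inner ℝ v y ^ 2 / 2 + inner ℝ T y ^ 2 / 2) ∂μ := by
      rw [h1]
      refine integral_mono ?_ ((hiv.div_const 2).add (hiT.div_const 2)) fun y => ?_
      · have := Integrable.const_inner (𝕜 := ℝ) T (h.integrable_cos_mul_inner_smul α x v)
        simpa only [inner_smul_right] using this
      · simp only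
        have hc := Real.abs_cos_le_one (inner ℝ x y + α)
        rw [real_inner_comm v y]
        have h3 : |Real.cos (inner ℝ x y + α) * inner ℝ v y * inner ℝ T y| ≤
            |inner ℝ v y| * |inner ℝ T y| := by
          rw [abs_mul, abs_mul, mul_assoc]
          exact mul_le_of_le_one_left (by positivity) hc
        refine (le_abs_self _).trans (h3.trans ?_)
        have := two_mul_le_add_sq |inner ℝ v y| |inner ℝ T y|
        rw [sq_abs, sq_abs] at this
        linarith
    rw [integral_add (hiv.div_const 2) (hiT.div_const 2), integral_div, integral_div,
      h.integral_inner_sq, h.integral_inner_sq] at h2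
    exact le_of_sq_le_sq (by linarith) (norm_nonneg _)
  have hS : ‖(Real.cos α * Real.exp (-‖x‖ ^ 2 / 2)) • (v - inner ℝ x v • x)‖ ≤ 2 * ‖v‖ := by
    rw [norm_smul, norm_mul, Real.norm_eq_abs, Real.norm_of_nonneg (Real.exp_pos _).le, mul_assoc]
    refine (mul_le_of_le_one_left (by positivity) (Real.abs_cos_le_one _)).trans ?_
    have h1 : Real.exp (-‖x‖ ^ 2 / 2) * Real.exp (‖x‖ ^ 2 / 2) = 1 := by
      rw [← Real.exp_add]
      ring_nf
      simp
    have h2 := Real.add_one_le_exp (‖x‖ ^ 2 / 2)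
    have h3 : ‖v - inner ℝ x v • x‖ ≤ (1 + ‖x‖ ^ 2) * ‖v‖ := by
      refine (norm_sub_le _ _).trans ?_
      rw [norm_smul]
      have := norm_inner_le_norm (𝕜 := ℝ) x v
      nlinarith [mul_le_mul_of_nonneg_right this (norm_nonneg x)]
    have h4 : (1 + ‖x‖ ^ 2) * Real.exp (-‖x‖ ^ 2 / 2) ≤ 2 := by
      nlinarith [Real.exp_pos (-‖x‖ ^ 2 / 2)]
    calc _ ≤ Real.exp (-‖x‖ ^ 2 / 2) * ((1 + ‖x‖ ^ 2) * ‖v‖) := by gcongr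
      _ = (1 + ‖x‖ ^ 2) * Real.exp (-‖x‖ ^ 2 / 2) * ‖v‖ := by ring
      _ ≤ _ := by gcongr
  calc _ ≤ _ := norm_add_le _ _
    _ ≤ ‖v‖ + 2 * ‖v‖ := by rw [norm_neg]; exact add_le_add hT hS
    _ = _ := by ring

variable [IsProbabilityMeasure μ]

lemma hasFDerivAt_charDiff (h : IsIsotropicPoincare μ l) (α : ℝ) (x : EuclideanSpace ℝ (Fin n)) :
    HasFDerivAt (charDiff μ α) (innerSL ℝ (charDiffGrad μ α x)) x := by
  have hd : HasFDerivAt (fun x => ∫ y, Real.cos (inner ℝ x y + α) ∂μ)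
      (∫ y, -Real.sin (inner ℝ x y + α) • innerSL ℝ y ∂μ) x := by
    refine hasFDerivAt_integral_of_dominated_of_fderiv_le (s := Set.univ)
      (F' := fun x y => -Real.sin (inner ℝ x y + α) • innerSL ℝ y)
      (bound := fun y => ‖y‖) Filter.univ_mem ?_ ?_ ?_ ?_ h.integrable_norm ?_
    · exact Filter.Eventually.of_forall fun x => by fun_prop
    · exact Integrable.of_bound (by fun_prop) 1 (ae_of_all _ fun y => Real.abs_cos_le_one _)
    · fun_prop
    · refine ae_of_all _ fun y x _ => ?_
      rw [norm_smul, innerSL_apply_norm, norm_neg]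
      exact mul_le_of_le_one_left (norm_nonneg _) (Real.abs_sin_le_one _)
    · refine ae_of_all _ fun y x _ => ?_
      have h1 : HasFDerivAt (fun x => inner ℝ x y + α) (innerSL ℝ y) x := by
        refine ((innerSL ℝ y).hasFDerivAt.add_const α).congr_of_eventuallyEq ?_
        exact Filter.Eventually.of_forall fun z => by simp [real_inner_comm]
      exact h1.cos
  have hint : Integrable (fun y => Real.sin (inner ℝ x y + α) • y) μ :=
    (h.memLp.integrable (by norm_num)).bdd_smul 1
      (by fun_prop : Continuous fun y => Real.sin (inner ℝ x y + α)).aestronglyMeasurable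
      (ae_of_all _ fun y => Real.abs_sin_le_one _)
  have hint2 : Integrable (fun y => -Real.sin (inner ℝ x y + α) • innerSL ℝ y) μ := by
    refine h.integrable_norm.mono' (by fun_prop) (ae_of_all _ fun y => ?_)
    rw [norm_smul, innerSL_apply_norm, norm_neg]
    exact mul_le_of_le_one_left (norm_nonneg _) (Real.abs_sin_le_one _)
  convert! hd.sub ((hasFDerivAt_exp_neg_norm_sq x).const_mul (Real.cos α)) using 1
  ext v
  simp only [charDiffGrad, innerSL_apply_apply, inner_add_left, inner_neg_left, inner_smul_left,
    FunLike.coe_sub, Pi.sub_apply, FunLike.coe_smul, Pi.smul_apply, smul_eq_mul]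
  rw [ContinuousLinearMap.integral_apply hint2, real_inner_comm, ← integral_inner hint,
    ← integral_neg]
  simp only [FunLike.coe_smul, Pi.smul_apply, smul_eq_mul, innerSL_apply_apply, inner_smul_right,
    real_inner_comm v, conj_trivial]
  simp only [neg_mul, mul_neg, sub_neg_eq_add, mul_assoc]

lemma hasFDerivAt_charDiffGrad (h : IsIsotropicPoincare μ l) (α : ℝ)
    (x : EuclideanSpace ℝ (Fin n)) :
    HasFDerivAt (charDiffGrad μ α) (charDiffHess μ α x) x := by
  have hint (x : EuclideanSpace ℝ (Fin n)) :
      Integrable (fun y => Real.sin (inner ℝ x y + α) • y) μ :=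
    (h.memLp.integrable (by norm_num)).bdd_smul 1
      (by fun_prop : Continuous fun y => Real.sin (inner ℝ x y + α)).aestronglyMeasurable
      (ae_of_all _ fun y => Real.abs_sin_le_one _)
  have hd : HasFDerivAt (fun x => ∫ y, Real.sin (inner ℝ x y + α) • y ∂μ)
      (∫ y, Real.cos (inner ℝ x y + α) • (innerSL ℝ y).smulRight y ∂μ) x := by
    refine hasFDerivAt_integral_of_dominated_of_fderiv_le (s := Set.univ)
      (F' := fun x y => Real.cos (inner ℝ x y + α) • (innerSL ℝ y).smulRight y)
      (bound := fun y => ‖y‖ ^ 2) Filter.univ_mem ?_ (hint x) ?_ ?_ h.integrable_norm_sq ?_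
    · exact Filter.Eventually.of_forall fun x => by fun_prop
    · exact (h.integrable_smulRight (by fun_prop) fun y => Real.abs_cos_le_one _).1
    · refine ae_of_all _ fun y x _ => ?_
      rw [norm_smul, ContinuousLinearMap.norm_smulRight_apply, innerSL_apply_norm, ← sq]
      exact mul_le_of_le_one_left (by positivity) (Real.abs_cos_le_one _)
    · refine ae_of_all _ fun y x _ => ?_
      have h1 : HasFDerivAt (fun x => inner ℝ x y + α) (innerSL ℝ y) x := by
        refine ((innerSL ℝ y).hasFDerivAt.add_const α).congr_of_eventuallyEq ?_
        exact Filter.Eventually.of_forall fun z => by simp [real_inner_comm]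
      convert! (h1.sin).smul_const y using 1
      ext v
      simp [mul_assoc]
  have h2 := ((hasFDerivAt_exp_neg_norm_sq x).const_mul (Real.cos α)).smul (hasFDerivAt_id x)
  convert! hd.neg.add h2 using 1
  rw [charDiffHess]
  congr 1
  ext v
  simp
  ring

lemma continuous_charDiffGrad (h : IsIsotropicPoincare μ l) (α : ℝ) :
    Continuous (charDiffGrad μ α) :=
  continuous_iff_continuousAt.2 fun x => (h.hasFDerivAt_charDiffGrad α x).continuousAt

lemma continuous_charDiff (h : IsIsotropicPoincare μ l) (α : ℝ) :
    Continuous (charDiff μ α) :=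
  continuous_iff_continuousAt.2 fun x => (h.hasFDerivAt_charDiff α x).continuousAt

lemma abs_charDiff_le (α : ℝ) (x : EuclideanSpace ℝ (Fin n)) : |charDiff μ α x| ≤ 2 := by
  unfold charDiff
  have h1 : |∫ y, Real.cos (inner ℝ x y + α) ∂μ| ≤ 1 := by
    have := norm_integral_le_of_norm_le_const (μ := μ) (C := 1)
      (f := fun y => Real.cos (inner ℝ x y + α)) (ae_of_all _ fun y => Real.abs_cos_le_one _)
    simpa using this
  have h2 : |Real.cos α * Real.exp (-‖x‖ ^ 2 / 2)| ≤ 1 := by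
    rw [abs_mul, Real.abs_exp]
    refine mul_le_one₀ (Real.abs_cos_le_one _) (Real.exp_pos _).le ?_
    exact Real.exp_le_one_iff.2 (by nlinarith [sq_nonneg ‖x‖])
  rw [abs_le] at h1 h2 ⊢
  exact ⟨by linarith, by linarith⟩

lemma norm_charDiffGrad_le (h : IsIsotropicPoincare μ l) (α : ℝ) (x : EuclideanSpace ℝ (Fin n)) :
    ‖charDiffGrad μ α x‖ ≤ ∫ y, ‖y‖ ∂μ + 2 := by
  unfold charDiffGrad
  refine (norm_add_le _ _).trans (add_le_add ?_ ?_)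
  · rw [norm_neg]
    refine norm_integral_le_of_norm_le h.integrable_norm (ae_of_all _ fun y => ?_)
    rw [norm_smul]
    exact mul_le_of_le_one_left (norm_nonneg _) (Real.abs_sin_le_one _)
  · rw [norm_smul, norm_mul, Real.norm_eq_abs, Real.norm_of_nonneg (Real.exp_pos _).le, mul_assoc]
    refine (mul_le_of_le_one_left (by positivity) (Real.abs_cos_le_one _)).trans ?_
    have h1 : Real.exp (-‖x‖ ^ 2 / 2) * Real.exp (‖x‖ ^ 2 / 2) = 1 := by
      rw [← Real.exp_add]
      ring_nf
      simp
    have h2 := Real.add_one_le_exp (‖x‖ ^ 2 / 2)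
    have h3 : ‖x‖ ≤ 2 * Real.exp (‖x‖ ^ 2 / 2) := by nlinarith [sq_nonneg (‖x‖ - 1)]
    nlinarith [Real.exp_pos (-‖x‖ ^ 2 / 2)]

/-- The Hilbert–Schmidt norm of the Hessian. The identity is subtracted from `y ⊗ y`, at the cost
of the term with `charDiff`, which is small itself. -/
lemma integral_norm_charDiffHess_sq_le (h : IsIsotropicPoincare μ l) (hn : 1 ≤ n) (α : ℝ)
    (x : EuclideanSpace ℝ (Fin n)) :
    ∫ v, ‖charDiffHess μ α x v‖ ^ 2 ∂(stdGaussian (EuclideanSpace ℝ (Fin n))) ≤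
      3 * (8 / l + n * charDiff μ α x ^ 2) := by
  set γ := stdGaussian (EuclideanSpace ℝ (Fin n))
  have hl := h.pos
  have hl1 := h.le_one hn
  set ψ : EuclideanSpace ℝ (Fin n) → ℝ := fun y => Real.cos (inner ℝ x y + α)
  have hψ : Continuous ψ := by fun_prop
  have hψ1 (y) : |ψ y| ≤ 1 := Real.abs_cos_le_one _
  have hψi : Integrable ψ μ := Integrable.of_bound hψ.aestronglyMeasurable 1 (ae_of_all _ hψ1)
  set b : Fin n → Fin n → ℝ := fun i j => ∫ y, ψ y * (y i * y j - if i = j then 1 else 0) ∂μ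
  have hS := h.sum_integral_mul_sq_le hψ hψ1
  set B : Fin n → EuclideanSpace ℝ (Fin n) := fun i => WithLp.toLp 2 (b i)
  set R : EuclideanSpace ℝ (Fin n) → EuclideanSpace ℝ (Fin n) :=
    fun v => WithLp.toLp 2 fun i => inner ℝ (B i) v
  set u := charDiff μ α x
  set e := Real.cos α * Real.exp (-‖x‖ ^ 2 / 2) with he
  have hu : u = ∫ y, ψ y ∂μ - e := rfl
  have hψij (i j : Fin n) : Integrable
      (fun y : EuclideanSpace ℝ (Fin n) => ψ y * (y i * y j - if i = j then 1 else 0)) μ :=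
    ((h.integrable_mul i j).sub (integrable_const _)).bdd_mul hψ.aestronglyMeasurable
      (ae_of_all _ hψ1)
  -- `R` is the matrix of `∫ cos (⟨x, y⟩ + α) (y ⊗ y - 1) dμ`, with rows `B i`.
  have hdec (v : EuclideanSpace ℝ (Fin n)) :
      charDiffHess μ α x v = -(R v + u • v + (e * inner ℝ x v) • x) := by
    rw [h.charDiffHess_apply]
    have hI := h.integrable_cos_mul_inner_smul α x v
    have hTi (i : Fin n) : (∫ y, (Real.cos (inner ℝ x y + α) * inner ℝ y v) • y ∂μ) i =
        R v i + (∫ y, ψ y ∂μ) * v i := by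
      have h1 := (EuclideanSpace.proj (𝕜 := ℝ) i :
        EuclideanSpace ℝ (Fin n) →L[ℝ] ℝ).integral_comp_comm hI
      simp only [PiLp.proj_apply, PiLp.smul_apply, smul_eq_mul] at h1
      rw [← h1]
      have h2 : R v i = ∫ y, ∑ j, v j * (ψ y * (y i * y j - if i = j then 1 else 0)) ∂μ := by
        rw [integral_finsetSum _ fun j _ => (hψij i j).const_mul _]
        simp only [R, B, PiLp.inner_apply, RCLike.inner_apply, conj_trivial, integral_const_mul, b]
      rw [h2, ← integral_mul_const, ← integral_add
        (integrable_finsetSum _ fun j _ => (hψij i j).const_mul _) (hψi.mul_const _)]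
      congr with y
      have h3 (j : Fin n) : v j * (ψ y * (y i * y j - if i = j then 1 else 0)) =
          ψ y * y i * (y j * v j) - (if i = j then ψ y * v j else 0) := by
        split_ifs <;> ring
      simp only [h3, Finset.sum_sub_distrib, ← Finset.mul_sum, Finset.sum_ite_eq,
        Finset.mem_univ, if_true]
      have h4 : inner ℝ y v = ∑ j, y j * v j := by
        simp [PiLp.inner_apply, mul_comm]
      rw [h4]
      simp only [ψ]
      ring
    ext i
    simp only [PiLp.add_apply, PiLp.neg_apply, PiLp.smul_apply, PiLp.sub_apply, smul_eq_mul, hTi]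
    rw [hu]
    ring
  have hRn (v : EuclideanSpace ℝ (Fin n)) : ‖R v‖ ^ 2 = ∑ i, inner ℝ (B i) v ^ 2 := by
    rw [EuclideanSpace.real_norm_sq_eq]
  have hBi (i : Fin n) := integral_inner_sq_stdGaussian (B i)
  have hRint : Integrable (fun v => ‖R v‖ ^ 2) γ := by
    simp_rw [hRn]
    exact integrable_finsetSum _ fun i _ => (hBi i).1
  have hRle : ∫ v, ‖R v‖ ^ 2 ∂γ ≤ 4 / l := by
    simp_rw [hRn]
    rw [integral_finsetSum _ fun i _ => (hBi i).1]
    simp_rw [fun i => (hBi i).2, EuclideanSpace.real_norm_sq_eq]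
    exact hS
  have hx := integral_inner_sq_stdGaussian x
  have hvn := integral_norm_sq_stdGaussian n
  have hpt (v : EuclideanSpace ℝ (Fin n)) : ‖charDiffHess μ α x v‖ ^ 2 ≤
      3 * ((‖R v‖ ^ 2 + u ^ 2 * ‖v‖ ^ 2) + (e ^ 2 * ‖x‖ ^ 2) * inner ℝ x v ^ 2) := by
    rw [hdec, norm_neg]
    have h1 := norm_add₃_le (a := R v) (b := u • v) (c := (e * inner ℝ x v) • x)
    have h2 : ‖u • v‖ ^ 2 = u ^ 2 * ‖v‖ ^ 2 := by
      rw [norm_smul, mul_pow, Real.norm_eq_abs, sq_abs]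
    have h3 : ‖(e * inner ℝ x v) • x‖ ^ 2 = (e ^ 2 * ‖x‖ ^ 2) * inner ℝ x v ^ 2 := by
      rw [norm_smul, mul_pow, Real.norm_eq_abs, sq_abs]
      ring
    rw [← h2, ← h3]
    set a := ‖R v‖
    set c := ‖u • v‖
    set d := ‖(e * inner ℝ x v) • x‖
    calc _ ≤ (a + c + d) ^ 2 := pow_le_pow_left₀ (norm_nonneg _) h1 2
      _ ≤ _ := by nlinarith [sq_nonneg (a - c), sq_nonneg (a - d), sq_nonneg (c - d)]
  have hi12 : Integrable (fun v => ‖R v‖ ^ 2 + u ^ 2 * ‖v‖ ^ 2) γ :=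
    hRint.add (hvn.1.const_mul _)
  have hi3 : Integrable (fun v => (e ^ 2 * ‖x‖ ^ 2) * inner ℝ x v ^ 2) γ := hx.1.const_mul _
  have hmono : ∫ v, ‖charDiffHess μ α x v‖ ^ 2 ∂γ ≤
      ∫ v, 3 * ((‖R v‖ ^ 2 + u ^ 2 * ‖v‖ ^ 2) + (e ^ 2 * ‖x‖ ^ 2) * inner ℝ x v ^ 2) ∂γ := by
    refine integral_mono ?_ ((hi12.add hi3).const_mul 3) hpt
    exact ((charDiffHess μ α x).comp_memLp'
      (IsGaussian.memLp_id γ 2 (by simp))).integrable_norm_pow two_ne_zero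
  rw [integral_const_mul, integral_add hi12 hi3, integral_add hRint (hvn.1.const_mul _),
    integral_const_mul, integral_const_mul, hx.2, hvn.2] at hmono
  have h4 : e ^ 2 * ‖x‖ ^ 2 * ‖x‖ ^ 2 ≤ 4 := by
    have h5 : ‖x‖ ^ 2 / 2 * Real.exp (-(‖x‖ ^ 2 / 2)) ≤ 1 := mul_exp_neg_le_one _
    have h6 : e ^ 2 * ‖x‖ ^ 2 * ‖x‖ ^ 2 =
        Real.cos α ^ 2 * (4 * (‖x‖ ^ 2 / 2 * Real.exp (-(‖x‖ ^ 2 / 2))) ^ 2) := by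
      rw [he, neg_div]
      ring
    rw [h6]
    have h7 : 0 ≤ ‖x‖ ^ 2 / 2 * Real.exp (-(‖x‖ ^ 2 / 2)) := by positivity
    have h8 : (‖x‖ ^ 2 / 2 * Real.exp (-(‖x‖ ^ 2 / 2))) ^ 2 ≤ 1 := pow_le_one₀ h7 h5
    have h9 := Real.cos_sq_le_one α
    nlinarith [sq_nonneg (Real.cos α)]
  have h10 : 4 ≤ 4 / l := by
    rw [le_div_iff₀ hl]
    linarith
  have h11 : 8 / l = 4 / l + 4 / l := by ring
  rw [h11]
  linarith

end IsIsotropicPoincare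

/-! ### Moments of the characteristic function along random directions -/

namespace IsIsotropicPoincare

variable {n : ℕ} {μ : Measure (EuclideanSpace ℝ (Fin n))} [IsProbabilityMeasure μ] {l : ℝ}

lemma integral_charDiff_smul (α δ : ℝ) :
    ∫ x, charDiff μ α (δ • x) ∂(stdGaussian (EuclideanSpace ℝ (Fin n))) =
      Real.cos α * (∫ y, Real.exp (-δ ^ 2 * ‖y‖ ^ 2 / 2) ∂μ - (1 + δ ^ 2) ^ (-(n / 2 : ℝ))) := by
  set γ := stdGaussian (EuclideanSpace ℝ (Fin n))
  have hint : Integrable (fun p : EuclideanSpace ℝ (Fin n) × EuclideanSpace ℝ (Fin n) =>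
      Real.cos (inner ℝ (δ • p.1) p.2 + α)) (γ.prod μ) :=
    Integrable.of_bound (by fun_prop) 1 (ae_of_all _ fun p => Real.abs_cos_le_one _)
  have h1 : ∫ x, ∫ y, Real.cos (inner ℝ (δ • x) y + α) ∂μ ∂γ =
      Real.cos α * ∫ y, Real.exp (-δ ^ 2 * ‖y‖ ^ 2 / 2) ∂μ := by
    rw [integral_integral_swap hint, ← integral_const_mul]
    congr with y
    have := integral_cos_inner_add_stdGaussian (δ • y) α
    simp_rw [inner_smul_right] at this
    simp_rw [inner_smul_left, conj_trivial]
    rw [this, norm_smul, mul_pow, Real.norm_eq_abs, sq_abs, neg_mul]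
  have h2 := integral_exp_neg_mul_norm_sq_stdGaussian (E := EuclideanSpace ℝ (Fin n))
    (sq_nonneg δ)
  have h3 (x : EuclideanSpace ℝ (Fin n)) : Real.exp (-‖δ • x‖ ^ 2 / 2) =
      Real.exp (-δ ^ 2 * ‖x‖ ^ 2 / 2) := by
    rw [norm_smul, mul_pow, Real.norm_eq_abs, sq_abs, neg_mul]
  unfold charDiff
  simp_rw [h3]
  have h4 : Integrable (fun x => Real.cos α * Real.exp (-δ ^ 2 * ‖x‖ ^ 2 / 2)) γ := by
    refine Integrable.of_bound (by fun_prop) 1 (ae_of_all _ fun x => ?_)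
    rw [norm_mul, Real.norm_of_nonneg (Real.exp_pos _).le]
    refine mul_le_one₀ (Real.abs_cos_le_one _) (Real.exp_pos _).le ?_
    exact Real.exp_le_one_iff.2 (by nlinarith [mul_nonneg (sq_nonneg δ) (sq_nonneg ‖x‖)])
  rw [integral_sub hint.integral_prod_left h4, h1, integral_const_mul, h2,
    finrank_euclideanSpace_fin, mul_sub]

/-- The mean of the gradient is, up to `|sin α| ≤ 1`, the vector of
`IsIsotropicPoincare.norm_integral_exp_smul_sq_le`. -/
lemma norm_integral_charDiffGrad_smul_sq_le (h : IsIsotropicPoincare μ l) (α δ : ℝ) :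
    ‖∫ x, charDiffGrad μ α (δ • x) ∂(stdGaussian (EuclideanSpace ℝ (Fin n)))‖ ^ 2 ≤ δ ^ 2 / l := by
  set γ := stdGaussian (EuclideanSpace ℝ (Fin n))
  have hint : Integrable (fun p : EuclideanSpace ℝ (Fin n) × EuclideanSpace ℝ (Fin n) =>
      Real.sin (inner ℝ (δ • p.1) p.2 + α) • p.2) (γ.prod μ) := by
    have hid : Integrable (fun p : EuclideanSpace ℝ (Fin n) × EuclideanSpace ℝ (Fin n) => ‖p.2‖)
        (γ.prod μ) := h.integrable_norm.comp_snd γ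
    refine hid.mono' (by fun_prop) (ae_of_all _ fun p => ?_)
    rw [norm_smul]
    exact mul_le_of_le_one_left (norm_nonneg _) (Real.abs_sin_le_one _)
  have h1 : ∫ x, ∫ y, Real.sin (inner ℝ (δ • x) y + α) • y ∂μ ∂γ =
      Real.sin α • ∫ y, Real.exp (-δ ^ 2 * ‖y‖ ^ 2 / 2) • y ∂μ := by
    rw [integral_integral_swap hint, ← integral_smul]
    congr with y : 1
    rw [integral_smul_const, smul_smul]
    congr 1
    have := integral_cos_inner_add_stdGaussian (δ • y) (α - Real.pi / 2)
    simp_rw [inner_smul_right, ← add_sub_assoc, Real.cos_sub_pi_div_two] at this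
    simp_rw [inner_smul_left, conj_trivial]
    rw [this, norm_smul, mul_pow, Real.norm_eq_abs, sq_abs, neg_mul]
  -- The Gaussian part of the gradient is odd.
  have h2 : ∫ x, (Real.cos α * Real.exp (-‖δ • x‖ ^ 2 / 2)) • (δ • x) ∂γ = 0 := by
    have hneg : γ.map (LinearIsometryEquiv.neg ℝ) = γ := stdGaussian_map _
    have h3 : ∫ x, (Real.cos α * Real.exp (-‖δ • x‖ ^ 2 / 2)) • (δ • x) ∂γ =
        -∫ x, (Real.cos α * Real.exp (-‖δ • x‖ ^ 2 / 2)) • (δ • x) ∂γ := by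
      conv_lhs => rw [← hneg, integral_map (by fun_prop) (by fun_prop)]
      simp [integral_neg]
    have h4 : (2 : ℝ) • ∫ x, (Real.cos α * Real.exp (-‖δ • x‖ ^ 2 / 2)) • (δ • x) ∂γ = 0 := by
      rw [two_smul]
      nth_rewrite 1 [h3]
      exact neg_add_cancel _
    exact (smul_eq_zero.1 h4).resolve_left two_ne_zero
  have hi2 : Integrable (fun x => (Real.cos α * Real.exp (-‖δ • x‖ ^ 2 / 2)) • (δ • x)) γ := by
    have hid := ((IsGaussian.memLp_id γ 1 (by simp)).integrable le_rfl).smul δ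
    refine hid.norm.mono' (by fun_prop) (ae_of_all _ fun x => ?_)
    rw [norm_smul]
    refine mul_le_of_le_one_left (norm_nonneg _) ?_
    rw [norm_mul, Real.norm_of_nonneg (Real.exp_pos _).le]
    refine mul_le_one₀ (Real.abs_cos_le_one _) (Real.exp_pos _).le ?_
    exact Real.exp_le_one_iff.2 (by nlinarith [sq_nonneg ‖δ • x‖])
  unfold charDiffGrad
  rw [integral_add (by exact hint.integral_prod_left.neg) hi2, integral_neg, h1, h2, add_zero,
    norm_neg, norm_smul, mul_pow, Real.norm_eq_abs, sq_abs]
  refine (mul_le_of_le_one_left (by positivity) (Real.sin_sq_le_one α)).trans ?_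
  exact h.norm_integral_exp_smul_sq_le (sq_nonneg δ)

lemma sq_integral_charDiff_smul_le (h : IsIsotropicPoincare μ l) (hn : 1 ≤ n) (α : ℝ) {δ : ℝ}
    (hδ : n * δ ^ 4 ≤ 1 / 40) :
    (∫ x, charDiff μ α (δ • x) ∂(stdGaussian (EuclideanSpace ℝ (Fin n)))) ^ 2 ≤
      (18 * min 1 (n * δ ^ 2 / 2) / (n * l)) ^ 2 := by
  rw [integral_charDiff_smul, ← sq_abs]
  refine pow_le_pow_left₀ (abs_nonneg _) ?_ 2
  rw [abs_mul]
  exact (mul_le_of_le_one_left (abs_nonneg _) (Real.abs_cos_le_one α)).trans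
    (h.abs_integral_exp_sub_le hn hδ)

lemma pi_div_two_sq_le : (Real.pi / 2) ^ 2 ≤ 5 / 2 := by
  have := Real.pi_lt_d2
  have := Real.pi_pos
  nlinarith

lemma hasFDerivAt_charDiff_smul (h : IsIsotropicPoincare μ l) (α δ : ℝ)
    (x : EuclideanSpace ℝ (Fin n)) :
    HasFDerivAt (fun x => charDiff μ α (δ • x)) (δ • innerSL ℝ (charDiffGrad μ α (δ • x))) x := by
  have h1 := (h.hasFDerivAt_charDiff α (δ • x)).comp x ((hasFDerivAt_id x).const_smul δ)
  convert! h1 using 1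
  ext v
  simp

lemma hasFDerivAt_charDiffGrad_smul (h : IsIsotropicPoincare μ l) (α δ : ℝ)
    (x : EuclideanSpace ℝ (Fin n)) :
    HasFDerivAt (fun x => charDiffGrad μ α (δ • x)) (δ • charDiffHess μ α (δ • x)) x := by
  have h1 := (h.hasFDerivAt_charDiffGrad α (δ • x)).comp x ((hasFDerivAt_id x).const_smul δ)
  convert! h1 using 1
  ext v
  simp

/-- Second moment of the gradient: the Gaussian Poincaré inequality is applied to the gradient and
to the function, and the term `charDiff²` produced by the Hessian is absorbed. -/
lemma integral_norm_charDiffGrad_sq_le (h : IsIsotropicPoincare μ l) (hN : 10 ≤ n * l) (α : ℝ)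
    {δ : ℝ} (hδ : n * δ ^ 4 ≤ 1 / 40) :
    ∫ x, ‖charDiffGrad μ α (δ • x)‖ ^ 2 ∂(stdGaussian (EuclideanSpace ℝ (Fin n))) ≤
      700 * δ ^ 2 / l := by
  set γ := stdGaussian (EuclideanSpace ℝ (Fin n))
  have hl := h.pos
  have hn : 1 ≤ n := by
    rcases Nat.eq_zero_or_pos n with h0 | h0
    · rw [h0] at hN; norm_num at hN
    · exact h0
  have hn0 : (0 : ℝ) < n := by exact_mod_cast hn
  have hpi := pi_div_two_sq_le
  have hUc : Continuous fun x : EuclideanSpace ℝ (Fin n) => charDiff μ α (δ • x) :=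
    (h.continuous_charDiff α).comp (continuous_const_smul δ)
  have hGc : Continuous fun x : EuclideanSpace ℝ (Fin n) => charDiffGrad μ α (δ • x) :=
    (h.continuous_charDiffGrad α).comp (continuous_const_smul δ)
  have hHc : Continuous fun x : EuclideanSpace ℝ (Fin n) => charDiffHess μ α (δ • x) :=
    (h.continuous_charDiffHess α).comp (continuous_const_smul δ)
  set m := ∫ x, charDiff μ α (δ • x) ∂γ
  set a := ∫ x, charDiff μ α (δ • x) ^ 2 ∂γ
  set V := ∫ x, charDiffGrad μ α (δ • x) ∂γ
  set b := ∫ x, ‖charDiffGrad μ α (δ • x)‖ ^ 2 ∂γ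
  have hUint : Integrable (fun x => charDiff μ α (δ • x)) γ :=
    Integrable.of_bound hUc.aestronglyMeasurable 2 (ae_of_all _ fun x => abs_charDiff_le α _)
  have hU2int : Integrable (fun x => charDiff μ α (δ • x) ^ 2) γ := by
    refine Integrable.of_bound (hUc.pow 2).aestronglyMeasurable (2 ^ 2) (ae_of_all _ fun x => ?_)
    rw [norm_pow]
    exact pow_le_pow_left₀ (norm_nonneg _) (abs_charDiff_le α _) 2
  set B := ∫ y, ‖y‖ ∂μ + 2
  have hGB (x : EuclideanSpace ℝ (Fin n)) : ‖charDiffGrad μ α (δ • x)‖ ≤ B :=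
    h.norm_charDiffGrad_le α _
  have hGint : Integrable (fun x => charDiffGrad μ α (δ • x)) γ :=
    Integrable.of_bound hGc.aestronglyMeasurable B (ae_of_all _ hGB)
  have hG2int : Integrable (fun x => ‖charDiffGrad μ α (δ • x)‖ ^ 2) γ := by
    refine Integrable.of_bound (hGc.norm.pow 2).aestronglyMeasurable (B ^ 2) (ae_of_all _ fun x => ?_)
    rw [norm_pow, norm_norm]
    exact pow_le_pow_left₀ (norm_nonneg _) (hGB x) 2
  have ha0 : 0 ≤ a := integral_nonneg fun x => by positivity
  have hb0 : 0 ≤ b := integral_nonneg fun x => by positivity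
  have hm2 := h.sq_integral_charDiff_smul_le hn α hδ
  -- The Gaussian Poincaré inequality for `charDiff μ α (δ ·)`.
  have ha : a ≤ m ^ 2 + 5 / 2 * (δ ^ 2 * b) := by
    have h1 := integral_centered_norm_sq_le (f := fun x => charDiff μ α (δ • x))
      (h := fun x => δ ^ 2 * ‖charDiffGrad μ α (δ • x)‖ ^ 2) (B := 2)
      (h.hasFDerivAt_charDiff_smul α δ) (by fun_prop) (fun x => abs_charDiff_le α _)
      (hG2int.const_mul _) (fun x => le_of_eq (by
        have := (integral_inner_sq_stdGaussian (charDiffGrad μ α (δ • x))).2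
        simp only [FunLike.coe_smul, Pi.smul_apply, norm_smul, mul_pow, innerSL_apply_apply,
          Real.norm_eq_abs, sq_abs]
        rw [integral_const_mul, this]))
    rw [integral_const_mul] at h1
    have h2 : ∫ x, ‖charDiff μ α (δ • x) - m‖ ^ 2 ∂γ = a - m ^ 2 := by
      simp_rw [Real.norm_eq_abs, sq_abs]
      have hmem : MemLp (fun x => charDiff μ α (δ • x)) 2 γ :=
        (memLp_two_iff_integrable_sq hUc.aestronglyMeasurable).2 hU2int
      rw [← variance_eq_integral hUc.aemeasurable, variance_eq_sub hmem]
      simp [a, m]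
    change ∫ x, ‖charDiff μ α (δ • x) - m‖ ^ 2 ∂γ ≤ _ * (δ ^ 2 * b) at h1
    rw [h2] at h1
    have : 0 ≤ δ ^ 2 * b := by positivity
    nlinarith
  -- The same inequality for the gradient.
  have hb : b ≤ δ ^ 2 / l + 5 / 2 * (δ ^ 2 * (3 * (8 / l + n * a))) := by
    have hi : Integrable (fun x => δ ^ 2 * (3 * (8 / l + n * charDiff μ α (δ • x) ^ 2))) γ :=
      (((integrable_const _).add (hU2int.const_mul _)).const_mul _).const_mul _
    have h1 := integral_centered_norm_sq_le (f := fun x => charDiffGrad μ α (δ • x))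
      (h := fun x => δ ^ 2 * (3 * (8 / l + n * charDiff μ α (δ • x) ^ 2))) (B := B)
      (h.hasFDerivAt_charDiffGrad_smul α δ) (by fun_prop) hGB hi (fun x => by
        have := h.integral_norm_charDiffHess_sq_le hn α (δ • x)
        simp only [FunLike.coe_smul, Pi.smul_apply, norm_smul, mul_pow,
          Real.norm_eq_abs, sq_abs]
        rw [integral_const_mul]
        exact mul_le_mul_of_nonneg_left this (sq_nonneg δ))
    rw [integral_const_mul, integral_const_mul, integral_add (integrable_const _)
      (hU2int.const_mul _), integral_const_mul] at h1
    simp only [integral_const, probReal_univ, smul_eq_mul, one_mul] at h1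
    change ∫ x, ‖charDiffGrad μ α (δ • x) - V‖ ^ 2 ∂γ ≤ _ * (δ ^ 2 * (3 * (8 / l + n * a))) at h1
    have h2 : ∫ x, ‖charDiffGrad μ α (δ • x) - V‖ ^ 2 ∂γ = b - ‖V‖ ^ 2 := by
      have h3 (x : EuclideanSpace ℝ (Fin n)) : ‖charDiffGrad μ α (δ • x) - V‖ ^ 2 =
          ‖charDiffGrad μ α (δ • x)‖ ^ 2 - 2 * inner ℝ V (charDiffGrad μ α (δ • x)) + ‖V‖ ^ 2 := by
        rw [norm_sub_sq_real, real_inner_comm]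
      simp_rw [h3]
      have h4 := (hGint.const_inner (𝕜 := ℝ) V).const_mul 2
      rw [integral_add (by exact hG2int.sub h4) (integrable_const _), integral_sub hG2int h4,
        integral_const_mul, integral_inner hGint V, real_inner_self_eq_norm_sq]
      simp only [integral_const, probReal_univ, smul_eq_mul, one_mul]
      ring
    rw [h2] at h1
    have h5 := h.norm_integral_charDiffGrad_smul_sq_le α δ
    have : 0 ≤ δ ^ 2 * (3 * (8 / l + n * a)) := by positivity
    have h6 := mul_le_mul_of_nonneg_right hpi this
    linarith
  have hmN : n * m ^ 2 ≤ 33 / l := by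
    have h1 : (18 * min 1 (n * δ ^ 2 / 2) / (n * l)) ^ 2 ≤ (18 / (n * l)) ^ 2 := by
      refine pow_le_pow_left₀ ?_ ?_ 2
      · have : 0 ≤ min 1 (n * δ ^ 2 / 2) := le_min one_pos.le (by positivity)
        positivity
      · gcongr
        linarith [min_le_left 1 (n * δ ^ 2 / 2)]
    have h2 : n * (18 / (n * l)) ^ 2 = 324 / (n * l) / l := by field_simp; norm_num
    calc n * m ^ 2 ≤ n * (18 / (n * l)) ^ 2 := mul_le_mul_of_nonneg_left (hm2.trans h1) hn0.le
      _ = 324 / (n * l) / l := h2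
      _ ≤ _ := by
        gcongr
        rw [div_le_iff₀ (by positivity)]
        linarith
  -- Substituting the first inequality in the second one yields `b ≤ C δ² / l + (15 / 32) b`, where the
  -- hypothesis `n δ⁴ ≤ 1 / 40` keeps the last coefficient below one.
  have h1 : n * a ≤ n * m ^ 2 + 5 / 2 * (n * δ ^ 2 * b) := by
    calc n * a ≤ n * (m ^ 2 + 5 / 2 * (δ ^ 2 * b)) := by gcongr
      _ = _ := by ring
  have h2 : δ ^ 2 * (n * δ ^ 2 * b) ≤ 1 / 40 * b := by
    calc _ = n * δ ^ 4 * b := by ring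
      _ ≤ _ := by gcongr
  have h3 : δ ^ 2 * (n * a) ≤ δ ^ 2 * (33 / l) + 5 / 2 * (1 / 40 * b) := by
    calc δ ^ 2 * (n * a) ≤ δ ^ 2 * (n * m ^ 2 + 5 / 2 * (n * δ ^ 2 * b)) := by gcongr
      _ = δ ^ 2 * (n * m ^ 2) + 5 / 2 * (δ ^ 2 * (n * δ ^ 2 * b)) := by ring
      _ ≤ _ := by gcongr
  have h4 : 700 * δ ^ 2 / l = 700 * (δ ^ 2 / l) := by ring
  have h5 : δ ^ 2 * (33 / l) = 33 * (δ ^ 2 / l) := by ring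
  have h6 : 5 / 2 * (δ ^ 2 * (3 * (8 / l + n * a))) =
      60 * (δ ^ 2 / l) + 15 / 2 * (δ ^ 2 * (n * a)) := by ring
  have h7 : 0 ≤ δ ^ 2 / l := by positivity
  rw [h6] at hb
  rw [h5] at h3
  rw [h4]
  linarith

lemma add_pow_le_two_pow_mul {a b : ℝ} (ha : 0 ≤ a) (hb : 0 ≤ b) (m : ℕ) :
    (a + b) ^ m ≤ 2 ^ m * (a ^ m + b ^ m) := by
  have h1 : a + b ≤ 2 * max a b := by linarith [le_max_left a b, le_max_right a b]
  calc (a + b) ^ m ≤ (2 * max a b) ^ m := pow_le_pow_left₀ (by positivity) h1 m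
    _ = 2 ^ m * max a b ^ m := mul_pow _ _ _
    _ ≤ _ := by
      gcongr
      rcases max_choice a b with h | h <;> rw [h]
      · linarith [pow_nonneg hb m]
      · linarith [pow_nonneg ha m]

/-- Higher moments of the gradient: its norm is a Lipschitz function of the Gaussian vector since
the Hessian is bounded in operator norm. The norm is regularized to be differentiable. -/
lemma integral_norm_charDiffGrad_pow_le (h : IsIsotropicPoincare μ l) (hN : 10 ≤ n * l) (α : ℝ)
    {δ : ℝ} (hδ0 : 0 < δ) (hδ : n * δ ^ 4 ≤ 1 / 40) (k : ℕ) (hk : 1 ≤ k) :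
    ∫ x, ‖charDiffGrad μ α (δ • x)‖ ^ (2 * k) ∂(stdGaussian (EuclideanSpace ℝ (Fin n))) ≤
      (4000 * k * δ ^ 2 / l) ^ k := by
  set γ := stdGaussian (EuclideanSpace ℝ (Fin n))
  have hl := h.pos
  have hn : 1 ≤ n := by
    rcases Nat.eq_zero_or_pos n with h0 | h0
    · rw [h0] at hN; norm_num at hN
    · exact h0
  have hl1 := h.le_one hn
  have hk1 : (1 : ℝ) ≤ k := by exact_mod_cast hk
  have hGc : Continuous fun x : EuclideanSpace ℝ (Fin n) => charDiffGrad μ α (δ • x) :=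
    (h.continuous_charDiffGrad α).comp (continuous_const_smul δ)
  have hHc : Continuous fun x : EuclideanSpace ℝ (Fin n) => charDiffHess μ α (δ • x) :=
    (h.continuous_charDiffHess α).comp (continuous_const_smul δ)
  set G : EuclideanSpace ℝ (Fin n) → EuclideanSpace ℝ (Fin n) :=
    fun x => charDiffGrad μ α (δ • x)
  set H : EuclideanSpace ℝ (Fin n) → EuclideanSpace ℝ (Fin n) →L[ℝ] EuclideanSpace ℝ (Fin n) :=
    fun x => charDiffHess μ α (δ • x)
  set η := δ ^ 2 / l with hη
  have hη0 : 0 < η := by positivity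
  have hδη : δ ^ 2 ≤ η := by
    rw [hη, le_div_iff₀ hl]
    nlinarith [sq_nonneg δ]
  -- The norm of the gradient, regularized so as to be differentiable; adding `η` does not change the
  -- order of magnitude.
  set w : EuclideanSpace ℝ (Fin n) → ℝ := fun x => √(η + ‖G x‖ ^ 2)
  have hpos (x : EuclideanSpace ℝ (Fin n)) : 0 < η + ‖G x‖ ^ 2 := by positivity
  have hw0 (x : EuclideanSpace ℝ (Fin n)) : 0 < w x := Real.sqrt_pos.2 (hpos x)
  have hw2 (x : EuclideanSpace ℝ (Fin n)) : w x ^ 2 = η + ‖G x‖ ^ 2 := Real.sq_sqrt (hpos x).le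
  have hwc : Continuous w := by fun_prop
  have hGw (x : EuclideanSpace ℝ (Fin n)) : ‖G x‖ ≤ w x :=
    Real.le_sqrt_of_sq_le (by linarith)
  set w' : EuclideanSpace ℝ (Fin n) → EuclideanSpace ℝ (Fin n) →L[ℝ] ℝ :=
    fun x => (w x)⁻¹ • (innerSL ℝ (G x)).comp (δ • H x)
  have hw' (x : EuclideanSpace ℝ (Fin n)) : HasFDerivAt w (w' x) x := by
    have h1 := (((h.hasFDerivAt_charDiffGrad_smul α δ x).norm_sq).const_add η).sqrt (hpos x).ne'
    convert! h1 using 1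
    ext v
    have := (hw0 x).ne'
    simp only [w', w, G, H, FunLike.coe_smul, Pi.smul_apply, ContinuousLinearMap.comp_apply,
      smul_eq_mul, innerSL_apply_apply, two_smul, FunLike.coe_add, Pi.add_apply, one_div, mul_inv]
    ring
  have hwinv : Continuous fun x => (w x)⁻¹ := hwc.inv₀ fun x => (hw0 x).ne'
  have hw'c : Continuous w' := by
    have h1 : Continuous fun x => (innerSL ℝ (G x)).comp (δ • H x) :=
      ((innerSL ℝ).continuous.comp hGc).clm_comp (hHc.const_smul δ)
    exact hwinv.smul h1
  have hw'n (x : EuclideanSpace ℝ (Fin n)) : ‖w' x‖ ≤ 3 * δ := by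
    have h1 : ‖(innerSL ℝ (G x)).comp (δ • H x)‖ ≤ ‖G x‖ * (δ * 3) := by
      refine (ContinuousLinearMap.opNorm_comp_le _ _).trans ?_
      rw [innerSL_apply_norm, norm_smul, Real.norm_of_nonneg hδ0.le]
      gcongr
      exact h.norm_charDiffHess_le α _
    simp only [w']
    rw [norm_smul, norm_inv, Real.norm_of_nonneg (hw0 x).le, inv_mul_le_iff₀ (hw0 x)]
    refine h1.trans ?_
    have := hGw x
    nlinarith [mul_le_mul_of_nonneg_right this hδ0.le]
  set B := ∫ y, ‖y‖ ∂μ + 2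
  have hGB (x : EuclideanSpace ℝ (Fin n)) : ‖G x‖ ≤ B := h.norm_charDiffGrad_le α _
  set W := √(η + B ^ 2)
  have hwW (x : EuclideanSpace ℝ (Fin n)) : |w x| ≤ W := by
    rw [abs_of_pos (hw0 x)]
    refine Real.sqrt_le_sqrt ?_
    have := pow_le_pow_left₀ (norm_nonneg _) (hGB x) 2
    linarith
  have hconc := integral_centered_pow_le hw' hw'c hwW hw'n k hk
  set M := ∫ x, w x ∂γ
  change ∫ x, (w x - M) ^ (2 * k) ∂γ ≤ _ * ∫ x, ‖w' x‖ ^ (2 * k) ∂γ at hconc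
  have hwint : Integrable w γ := Integrable.of_bound (by fun_prop) W (ae_of_all _ hwW)
  have hw2int : Integrable (fun x => w x ^ 2) γ := by
    refine Integrable.of_bound (by fun_prop) (W ^ 2) (ae_of_all _ fun x => ?_)
    rw [norm_pow]
    exact pow_le_pow_left₀ (norm_nonneg _) (hwW x) 2
  have hM0 : 0 ≤ M := integral_nonneg fun x => (hw0 x).le
  have hM2 : M ^ 2 ≤ 701 * η := by
    have hmem : MemLp w 2 γ := (memLp_two_iff_integrable_sq hwc.aestronglyMeasurable).2 hw2int
    have h1 : 0 ≤ ∫ x, w x ^ 2 ∂γ - M ^ 2 := by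
      have := variance_nonneg w γ
      rw [variance_eq_sub hmem] at this
      simpa using this
    have h2 : ∫ x, w x ^ 2 ∂γ = η + ∫ x, ‖G x‖ ^ 2 ∂γ := by
      simp_rw [hw2]
      rw [integral_add (integrable_const _)]
      · simp
      · refine Integrable.of_bound (by fun_prop) (B ^ 2) (ae_of_all _ fun x => ?_)
        rw [norm_pow, norm_norm]
        exact pow_le_pow_left₀ (norm_nonneg _) (hGB x) 2
    have h3 := h.integral_norm_charDiffGrad_sq_le hN α hδ
    change ∫ x, ‖G x‖ ^ 2 ∂γ ≤ _ at h3
    have h4 : 700 * δ ^ 2 / l = 700 * η := by rw [hη]; ring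
    linarith
  have hpowint (c : ℝ) : Integrable (fun x => |w x - c| ^ (2 * k)) γ := by
    refine Integrable.of_bound (by fun_prop) ((W + |c|) ^ (2 * k)) (ae_of_all _ fun x => ?_)
    rw [norm_pow, norm_abs_eq_norm]
    refine pow_le_pow_left₀ (norm_nonneg _) ((norm_sub_le _ _).trans ?_) _
    exact add_le_add (hwW x) le_rfl
  have hw'int : ∫ x, ‖w' x‖ ^ (2 * k) ∂γ ≤ (9 * η) ^ k := by
    have h1 (x : EuclideanSpace ℝ (Fin n)) : ‖w' x‖ ^ (2 * k) ≤ (9 * η) ^ k := by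
      rw [pow_mul]
      refine pow_le_pow_left₀ (by positivity) ?_ k
      have := pow_le_pow_left₀ (norm_nonneg _) (hw'n x) 2
      nlinarith
    have h2 : Integrable (fun x => ‖w' x‖ ^ (2 * k)) γ := by
      refine Integrable.of_bound (by fun_prop) ((9 * η) ^ k) (ae_of_all _ fun x => ?_)
      rw [norm_pow, norm_norm]
      exact h1 x
    have := integral_mono h2 (integrable_const _) h1
    simpa using this
  have hpt (x : EuclideanSpace ℝ (Fin n)) :
      ‖G x‖ ^ (2 * k) ≤ 2 ^ (2 * k) * (M ^ (2 * k) + |w x - M| ^ (2 * k)) := by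
    refine le_trans ?_ (add_pow_le_two_pow_mul hM0 (abs_nonneg (w x - M)) (2 * k))
    refine pow_le_pow_left₀ (norm_nonneg _) ?_ _
    linarith [hGw x, le_abs_self (w x - M)]
  have hcpow : ∫ x, |w x - M| ^ (2 * k) ∂γ ≤ (270 * k * η) ^ k := by
    simp_rw [Even.pow_abs (even_two_mul k)]
    calc _ ≤ _ := hconc
      _ ≤ (5 / 2 * (12 * k)) ^ k * (9 * η) ^ k := by
        gcongr
        exact pi_div_two_sq_le
      _ = _ := by rw [← mul_pow]; ring
  have hGint : Integrable (fun x => ‖G x‖ ^ (2 * k)) γ := by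
    refine Integrable.of_bound (by fun_prop) (B ^ (2 * k)) (ae_of_all _ fun x => ?_)
    rw [norm_pow, norm_norm]
    exact pow_le_pow_left₀ (norm_nonneg _) (hGB x) _
  calc ∫ x, ‖G x‖ ^ (2 * k) ∂γ
      ≤ ∫ x, 2 ^ (2 * k) * (M ^ (2 * k) + |w x - M| ^ (2 * k)) ∂γ :=
        integral_mono hGint (((integrable_const _).add (hpowint M)).const_mul _) hpt
    _ = 2 ^ (2 * k) * (M ^ (2 * k) + ∫ x, |w x - M| ^ (2 * k) ∂γ) := by
        rw [integral_const_mul, integral_add (integrable_const _) (hpowint M)]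
        simp
    _ ≤ 4 ^ k * ((701 * k * η) ^ k + (270 * k * η) ^ k) := by
        rw [pow_mul]
        norm_num only
        gcongr
        rw [pow_mul]
        refine pow_le_pow_left₀ (by positivity) (hM2.trans ?_) k
        nlinarith
    _ ≤ 4 ^ k * ((701 * k * η) + (270 * k * η)) ^ k := by
        gcongr
        exact pow_add_pow_le (by positivity) (by positivity) (by omega)
    _ ≤ _ := by
        rw [← mul_pow]
        refine pow_le_pow_left₀ (by positivity) ?_ k
        have : 4000 * k * δ ^ 2 / l = 4000 * k * η := by rw [hη]; ring
        rw [this]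
        have : 0 ≤ k * η := by positivity
        linarith

/-- **Second-order concentration**: along a random direction at frequency `√n δ` the
characteristic function differs from the Gaussian one by `O(k δ² / l)` in `L^{2k}`. -/
theorem integral_charDiff_pow_le (h : IsIsotropicPoincare μ l) (hN : 10 ≤ n * l) (α : ℝ)
    {δ : ℝ} (hδ0 : 0 < δ) (hδ : n * δ ^ 4 ≤ 1 / 40) (k : ℕ) (hk : 1 ≤ k) :
    ∫ x, charDiff μ α (δ • x) ^ (2 * k) ∂(stdGaussian (EuclideanSpace ℝ (Fin n))) ≤
      (700 * k * δ ^ 2 / l) ^ (2 * k) := by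
  set γ := stdGaussian (EuclideanSpace ℝ (Fin n))
  have hl := h.pos
  have hn : 1 ≤ n := by
    rcases Nat.eq_zero_or_pos n with h0 | h0
    · rw [h0] at hN; norm_num at hN
    · exact h0
  have hn0 : (0 : ℝ) < n := by exact_mod_cast hn
  have hl1 := h.le_one hn
  have hk1 : (1 : ℝ) ≤ k := by exact_mod_cast hk
  have hUc : Continuous fun x : EuclideanSpace ℝ (Fin n) => charDiff μ α (δ • x) :=
    (h.continuous_charDiff α).comp (continuous_const_smul δ)
  have hGc : Continuous fun x : EuclideanSpace ℝ (Fin n) => charDiffGrad μ α (δ • x) :=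
    (h.continuous_charDiffGrad α).comp (continuous_const_smul δ)
  set η := δ ^ 2 / l with hη
  have hη0 : 0 < η := by positivity
  have hδη : δ ^ 2 ≤ η := by
    rw [hη, le_div_iff₀ hl]
    nlinarith [sq_nonneg δ]
  set B := ∫ y, ‖y‖ ∂μ + 2
  have hGB (x : EuclideanSpace ℝ (Fin n)) : ‖charDiffGrad μ α (δ • x)‖ ≤ B :=
    h.norm_charDiffGrad_le α _
  have hnorm (x : EuclideanSpace ℝ (Fin n)) :
      ‖δ • innerSL ℝ (charDiffGrad μ α (δ • x))‖ = δ * ‖charDiffGrad μ α (δ • x)‖ := by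
    rw [norm_smul, innerSL_apply_norm, Real.norm_of_nonneg hδ0.le]
  have hconc := integral_centered_pow_le (f := fun x => charDiff μ α (δ • x)) (B := 2) (M := δ * B)
    (h.hasFDerivAt_charDiff_smul α δ) (by fun_prop) (fun x => abs_charDiff_le α _)
    (fun x => by rw [hnorm]; exact mul_le_mul_of_nonneg_left (hGB x) hδ0.le) k hk
  simp_rw [hnorm, mul_pow] at hconc
  rw [integral_const_mul] at hconc
  set m := ∫ x, charDiff μ α (δ • x) ∂γ
  have hm : m ^ (2 * k) ≤ (81 * k ^ 2 * η ^ 2) ^ k := by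
    rw [pow_mul]
    refine pow_le_pow_left₀ (by positivity) ?_ k
    refine (h.sq_integral_charDiff_smul_le hn α hδ).trans ?_
    have h1 : 18 * min 1 (n * δ ^ 2 / 2) / (n * l) ≤ 9 * η := by
      calc _ ≤ 18 * (n * δ ^ 2 / 2) / (n * l) := by gcongr; exact min_le_right _ _
        _ = 9 * η := by rw [hη]; field_simp; norm_num
    have h0 : 0 ≤ 18 * min 1 (n * δ ^ 2 / 2) / (n * l) := by
      have : 0 ≤ min 1 (n * δ ^ 2 / 2) := le_min one_pos.le (by positivity)
      positivity
    calc _ ≤ (9 * η) ^ 2 := pow_le_pow_left₀ h0 h1 2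
      _ = 81 * 1 ^ 2 * η ^ 2 := by ring
      _ ≤ _ := by gcongr
  have hc : ∫ x, (charDiff μ α (δ • x) - m) ^ (2 * k) ∂γ ≤ (120000 * k ^ 2 * η ^ 2) ^ k := by
    refine hconc.trans ?_
    have h1 := h.integral_norm_charDiffGrad_pow_le hN α hδ0 hδ k hk
    have hG0 : 0 ≤ ∫ x, ‖charDiffGrad μ α (δ • x)‖ ^ (2 * k) ∂γ :=
      integral_nonneg fun x => by positivity
    have h2 : ((Real.pi / 2) ^ 2) ^ k ≤ (5 / 2) ^ k :=
      pow_le_pow_left₀ (by positivity) pi_div_two_sq_le k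
    have h3 : δ ^ (2 * k) ≤ η ^ k := by
      rw [pow_mul]
      exact pow_le_pow_left₀ (by positivity) hδη k
    have h4 : 4000 * k * δ ^ 2 / l = 4000 * k * η := by rw [hη]; ring
    rw [h4] at h1
    have h5 : (120000 * k ^ 2 * η ^ 2 : ℝ) ^ k =
        (5 / 2) ^ k * (12 * k) ^ k * (η ^ k * (4000 * k * η) ^ k) := by
      rw [← mul_pow, ← mul_pow, ← mul_pow]
      congr 1
      ring
    rw [h5, ← mul_pow 12]
    gcongr
  have hUpow (c : ℝ) : Integrable (fun x => |charDiff μ α (δ • x) - c| ^ (2 * k)) γ := by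
    refine Integrable.of_bound
      ((hUc.sub continuous_const).abs.pow _).aestronglyMeasurable ((2 + |c|) ^ (2 * k)) (ae_of_all _ fun x => ?_)
    rw [norm_pow, norm_abs_eq_norm]
    refine pow_le_pow_left₀ (norm_nonneg _) ((norm_sub_le _ _).trans ?_) _
    exact add_le_add (abs_charDiff_le α _) le_rfl
  have hpt (x : EuclideanSpace ℝ (Fin n)) : charDiff μ α (δ • x) ^ (2 * k) ≤
      2 ^ (2 * k) * (|m| ^ (2 * k) + |charDiff μ α (δ • x) - m| ^ (2 * k)) := by
    rw [← Even.pow_abs (even_two_mul k)]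
    refine le_trans ?_ (add_pow_le_two_pow_mul (abs_nonneg m) (abs_nonneg _) (2 * k))
    refine pow_le_pow_left₀ (abs_nonneg _) ?_ _
    have := abs_add_le m (charDiff μ α (δ • x) - m)
    simpa using this
  have hUint : Integrable (fun x => charDiff μ α (δ • x) ^ (2 * k)) γ := by
    have := hUpow 0
    simpa [Even.pow_abs (even_two_mul k)] using this
  calc ∫ x, charDiff μ α (δ • x) ^ (2 * k) ∂γ
      ≤ ∫ x, 2 ^ (2 * k) * (|m| ^ (2 * k) + |charDiff μ α (δ • x) - m| ^ (2 * k)) ∂γ :=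
        integral_mono hUint (((integrable_const _).add (hUpow m)).const_mul _) hpt
    _ = 4 ^ k * (m ^ (2 * k) + ∫ x, (charDiff μ α (δ • x) - m) ^ (2 * k) ∂γ) := by
        rw [integral_const_mul, integral_add (integrable_const _) (hUpow m), pow_mul]
        simp_rw [Even.pow_abs (even_two_mul k)]
        norm_num
    _ ≤ 4 ^ k * ((81 * k ^ 2 * η ^ 2) ^ k + (120000 * k ^ 2 * η ^ 2) ^ k) := by gcongr
    _ ≤ 4 ^ k * ((81 * k ^ 2 * η ^ 2) + (120000 * k ^ 2 * η ^ 2)) ^ k := by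
        gcongr
        exact pow_add_pow_le (by positivity) (by positivity) (by omega)
    _ ≤ _ := by
        rw [← mul_pow, pow_mul]
        refine pow_le_pow_left₀ (by positivity) ?_ k
        have : 700 * k * δ ^ 2 / l = 700 * k * η := by rw [hη]; ring
        rw [this]
        have : 0 ≤ k ^ 2 * η ^ 2 := by positivity
        linarith

end IsIsotropicPoincare

/-! ### A smoothing inequality for distribution functions -/

section Smoothing

lemma integral_cos_gaussianReal (v : NNReal) (a : ℝ) :
    ∫ t, Real.cos (t * a) ∂(gaussianReal 0 v) = Real.exp (-(v * a ^ 2 / 2)) := by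
  have h := charFun_gaussianReal (μ := 0) (v := v) a
  rw [charFun_apply_real] at h
  have hint : Integrable (fun x : ℝ => Complex.exp (a * x * Complex.I)) (gaussianReal 0 v) := by
    refine Integrable.of_bound (by fun_prop) 1 (ae_of_all _ fun x => ?_)
    rw [← Complex.ofReal_mul, Complex.norm_exp_ofReal_mul_I]
  have h4 := integral_re hint
  simp only [RCLike.re_to_complex] at h4
  rw [h] at h4
  have h5 : Complex.exp (a * (0 : ℝ) * Complex.I - v * a ^ 2 / 2) =
      (Real.exp (-(v * a ^ 2 / 2)) : ℝ) := by
    push_cast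
    congr 1
    ring
  rw [h5, Complex.ofReal_re] at h4
  rw [← h4]
  congr with x
  rw [← Complex.ofReal_mul, Complex.exp_ofReal_mul_I_re, mul_comm]

/-- The Gaussian distribution function with variance `1 / T²` is, up to a constant, an absolutely
convergent sine integral. -/
lemma gaussianReal_real_Iic_sub {T : NNReal} (hT : T ≠ 0) (b : ℝ) :
    (gaussianReal 0 (T ^ 2)⁻¹).real (Set.Iic b) - (gaussianReal 0 (T ^ 2)⁻¹).real (Set.Iic 0) =
      T / √(2 * Real.pi) * ∫ t, Real.sin (t * b) / t ∂(gaussianReal 0 (T ^ 2)) := by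
  have hv : (T ^ 2)⁻¹ ≠ 0 := by positivity
  have hv2 : T ^ 2 ≠ 0 := by positivity
  have hT0 : (0 : ℝ) < T := by
    have := pos_iff_ne_zero.2 hT
    exact_mod_cast this
  have hpdf (a : ℝ) : gaussianPDFReal 0 (T ^ 2)⁻¹ a =
      T / √(2 * Real.pi) * ∫ t, Real.cos (t * a) ∂(gaussianReal 0 (T ^ 2)) := by
    rw [integral_cos_gaussianReal, gaussianPDFReal]
    push_cast
    rw [Real.sqrt_mul (by positivity), Real.sqrt_inv, Real.sqrt_sq hT0.le]
    congr 1
    · rw [mul_inv, inv_inv]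
      ring
    · congr 1
      field_simp
      ring
  have h1 : ∫ a in (0 : ℝ)..b, gaussianPDFReal 0 (T ^ 2)⁻¹ a =
      (gaussianReal 0 (T ^ 2)⁻¹).real (Set.Iic b) -
        (gaussianReal 0 (T ^ 2)⁻¹).real (Set.Iic 0) := by
    have hI := integrable_gaussianPDFReal 0 (T ^ 2)⁻¹
    rw [← intervalIntegral.integral_Iic_sub_Iic hI.integrableOn hI.integrableOn]
    simp only [measureReal_def, gaussianReal_apply_eq_integral 0 hv]
    rw [ENNReal.toReal_ofReal, ENNReal.toReal_ofReal]
    · exact setIntegral_nonneg measurableSet_Iic fun x _ => gaussianPDFReal_nonneg _ _ _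
    · exact setIntegral_nonneg measurableSet_Iic fun x _ => gaussianPDFReal_nonneg _ _ _
  rw [← h1]
  simp_rw [hpdf]
  rw [intervalIntegral.integral_const_mul]
  congr 1
  rw [intervalIntegral_integral_swap]
  · refine integral_congr_ae ?_
    have : NullSingletonClass (gaussianReal 0 (T ^ 2)) := nullSingletonClass_gaussianReal hv2
    have hae : ∀ᵐ t ∂(gaussianReal 0 (T ^ 2)), t ≠ 0 := by
      rw [ae_iff]
      simp
    filter_upwards [hae] with t ht
    have h2 : ∀ a ∈ Set.uIcc 0 b, HasDerivAt (fun a => Real.sin (t * a) / t) (Real.cos (t * a)) a := by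
      intro a _
      have := (((hasDerivAt_id a).const_mul t).sin).div_const t
      convert! this using 1
      simp
      field_simp
    rw [intervalIntegral.integral_eq_sub_of_hasDerivAt h2
      ((by fun_prop : Continuous fun a => Real.cos (t * a)).intervalIntegrable _ _)]
    simp
  · have : IsFiniteMeasure ((volume : Measure ℝ).restrict (Set.uIoc 0 b)) :=
      isFiniteMeasure_restrict.2 (by simp [Set.uIoc])
    exact Integrable.of_bound (by fun_prop) 1 (ae_of_all _ fun p => Real.abs_cos_le_one _)

/-- The weighted `L¹` distance, with weight `exp (-t² / (2 T²)) / |t|`, between a function of the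
frequency and the standard normal characteristic function. -/
noncomputable def smoothedCharDist (f : ℝ → ℂ) (T : ℝ) : ℝ≥0∞ :=
  ∫⁻ t, ‖f t - Complex.exp (-t ^ 2 / 2)‖ₑ / ‖t‖ₑ * ENNReal.ofReal (Real.exp (-t ^ 2 / (2 * T ^ 2)))

lemma integral_real_Iic_sub_comm (κ ν : Measure ℝ) [IsProbabilityMeasure κ]
    [IsProbabilityMeasure ν] (x : ℝ) :
    ∫ w, ν.real (Set.Iic (x - w)) ∂κ = ∫ y, κ.real (Set.Iic (x - y)) ∂ν := by
  have hS : MeasurableSet {p : ℝ × ℝ | p.1 + p.2 ≤ x} :=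
    measurableSet_le (by fun_prop) measurable_const
  have h1 := Measure.prod_apply (μ := κ) (ν := ν) hS
  have h2 := Measure.prod_apply_symm (μ := κ) (ν := ν) hS
  have e1 (w : ℝ) : Prod.mk w ⁻¹' {p : ℝ × ℝ | p.1 + p.2 ≤ x} = Set.Iic (x - w) := by
    ext y
    simp [le_sub_iff_add_le, add_comm]
  have e2 (y : ℝ) : (fun w => (w, y)) ⁻¹' {p : ℝ × ℝ | p.1 + p.2 ≤ x} = Set.Iic (x - y) := by
    ext w
    simp [le_sub_iff_add_le]
  have m1 : Measurable fun w => ν (Set.Iic (x - w)) := by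
    simpa only [e1] using measurable_measure_prodMk_left (ν := ν) hS
  have m2 : Measurable fun y => κ (Set.Iic (x - y)) := by
    simpa only [e2] using measurable_measure_prodMk_right (μ := κ) hS
  simp only [e1] at h1
  simp only [e2] at h2
  simp only [measureReal_def]
  rw [integral_toReal m1.aemeasurable (ae_of_all _ fun w => measure_lt_top _ _),
    integral_toReal m2.aemeasurable (ae_of_all _ fun w => measure_lt_top _ _), ← h1, ← h2]

lemma integral_sin_eq_im_charFun (ν : Measure ℝ) [IsProbabilityMeasure ν] (x t : ℝ) :
    ∫ y, Real.sin (t * (x - y)) ∂ν =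
      (Complex.exp ((t * x : ℝ) * Complex.I) * (starRingEnd ℂ) (charFun ν t)).im := by
  rw [← charFun_neg, charFun_apply_real, ← integral_const_mul]
  have hint : Integrable (fun y : ℝ => Complex.exp ((t * x : ℝ) * Complex.I) *
      Complex.exp ((-t : ℝ) * y * Complex.I)) ν := by
    refine Integrable.of_bound (by fun_prop) 1 (ae_of_all _ fun y => ?_)
    rw [norm_mul, ← Complex.ofReal_mul, Complex.norm_exp_ofReal_mul_I,
      Complex.norm_exp_ofReal_mul_I, one_mul]
  have h4 := integral_im hint
  simp only [RCLike.im_to_complex] at h4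
  rw [← h4]
  congr with y
  rw [← Complex.exp_add, ← add_mul, ← Complex.ofReal_mul, ← Complex.ofReal_add,
    Complex.exp_ofReal_mul_I_im]
  congr 1
  ring

/-- The distribution function of `ν` smoothed by a centred Gaussian law of variance `1 / T²`, as an
integral over frequencies. The first moment of `ν` makes the integrand bounded near `t = 0`. -/
lemma integral_smoothed_eq {T : NNReal} (hT : T ≠ 0) (ν : Measure ℝ) [IsProbabilityMeasure ν]
    (hν : Integrable id ν) (x : ℝ) :
    Integrable (fun t => (∫ y, Real.sin (t * (x - y)) ∂ν) / t) (gaussianReal 0 (T ^ 2)) ∧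
    ∫ w, ν.real (Set.Iic (x - w)) ∂(gaussianReal 0 (T ^ 2)⁻¹) =
      (gaussianReal 0 (T ^ 2)⁻¹).real (Set.Iic 0) + T / √(2 * Real.pi) *
        ∫ t, (∫ y, Real.sin (t * (x - y)) ∂ν) / t ∂(gaussianReal 0 (T ^ 2)) := by
  set κ := gaussianReal 0 (T ^ 2)⁻¹
  set N := gaussianReal 0 (T ^ 2)
  have h1 (y : ℝ) : κ.real (Set.Iic (x - y)) = κ.real (Set.Iic 0) + T / √(2 * Real.pi) *
      ∫ t, Real.sin (t * (x - y)) / t ∂N := by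
    rw [← gaussianReal_real_Iic_sub hT (x - y)]
    ring
  have hint : Integrable (fun p : ℝ × ℝ => Real.sin (p.1 * (x - p.2)) / p.1) (N.prod ν) := by
    have hid : Integrable (fun p : ℝ × ℝ => x - p.2) (N.prod ν) :=
      (integrable_const x).sub (hν.comp_snd N)
    refine hid.norm.mono' (Measurable.aestronglyMeasurable (by fun_prop)) (ae_of_all _ fun p => ?_)
    rw [norm_div]
    rcases eq_or_ne p.1 0 with h0 | h0
    · simp [h0]
    · rw [div_le_iff₀ (norm_pos_iff.2 h0), Real.norm_eq_abs]
      refine Real.abs_sin_le_abs.trans ?_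
      rw [abs_mul, mul_comm]
      rfl
  refine ⟨?_, ?_⟩
  · have := hint.integral_prod_left
    simpa only [integral_div] using this
  · rw [integral_real_Iic_sub_comm]
    simp_rw [h1]
    rw [integral_add (integrable_const _) (hint.integral_prod_right.const_mul _),
      integral_const_mul, ← integral_integral_swap hint]
    simp [integral_div]

lemma abs_integral_smoothed_sub_le {T : NNReal} (hT : T ≠ 0) (ν : Measure ℝ)
    [IsProbabilityMeasure ν] (hν : Integrable id ν) (x : ℝ) {j : ℝ} (hj : 0 ≤ j)
    (hJ : smoothedCharDist (charFun ν) T ≤ ENNReal.ofReal j) :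
    |∫ w, ν.real (Set.Iic (x - w)) ∂(gaussianReal 0 (T ^ 2)⁻¹) -
      ∫ w, (gaussianReal 0 1).real (Set.Iic (x - w)) ∂(gaussianReal 0 (T ^ 2)⁻¹)| ≤
      j / (2 * Real.pi) := by
  have hpi := Real.pi_pos
  have hT0 : (0 : ℝ) < T := by
    have := pos_iff_ne_zero.2 hT
    exact_mod_cast this
  have hv2 : T ^ 2 ≠ 0 := by positivity
  obtain ⟨i1, e1⟩ := integral_smoothed_eq hT ν hν x
  obtain ⟨i2, e2⟩ := integral_smoothed_eq hT (gaussianReal 0 1)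
    ((memLp_id_gaussianReal 1).integrable (by simp)) x
  rw [e1, e2, add_sub_add_left_eq_sub, ← mul_sub, ← integral_sub i1 i2]
  set N := gaussianReal 0 (T ^ 2)
  have hpt (t : ℝ) : ‖(∫ y, Real.sin (t * (x - y)) ∂ν) / t -
      (∫ y, Real.sin (t * (x - y)) ∂(gaussianReal 0 1)) / t‖ₑ ≤
      ‖charFun ν t - Complex.exp (-t ^ 2 / 2)‖ₑ / ‖t‖ₑ := by
    rcases eq_or_ne t 0 with h0 | h0
    · simp [h0]
    rw [← sub_div, div_eq_mul_inv, enorm_mul, enorm_inv h0, ← div_eq_mul_inv]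
    gcongr
    rw [integral_sin_eq_im_charFun, integral_sin_eq_im_charFun, ← Complex.sub_im, ← mul_sub,
      ← map_sub, charFun_gaussianReal]
    have h2 : Complex.exp (t * (0 : ℝ) * Complex.I - ((1 : NNReal) : ℝ) * t ^ 2 / 2) =
        Complex.exp (-t ^ 2 / 2) := by
      congr 1
      push_cast
      ring
    rw [h2, enorm_le_iff_norm_le]
    refine (Complex.abs_im_le_norm _).trans ?_
    rw [norm_mul, Complex.norm_exp_ofReal_mul_I, one_mul, RCLike.norm_conj]
  have hmeas : Measurable fun t => ‖charFun ν t - Complex.exp (-t ^ 2 / 2)‖ₑ / ‖t‖ₑ := by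
    have := measurable_charFun (μ := ν)
    fun_prop
  have hbound : ‖∫ t, ((∫ y, Real.sin (t * (x - y)) ∂ν) / t -
      (∫ y, Real.sin (t * (x - y)) ∂(gaussianReal 0 1)) / t) ∂N‖ₑ ≤
      ENNReal.ofReal ((√(2 * Real.pi) * T)⁻¹ * j) := by
    calc _ ≤ ∫⁻ t, ‖charFun ν t - Complex.exp (-t ^ 2 / 2)‖ₑ / ‖t‖ₑ ∂N :=
          (enorm_integral_le_lintegral_enorm _).trans (lintegral_mono hpt)
      _ = ENNReal.ofReal (√(2 * Real.pi) * T)⁻¹ * smoothedCharDist (charFun ν) T := by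
          simp only [N]
          rw [gaussianReal_of_var_ne_zero 0 hv2, lintegral_withDensity_eq_lintegral_mul _
            (measurable_gaussianPDF _ _) hmeas, smoothedCharDist,
            ← lintegral_const_mul' _ _ ENNReal.ofReal_ne_top]
          refine lintegral_congr fun t => ?_
          rw [Pi.mul_apply, gaussianPDF, gaussianPDFReal, ENNReal.ofReal_mul (by positivity)]
          push_cast
          rw [Real.sqrt_mul (by positivity), Real.sqrt_sq hT0.le, sub_zero]
          ring
      _ ≤ ENNReal.ofReal (√(2 * Real.pi) * T)⁻¹ * ENNReal.ofReal j := by gcongr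
      _ = _ := by rw [← ENNReal.ofReal_mul (by positivity)]
  rw [← ofReal_norm, ENNReal.ofReal_le_ofReal_iff (by positivity), Real.norm_eq_abs] at hbound
  rw [abs_mul, abs_of_pos (by positivity)]
  calc _ ≤ T / √(2 * Real.pi) * ((√(2 * Real.pi) * T)⁻¹ * j) := by gcongr
    _ = j / (√(2 * Real.pi) ^ 2) := by field_simp
    _ = _ := by rw [Real.sq_sqrt (by positivity)]

lemma stdNormalCDF_sub_le {x y : ℝ} (hxy : x ≤ y) :
    stdNormalCDF y - stdNormalCDF x ≤ (y - x) / 2 := by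
  have hI := integrable_gaussianPDFReal 0 1
  have h1 : ∫ a in x..y, gaussianPDFReal 0 1 a = stdNormalCDF y - stdNormalCDF x := by
    rw [← intervalIntegral.integral_Iic_sub_Iic hI.integrableOn hI.integrableOn]
    simp only [stdNormalCDF, measureReal_def, gaussianReal_apply_eq_integral 0 one_ne_zero]
    rw [ENNReal.toReal_ofReal, ENNReal.toReal_ofReal]
    · exact setIntegral_nonneg measurableSet_Iic fun x _ => gaussianPDFReal_nonneg _ _ _
    · exact setIntegral_nonneg measurableSet_Iic fun x _ => gaussianPDFReal_nonneg _ _ _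
  have h2 (a : ℝ) : gaussianPDFReal 0 1 a ≤ 1 / 2 := by
    rw [gaussianPDFReal]
    have h3 : (2 : ℝ) ≤ √(2 * Real.pi * (1 : NNReal)) := by
      refine Real.le_sqrt_of_sq_le ?_
      have := Real.pi_gt_three
      push_cast
      linarith
    have h4 : Real.exp (-(a - 0) ^ 2 / (2 * (1 : NNReal))) ≤ 1 := by
      refine Real.exp_le_one_iff.2 ?_
      push_cast
      nlinarith [sq_nonneg (a - 0)]
    calc _ ≤ (2 : ℝ)⁻¹ * 1 := by gcongr
      _ = _ := by norm_num
  have h3 := intervalIntegral.integral_mono_on hxy (hI.intervalIntegrable)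
    (intervalIntegrable_const (c := (1 / 2 : ℝ))) fun a _ => h2 a
  rw [h1, intervalIntegral.integral_const, smul_eq_mul] at h3
  linarith

lemma gaussianReal_real_abs_le {T : NNReal} (hT : T ≠ 0) :
    3 / 4 ≤ (gaussianReal 0 (T ^ 2)⁻¹).real {w | |w| ≤ 2 / T} := by
  set κ := gaussianReal 0 (T ^ 2)⁻¹
  have hT0 : (0 : ℝ) < T := by
    have := pos_iff_ne_zero.2 hT
    exact_mod_cast this
  have hch := meas_ge_le_variance_div_sq (μ := κ) (memLp_id_gaussianReal 2)
    (by positivity : (0 : ℝ) < 2 / T)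
  have hmean : ∫ x, id x ∂κ = 0 := integral_id_gaussianReal
  rw [variance_id_gaussianReal, hmean] at hch
  have h1 : κ.real {w | 2 / (T : ℝ) ≤ |id w - 0|} ≤ 1 / 4 := by
    refine ENNReal.toReal_le_of_le_ofReal (by norm_num) (hch.trans (le_of_eq ?_))
    congr 1
    push_cast
    field_simp
    norm_num
  have h2 : {w : ℝ | |w| ≤ 2 / T}ᶜ ⊆ {w | 2 / (T : ℝ) ≤ |id w - 0|} := by
    intro w hw
    simp only [Set.mem_compl_iff, Set.mem_ofPred_eq, not_le] at hw
    simpa using hw.le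
  have h3 := (measureReal_mono (μ := κ) h2).trans h1
  have hm : MeasurableSet {w : ℝ | |w| ≤ 2 / T} := measurableSet_le (by fun_prop) (by fun_prop)
  rw [probReal_compl_eq_one_sub hm] at h3
  linarith

/-- **Smoothing inequality** (Esseen type, with a Gaussian kernel). The smoothed difference of the
distribution functions is bounded by the frequency integral; since `Φ` is Lipschitz and `ν` has a
monotone distribution function, the unsmoothed difference exceeds it by little. -/
theorem abs_real_Iic_sub_stdNormalCDF_le {T : NNReal} (hT : T ≠ 0) (ν : Measure ℝ)
    [IsProbabilityMeasure ν] (hν : Integrable id ν) {j : ℝ} (hj : 0 ≤ j)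
    (hJ : smoothedCharDist (charFun ν) T ≤ ENNReal.ofReal j) (x : ℝ) :
    |ν.real (Set.Iic x) - stdNormalCDF x| ≤ j + 3 / T := by
  have hT0 : (0 : ℝ) < T := by
    have := pos_iff_ne_zero.2 hT
    exact_mod_cast this
  set κ := gaussianReal 0 (T ^ 2)⁻¹
  set F : ℝ → ℝ := fun x => ν.real (Set.Iic x)
  set H : ℝ → ℝ := fun x => F x - stdNormalCDF x
  have hFm : Monotone F := fun a b hab => measureReal_mono (Set.Iic_subset_Iic.2 hab)
  have hΦm : Monotone stdNormalCDF := fun a b hab => measureReal_mono (Set.Iic_subset_Iic.2 hab)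
  have hF01 (x : ℝ) : 0 ≤ F x ∧ F x ≤ 1 := ⟨measureReal_nonneg, measureReal_le_one⟩
  have hΦ01 (x : ℝ) : 0 ≤ stdNormalCDF x ∧ stdNormalCDF x ≤ 1 :=
    ⟨measureReal_nonneg, measureReal_le_one⟩
  have hH1 (x : ℝ) : |H x| ≤ 1 := by
    rw [abs_le]
    constructor <;> linarith [(hF01 x).1, (hF01 x).2, (hΦ01 x).1, (hΦ01 x).2]
  have hbdd : BddAbove (Set.range fun x => |H x|) := ⟨1, by rintro _ ⟨x, rfl⟩; exact hH1 x⟩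
  set Δ := ⨆ x, |H x|
  have hΔ (x : ℝ) : |H x| ≤ Δ := le_ciSup hbdd x
  have hFmeas : Measurable F := hFm.measurable
  have hΦmeas : Measurable stdNormalCDF := hΦm.measurable
  have hFi (x : ℝ) : Integrable (fun w => F (x - w)) κ :=
    Integrable.of_bound (hFmeas.comp (measurable_const.sub measurable_id)).aestronglyMeasurable 1
      (ae_of_all _ fun w => by
        rw [Real.norm_of_nonneg (hF01 _).1]
        exact (hF01 _).2)
  have hΦi (x : ℝ) : Integrable (fun w => stdNormalCDF (x - w)) κ :=
    Integrable.of_bound (hΦmeas.comp (measurable_const.sub measurable_id)).aestronglyMeasurable 1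
      (ae_of_all _ fun w => by
        rw [Real.norm_of_nonneg (hΦ01 _).1]
        exact (hΦ01 _).2)
  have hHi (x : ℝ) : Integrable (fun w => H (x - w)) κ := (hFi x).sub (hΦi x)
  set B := j / (2 * Real.pi)
  have hB (x : ℝ) : |∫ w, H (x - w) ∂κ| ≤ B := by
    have := abs_integral_smoothed_sub_le hT ν hν x hj hJ
    change |∫ w, F (x - w) ∂κ - ∫ w, stdNormalCDF (x - w) ∂κ| ≤ B at this
    rwa [← integral_sub (hFi x) (hΦi x)] at this
  set a := 2 / (T : ℝ)
  have ha0 : 0 < a := by positivity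
  have hq := gaussianReal_real_abs_le hT
  change 3 / 4 ≤ κ.real {w | |w| ≤ a} at hq
  have hm : MeasurableSet {w : ℝ | |w| ≤ a} := measurableSet_le (by fun_prop) (by fun_prop)
  have hind (c : ℝ) : Integrable ({w : ℝ | |w| ≤ a}.indicator fun _ => c) κ :=
    (integrable_const c).indicator hm
  -- Both one-sided bounds evaluate the smoothed difference at a point shifted by `a`.
  have hup (x : ℝ) : H x ≤ 4 / 3 * B + Δ / 3 + a := by
    by_contra! hc
    have hlow : ∀ w, {w : ℝ | |w| ≤ a}.indicator (fun _ => H x - a + Δ) w - Δ ≤ H (x + a - w) := by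
      intro w
      by_cases hw : |w| ≤ a
      · rw [Set.indicator_of_mem (by exact hw)]
        rw [abs_le] at hw
        have h1 : F x ≤ F (x + a - w) := hFm (by linarith)
        have h2 := stdNormalCDF_sub_le (x := x) (y := x + a - w) (by linarith)
        simp only [H]
        linarith
      · rw [Set.indicator_of_notMem (by exact hw)]
        have := hΔ (x + a - w)
        rw [abs_le] at this
        linarith
    have h1 := integral_mono (μ := κ) ((hind _).sub (integrable_const Δ)) (hHi (x + a)) hlow
    rw [integral_sub' (hind _) (integrable_const Δ), integral_indicator_const _ hm] at h1
    simp only [integral_const, probReal_univ, smul_eq_mul, one_mul] at h1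
    have h2 := (abs_le.1 (hB (x + a))).2
    have h3 : 0 ≤ Δ := (abs_nonneg _).trans (hΔ x)
    have h4 : 0 ≤ B := (abs_nonneg _).trans (hB x)
    have h5 : 0 ≤ H x - a + Δ := by linarith
    nlinarith
  have hdown (x : ℝ) : -H x ≤ 4 / 3 * B + Δ / 3 + a := by
    by_contra! hc
    have hlow : ∀ w, H (x - a - w) ≤ Δ - {w : ℝ | |w| ≤ a}.indicator (fun _ => -H x - a + Δ) w := by
      intro w
      by_cases hw : |w| ≤ a
      · rw [Set.indicator_of_mem (by exact hw)]
        rw [abs_le] at hw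
        have h1 : F (x - a - w) ≤ F x := hFm (by linarith)
        have h2 := stdNormalCDF_sub_le (x := x - a - w) (y := x) (by linarith)
        simp only [H]
        linarith
      · rw [Set.indicator_of_notMem (by exact hw)]
        have := hΔ (x - a - w)
        rw [abs_le] at this
        linarith
    have h1 := integral_mono (μ := κ) (hHi (x - a)) ((integrable_const Δ).sub (hind _)) hlow
    rw [integral_sub' (integrable_const Δ) (hind _), integral_indicator_const _ hm] at h1
    simp only [integral_const, probReal_univ, smul_eq_mul, one_mul] at h1
    have h2 := (abs_le.1 (hB (x - a))).1
    have h3 : 0 ≤ Δ := (abs_nonneg _).trans (hΔ x)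
    have h4 : 0 ≤ B := (abs_nonneg _).trans (hB x)
    have h5 : 0 ≤ -H x - a + Δ := by linarith
    nlinarith
  have hΔle : Δ ≤ 4 / 3 * B + Δ / 3 + a :=
    ciSup_le fun x => abs_le'.2 ⟨hup x, hdown x⟩
  have hBj : 2 * B ≤ j := by
    have := Real.pi_gt_three
    have h2 : 2 * B = j / Real.pi := by
      simp only [B]
      field_simp
    rw [h2]
    exact div_le_self hj (by linarith)
  have haT : 3 / 2 * a = 3 / T := by simp only [a]; ring
  calc |H x| ≤ Δ := hΔ x
    _ ≤ _ := by linarith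

end Smoothing

/-! ### Frequency bounds for the characteristic function at a Gaussian random point -/

section CharFunDiff

variable {n : ℕ} {μ : Measure (EuclideanSpace ℝ (Fin n))} {l : ℝ}

/-- The difference between the characteristic function of `μ` and the standard Gaussian one. -/
noncomputable def charFunDiff (μ : Measure (EuclideanSpace ℝ (Fin n)))
    (x : EuclideanSpace ℝ (Fin n)) : ℂ :=
  charFun μ x - Complex.exp (-‖x‖ ^ 2 / 2)

lemma exp_neg_norm_sq_eq_ofReal (x : EuclideanSpace ℝ (Fin n)) :
    Complex.exp (-‖x‖ ^ 2 / 2) = (Real.exp (-‖x‖ ^ 2 / 2) : ℝ) := by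
  push_cast
  rfl

lemma norm_charFunDiff_neg (x : EuclideanSpace ℝ (Fin n)) :
    ‖charFunDiff μ (-x)‖ = ‖charFunDiff μ x‖ := by
  have : charFunDiff μ (-x) = (starRingEnd ℂ) (charFunDiff μ x) := by
    simp only [charFunDiff, exp_neg_norm_sq_eq_ofReal, charFun_neg, map_sub, Complex.conj_ofReal,
      norm_neg]
  rw [this, RCLike.norm_conj]

lemma integral_exp_neg_mul_norm_sub_sq_le (κ : Measure (EuclideanSpace ℝ (Fin n)))
    [IsProbabilityMeasure κ] (y : EuclideanSpace ℝ (Fin n)) (b : ℝ) (hb : 0 ≤ b) :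
    ∫ x, Real.exp (-b * ‖x - y‖ ^ 2 / 2) ∂κ ≤
      Real.exp (-b * n / 8) + κ.real {x | ‖x - y‖ ^ 2 < n / 4} := by
  have hm : MeasurableSet {x : EuclideanSpace ℝ (Fin n) | ‖x - y‖ ^ 2 < n / 4} :=
    measurableSet_lt (by fun_prop) measurable_const
  have hle (x : EuclideanSpace ℝ (Fin n)) : Real.exp (-b * ‖x - y‖ ^ 2 / 2) ≤ 1 :=
    Real.exp_le_one_iff.2 (by nlinarith [mul_nonneg hb (sq_nonneg ‖x - y‖)])
  have hint : Integrable (fun x => Real.exp (-b * ‖x - y‖ ^ 2 / 2)) κ :=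
    Integrable.of_bound (by fun_prop) 1 (ae_of_all _ fun x => by
      rw [Real.norm_of_nonneg (Real.exp_pos _).le]
      exact hle x)
  have hind : Integrable ({x : EuclideanSpace ℝ (Fin n) | ‖x - y‖ ^ 2 < n / 4}.indicator
      fun _ => (1 : ℝ)) κ := (integrable_const _).indicator hm
  have := integral_mono hint ((integrable_const (Real.exp (-b * n / 8))).add hind) fun x => ?_
  · rw [integral_add' (integrable_const _) hind, integral_indicator_const _ hm] at this
    simpa using this
  · simp only [Pi.add_apply]
    by_cases hx : ‖x - y‖ ^ 2 < n / 4
    · rw [Set.indicator_of_mem (by exact hx)]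
      linarith [hle x, Real.exp_pos (-b * n / 8)]
    · rw [Set.indicator_of_notMem (by exact hx), add_zero]
      refine Real.exp_le_exp.2 ?_
      nlinarith [mul_le_mul_of_nonneg_left (not_lt.1 hx) hb]

variable [IsProbabilityMeasure μ]

lemma measurable_charFunDiff : Measurable (charFunDiff μ) := by
  have := measurable_charFun (μ := μ)
  unfold charFunDiff
  fun_prop

lemma charFun_re_eq (x : EuclideanSpace ℝ (Fin n)) :
    (charFun μ x).re = ∫ y, Real.cos (inner ℝ x y) ∂μ := by
  rw [charFun_apply]
  have hint : Integrable (fun y => Complex.exp (inner ℝ y x * Complex.I)) μ :=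
    Integrable.of_bound (by fun_prop) 1 (ae_of_all _ fun y => by
      rw [Complex.norm_exp_ofReal_mul_I])
  have h := integral_re hint
  simp only [RCLike.re_to_complex] at h
  rw [← h]
  congr with y
  rw [Complex.exp_ofReal_mul_I_re, real_inner_comm]

lemma charFun_im_eq (x : EuclideanSpace ℝ (Fin n)) :
    (charFun μ x).im = ∫ y, Real.sin (inner ℝ x y) ∂μ := by
  rw [charFun_apply]
  have hint : Integrable (fun y => Complex.exp (inner ℝ y x * Complex.I)) μ :=
    Integrable.of_bound (by fun_prop) 1 (ae_of_all _ fun y => by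
      rw [Complex.norm_exp_ofReal_mul_I])
  have h := integral_im hint
  simp only [RCLike.im_to_complex] at h
  rw [← h]
  congr with y
  rw [Complex.exp_ofReal_mul_I_im, real_inner_comm]

lemma norm_charFunDiff_le (x : EuclideanSpace ℝ (Fin n)) :
    ‖charFunDiff μ x‖ ≤ |charDiff μ 0 x| + |charDiff μ (Real.pi / 2) x| := by
  have h1 : (charFunDiff μ x).re = charDiff μ 0 x := by
    simp [charFunDiff, charDiff, exp_neg_norm_sq_eq_ofReal, charFun_re_eq, -Complex.ofReal_exp]
  have h2 : (charFunDiff μ x).im = -charDiff μ (Real.pi / 2) x := by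
    simp [charFunDiff, charDiff, exp_neg_norm_sq_eq_ofReal, charFun_im_eq, -Complex.ofReal_exp,
      Real.cos_add_pi_div_two, integral_neg]
  have := Complex.norm_le_abs_re_add_abs_im (charFunDiff μ x)
  rwa [h1, h2, abs_neg] at this

/-- Even moments of the difference of the characteristic functions at a Gaussian point of length about
`|t|`: the real and imaginary parts are covered by `integral_charDiff_pow_le`. -/
lemma lintegral_charFunDiff_pow_le (h : IsIsotropicPoincare μ l) (hN : 10 ≤ n * l) {t : ℝ}
    (ht0 : t ≠ 0) (ht : t ^ 4 ≤ n / 40) (k : ℕ) (hk : 1 ≤ k) :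
    ∫⁻ x, ‖charFunDiff μ ((t / √n) • x)‖ₑ ^ (2 * k) ∂(stdGaussian (EuclideanSpace ℝ (Fin n))) ≤
      ENNReal.ofReal (1400 * k * t ^ 2 / (n * l)) ^ (2 * k) := by
  have hl := h.pos
  have hn : (0 : ℝ) < n := by
    by_contra hc
    have := mul_nonneg_of_nonpos_of_nonpos (not_lt.1 hc) (neg_nonpos.2 hl.le)
    linarith
  set γ := stdGaussian (EuclideanSpace ℝ (Fin n))
  set δ := |t| / √n with hδdef
  have hδ0 : 0 < δ := by positivity
  have hδ2 : δ ^ 2 = t ^ 2 / n := by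
    rw [hδdef, div_pow, sq_abs, Real.sq_sqrt hn.le]
  have hδ4 : n * δ ^ 4 ≤ 1 / 40 := by
    have : δ ^ 4 = (δ ^ 2) ^ 2 := by ring
    rw [this, hδ2, div_pow, ← pow_mul]
    norm_num
    rw [← mul_div_assoc, div_le_iff₀ (by positivity)]
    nlinarith
  have heven (x : EuclideanSpace ℝ (Fin n)) :
      ‖charFunDiff μ ((t / √n) • x)‖ = ‖charFunDiff μ (δ • x)‖ := by
    rcases abs_choice t with h1 | h1
    · rw [hδdef, h1]
    · rw [hδdef, h1, neg_div, neg_smul, norm_charFunDiff_neg]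
  have hcont (α : ℝ) : Continuous fun x => charDiff μ α (δ • x) :=
    (h.continuous_charDiff α).comp (continuous_const_smul δ)
  have hint (α : ℝ) : Integrable (fun x => charDiff μ α (δ • x) ^ (2 * k)) γ := by
    refine Integrable.of_bound ((hcont α).pow _).aestronglyMeasurable (2 ^ (2 * k))
      (ae_of_all _ fun x => ?_)
    rw [norm_pow]
    exact pow_le_pow_left₀ (norm_nonneg _) (IsIsotropicPoincare.abs_charDiff_le α _) _
  have hpt (x : EuclideanSpace ℝ (Fin n)) : ‖charFunDiff μ ((t / √n) • x)‖ₑ ^ (2 * k) ≤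
      ENNReal.ofReal (2 ^ (2 * k - 1) * (charDiff μ 0 (δ • x) ^ (2 * k) +
        charDiff μ (Real.pi / 2) (δ • x) ^ (2 * k))) := by
    rw [← ofReal_norm, ← ENNReal.ofReal_pow (norm_nonneg _), heven]
    refine ENNReal.ofReal_le_ofReal ?_
    refine (pow_le_pow_left₀ (norm_nonneg _) (norm_charFunDiff_le _) _).trans ?_
    refine (add_pow_le (abs_nonneg _) (abs_nonneg _) _).trans (le_of_eq ?_)
    rw [Even.pow_abs (even_two_mul k), Even.pow_abs (even_two_mul k)]
  refine (lintegral_mono hpt).trans ?_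
  have hintadd : Integrable (fun x => 2 ^ (2 * k - 1) * (charDiff μ 0 (δ • x) ^ (2 * k) +
      charDiff μ (Real.pi / 2) (δ • x) ^ (2 * k))) γ := ((hint 0).add (hint _)).const_mul _
  rw [← ofReal_integral_eq_lintegral_ofReal hintadd
    (ae_of_all _ fun x => by
      have h1 (α : ℝ) : 0 ≤ charDiff μ α (δ • x) ^ (2 * k) := (even_two_mul k).pow_nonneg _
      have := add_nonneg (h1 0) (h1 (Real.pi / 2))
      positivity), ← ENNReal.ofReal_pow (by positivity)]
  refine ENNReal.ofReal_le_ofReal ?_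
  have h1 (α : ℝ) := h.integral_charDiff_pow_le hN α hδ0 hδ4 k hk
  rw [integral_const_mul, integral_add (hint 0) (hint _)]
  have hη : (700 * k * δ ^ 2 / l : ℝ) = 700 * k * t ^ 2 / (n * l) := by
    rw [hδ2]
    field_simp
  calc _ ≤ (2 : ℝ) ^ (2 * k - 1) * ((700 * k * δ ^ 2 / l) ^ (2 * k) +
        (700 * k * δ ^ 2 / l) ^ (2 * k)) := by
        gcongr
        · exact h1 0
        · exact h1 _
    _ = (2 * (700 * k * δ ^ 2 / l)) ^ (2 * k) := by
        rw [mul_pow]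
        obtain ⟨m, hm⟩ : ∃ m, 2 * k = m + 1 := ⟨2 * k - 1, by omega⟩
        rw [hm, Nat.add_sub_cancel]
        ring
    _ = _ := by
        rw [hη]
        congr 1
        ring

lemma norm_charFun_sq (x : EuclideanSpace ℝ (Fin n)) :
    ‖charFun μ x‖ ^ 2 = ∫ p, Real.cos (inner ℝ x (p.1 - p.2)) ∂(μ.prod μ) := by
  have hc : Integrable (fun y => Real.cos (inner ℝ x y)) μ :=
    Integrable.of_bound (by fun_prop) 1 (ae_of_all _ fun y => Real.abs_cos_le_one _)
  have hs : Integrable (fun y => Real.sin (inner ℝ x y)) μ :=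
    Integrable.of_bound (by fun_prop) 1 (ae_of_all _ fun y => Real.abs_sin_le_one _)
  simp_rw [inner_sub_right, Real.cos_sub]
  rw [integral_add (hc.mul_prod hc) (hs.mul_prod hs), integral_prod_mul (fun y => Real.cos (inner ℝ x y)) (fun y => Real.cos (inner ℝ x y)),
    integral_prod_mul (fun y => Real.sin (inner ℝ x y)) (fun y => Real.sin (inner ℝ x y)),
    ← charFun_re_eq, ← charFun_im_eq, Complex.sq_norm, Complex.normSq_apply]

/-- Averaged over Gaussian points, the squared modulus of the characteristic function is a Laplace
transform of `‖y - y'‖²` for independent `y`, `y'` with law `μ`, which is small by the small ball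
estimate. -/
lemma integral_norm_charFun_sq_le (h : IsIsotropicPoincare μ l) (hN : 10 ≤ n * l) (δ : ℝ) :
    ∫ x, ‖charFun μ (δ • x)‖ ^ 2 ∂(stdGaussian (EuclideanSpace ℝ (Fin n))) ≤
      Real.exp (-δ ^ 2 * n / 8) + Real.exp 2 * Real.exp (-(3 / 10) * √(n * l)) := by
  set γ := stdGaussian (EuclideanSpace ℝ (Fin n))
  simp_rw [norm_charFun_sq]
  have hint : Integrable (fun q : EuclideanSpace ℝ (Fin n) ×
      (EuclideanSpace ℝ (Fin n) × EuclideanSpace ℝ (Fin n)) =>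
      Real.cos (inner ℝ (δ • q.1) (q.2.1 - q.2.2))) (γ.prod (μ.prod μ)) :=
    Integrable.of_bound (by fun_prop) 1 (ae_of_all _ fun y => Real.abs_cos_le_one _)
  rw [integral_integral_swap hint]
  have h1 (p : EuclideanSpace ℝ (Fin n) × EuclideanSpace ℝ (Fin n)) :
      ∫ x, Real.cos (inner ℝ (δ • x) (p.1 - p.2)) ∂γ = Real.exp (-δ ^ 2 * ‖p.1 - p.2‖ ^ 2 / 2) := by
    have := integral_cos_inner_add_stdGaussian (δ • (p.1 - p.2)) 0
    simp only [add_zero, Real.cos_zero, one_mul, norm_smul, mul_pow, Real.norm_eq_abs,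
      sq_abs] at this
    simp_rw [real_inner_smul_left, ← real_inner_smul_right]
    rw [this]
    congr 1
    ring
  simp_rw [h1]
  have hint2 : Integrable (fun p : EuclideanSpace ℝ (Fin n) × EuclideanSpace ℝ (Fin n) =>
      Real.exp (-δ ^ 2 * ‖p.1 - p.2‖ ^ 2 / 2)) (μ.prod μ) :=
    Integrable.of_bound (by fun_prop) 1 (ae_of_all _ fun p => by
      rw [Real.norm_of_nonneg (Real.exp_pos _).le]
      exact Real.exp_le_one_iff.2 (by nlinarith [mul_nonneg (sq_nonneg δ) (sq_nonneg ‖p.1 - p.2‖)]))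
  rw [integral_prod_symm _ hint2]
  have h2 (y : EuclideanSpace ℝ (Fin n)) : ∫ x, Real.exp (-δ ^ 2 * ‖x - y‖ ^ 2 / 2) ∂μ ≤
      Real.exp (-δ ^ 2 * n / 8) + Real.exp 2 * Real.exp (-(3 / 10) * √(n * l)) := by
    refine (integral_exp_neg_mul_norm_sub_sq_le μ y (δ ^ 2) (sq_nonneg _)).trans ?_
    gcongr
    refine (measureReal_mono ?_).trans (h.measureReal_ball_le hN y)
    intro x hx
    simp only [Set.mem_ofPred_eq] at hx ⊢
    exact hx.le
  have := integral_mono hint2.integral_prod_right (integrable_const _) h2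
  simpa using this

/-- Away from low frequencies both characteristic functions are small on average, since neither `μ`
nor the standard Gaussian measure charges balls of radius `√n / 2` appreciably. -/
lemma lintegral_charFunDiff_le (h : IsIsotropicPoincare μ l) (hn : 1 ≤ n) (hN : 10 ≤ n * l)
    (t : ℝ) :
    ∫⁻ x, ‖charFunDiff μ ((t / √n) • x)‖ₑ ∂(stdGaussian (EuclideanSpace ℝ (Fin n))) ≤
      ENNReal.ofReal (2 * Real.exp (-t ^ 2 / 16) + 4 * Real.exp (-(3 / 20) * √(n * l))) := by
  have hn0 : (0 : ℝ) < n := by exact_mod_cast hn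
  set γ := stdGaussian (EuclideanSpace ℝ (Fin n))
  set δ := t / √n with hδdef
  have hδ2 : δ ^ 2 * n = t ^ 2 := by
    rw [hδdef, div_pow, Real.sq_sqrt hn0.le]
    field_simp
  set E := Real.exp (-(3 / 20) * √(n * l))
  have hE2 : Real.exp (-(3 / 10) * √(n * l)) = E ^ 2 := by
    rw [← Real.exp_nat_mul]
    congr 1
    push_cast
    ring
  set G := Real.exp (-t ^ 2 / 16) with hG
  have hG2 : Real.exp (-δ ^ 2 * n / 8) = G ^ 2 := by
    rw [← Real.exp_nat_mul, neg_mul, hδ2]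
    congr 1
    push_cast
    ring
  have hmeas : Measurable fun x => charFun μ (δ • x) :=
    (measurable_charFun (μ := μ)).comp (measurable_const_smul δ)
  have hbd (x : EuclideanSpace ℝ (Fin n)) : ‖charFun μ (δ • x)‖ ≤ 1 := norm_charFun_le_one _
  have hint : Integrable (fun x => ‖charFun μ (δ • x)‖) γ :=
    Integrable.of_bound hmeas.norm.aestronglyMeasurable 1 (ae_of_all _ fun x => by
      rw [norm_norm]; exact hbd x)
  have hint2 : Integrable (fun x => ‖charFun μ (δ • x)‖ ^ 2) γ :=
    Integrable.of_bound (hmeas.norm.pow_const 2).aestronglyMeasurable 1 (ae_of_all _ fun x => by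
      rw [norm_pow, norm_norm]; exact pow_le_one₀ (norm_nonneg _) (hbd x))
  have hexp : Integrable (fun x : EuclideanSpace ℝ (Fin n) => Real.exp (-‖δ • x‖ ^ 2 / 2)) γ :=
    Integrable.of_bound (by fun_prop) 1 (ae_of_all _ fun x => by
      rw [Real.norm_of_nonneg (Real.exp_pos _).le]
      exact Real.exp_le_one_iff.2 (by nlinarith [sq_nonneg ‖δ • x‖]))
  have h1 : ∫ x, ‖charFun μ (δ • x)‖ ∂γ ≤ G + Real.exp 1 * E := by
    have hJ : (∫ x, ‖charFun μ (δ • x)‖ ∂γ) ^ 2 ≤ ∫ x, ‖charFun μ (δ • x)‖ ^ 2 ∂γ := by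
      have hv := variance_nonneg (fun x => ‖charFun μ (δ • x)‖) γ
      rw [variance_eq_sub ((memLp_two_iff_integrable_sq hmeas.norm.aestronglyMeasurable).2 hint2)]
        at hv
      simpa using hv
    have h2 := integral_norm_charFun_sq_le h hN δ
    rw [hE2, hG2] at h2
    refine abs_le_of_sq_le_sq' ?_ (by positivity) |>.2
    have he : Real.exp 2 = Real.exp 1 ^ 2 := by rw [← Real.exp_nat_mul]; norm_num
    rw [he] at h2
    have : 0 ≤ G * (Real.exp 1 * E) := by positivity
    nlinarith
  have h3 : ∫ x, Real.exp (-‖δ • x‖ ^ 2 / 2) ∂γ ≤ G + E := by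
    have h4 := integral_exp_neg_mul_norm_sub_sq_le γ 0 (δ ^ 2) (sq_nonneg _)
    simp only [sub_zero] at h4
    have h5 := stdGaussian_real_ball_le n
    have h6 : Real.exp (-(3 / 10) * n) ≤ E := by
      refine Real.exp_le_exp.2 ?_
      have hl1 := h.le_one hn
      have : √(n * l) ≤ n := by
        refine Real.sqrt_le_iff.2 ⟨hn0.le, ?_⟩
        have : (1 : ℝ) ≤ n := by exact_mod_cast hn
        nlinarith
      linarith [Real.sqrt_nonneg (n * l)]
    have h7 : G ^ 2 ≤ G := by
      have : G ≤ 1 := Real.exp_le_one_iff.2 (by nlinarith [sq_nonneg t])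
      nlinarith [Real.exp_pos (-t ^ 2 / 16)]
    rw [hG2] at h4
    simp_rw [norm_smul, mul_pow, Real.norm_eq_abs, sq_abs, ← neg_mul]
    linarith
  calc _ ≤ ∫⁻ x, ENNReal.ofReal (‖charFun μ (δ • x)‖ + Real.exp (-‖δ • x‖ ^ 2 / 2)) ∂γ := by
        refine lintegral_mono fun x => ?_
        rw [← ofReal_norm]
        refine ENNReal.ofReal_le_ofReal ?_
        refine (norm_sub_le _ _).trans ?_
        rw [exp_neg_norm_sq_eq_ofReal, Complex.norm_real, Real.norm_of_nonneg (Real.exp_pos _).le]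
    _ = ENNReal.ofReal (∫ x, (‖charFun μ (δ • x)‖ + Real.exp (-‖δ • x‖ ^ 2 / 2)) ∂γ) :=
        (ofReal_integral_eq_lintegral_ofReal (hint.add hexp)
          (ae_of_all _ fun x => add_nonneg (norm_nonneg _) (Real.exp_pos _).le)).symm
    _ ≤ _ := by
        refine ENNReal.ofReal_le_ofReal ?_
        rw [integral_add hint hexp]
        have := Real.exp_one_lt_d9
        have hE0 : 0 < E := Real.exp_pos _
        nlinarith

end CharFunDiff

/-! ### Tail bounds for the smoothed distance in a random direction -/

/-- Jensen's inequality and Fubini: the `m`-th moment of an integral over a parameter is bounded by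
uniform bounds on the `m`-th moments of the integrand. -/
lemma lintegral_lintegral_pow_le {α β : Type*} [MeasurableSpace α] [MeasurableSpace β]
    {ν : Measure α} {κ : Measure β} [SFinite ν] [SFinite κ] {G : β → α → ℝ≥0∞}
    (hG : Measurable (Function.uncurry G)) {m : ℕ} (hm : 1 ≤ m) {B : ℝ≥0∞}
    (hB : ∀ᵐ t ∂ν, ∫⁻ x, G x t ^ m ∂κ ≤ B ^ m) :
    ∫⁻ x, (∫⁻ t, G x t ∂ν) ^ m ∂κ ≤ (ν Set.univ * B) ^ m := by
  obtain ⟨q, rfl⟩ : ∃ q, m = q + 1 := ⟨m - 1, by omega⟩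
  have hGx (x : β) : Measurable (G x) := hG.comp measurable_prodMk_left
  have hGm : Measurable fun p : β × α => G p.1 p.2 ^ (q + 1) := hG.pow_const _
  calc _ ≤ ∫⁻ x, ν Set.univ ^ q * ∫⁻ t, G x t ^ (q + 1) ∂ν ∂κ :=
        lintegral_mono fun x => pow_lintegral_le (hGx x).aemeasurable q
    _ = ν Set.univ ^ q * ∫⁻ t, ∫⁻ x, G x t ^ (q + 1) ∂κ ∂ν := by
        rw [lintegral_const_mul _ hGm.lintegral_prod_right',
          lintegral_lintegral_swap hGm.aemeasurable]
    _ ≤ ν Set.univ ^ q * ∫⁻ _, B ^ (q + 1) ∂ν := by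
        exact mul_le_mul_right (lintegral_mono_ae hB) _
    _ = _ := by
        rw [lintegral_const, mul_pow]
        ring

/-- Markov's inequality for the `m`-th moment, at `exp 1` times the `L^m` norm. -/
lemma measure_ge_le_exp_neg {β : Type*} [MeasurableSpace β] {κ : Measure β} {Q : β → ℝ≥0∞}
    (hQ : Measurable Q) {c : ℝ} (hc : 0 < c) (m : ℕ)
    (h : ∫⁻ x, Q x ^ m ∂κ ≤ ENNReal.ofReal c ^ m) :
    κ {x | ENNReal.ofReal (Real.exp 1 * c) ≤ Q x} ≤ ENNReal.ofReal (Real.exp (-m)) := by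
  have hM := mul_meas_ge_le_lintegral (μ := κ) (hQ.pow_const m)
    (ENNReal.ofReal (Real.exp 1 * c) ^ m)
  have hsub : {x | ENNReal.ofReal (Real.exp 1 * c) ≤ Q x} ⊆
      {x | ENNReal.ofReal (Real.exp 1 * c) ^ m ≤ Q x ^ m} := fun x hx => by
    simp only [Set.mem_ofPred_eq] at hx ⊢
    exact pow_le_pow_left' hx m
  have h1 := (mul_le_mul_right (measure_mono (μ := κ) hsub)
    (ENNReal.ofReal (Real.exp 1 * c) ^ m)).trans (hM.trans h)
  have hpos : 0 < Real.exp 1 * c := by positivity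
  rw [mul_comm, ← ENNReal.le_div_iff_mul_le (Or.inl (by positivity)) (Or.inl (by finiteness)),
    ← ENNReal.ofReal_pow hc.le, ← ENNReal.ofReal_pow hpos.le,
    ← ENNReal.ofReal_div_of_pos (by positivity), mul_pow, ← Real.exp_nat_mul, mul_one] at h1
  refine h1.trans (le_of_eq ?_)
  congr 1
  rw [Real.exp_neg]
  field_simp

section Direction

variable {n : ℕ} {μ : Measure (EuclideanSpace ℝ (Fin n))} [IsProbabilityMeasure μ] {l : ℝ}

lemma measurable_charFunDiff_smul (c : ℝ) :
    Measurable fun p : EuclideanSpace ℝ (Fin n) × ℝ => ‖charFunDiff μ ((p.2 / c) • p.1)‖ₑ := by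
  have := measurable_charFunDiff (μ := μ)
  fun_prop

/-- Replacing the unit vector `x / ‖x‖` by `x / √n` is a change of frequency, which only costs a
constant factor in the Gaussian cutoff as long as `‖x‖` is not much smaller than `√n`. -/
lemma smoothedCharDist_direction_le (hn : 1 ≤ n) (T : ℝ) {x : EuclideanSpace ℝ (Fin n)}
    (hx : n / 4 ≤ ‖x‖ ^ 2) :
    smoothedCharDist (fun t => charFun μ (t • ‖x‖⁻¹ • x)) T ≤
      ∫⁻ t : ℝ, ‖charFunDiff μ ((t / √n) • x)‖ₑ / ‖t‖ₑ *
        ENNReal.ofReal (Real.exp (-t ^ 2 / (8 * T ^ 2))) := by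
  have hn0 : (0 : ℝ) < n := by exact_mod_cast hn
  have hx0 : 0 < ‖x‖ := by
    by_contra hc
    have : ‖x‖ = 0 := le_antisymm (not_lt.1 hc) (norm_nonneg _)
    rw [this] at hx
    norm_num at hx
    linarith
  set r := ‖x‖ / √n with hrdef
  have hr : 0 < r := by positivity
  have hr2 : 1 / 4 ≤ r ^ 2 := by
    rw [hrdef, div_pow, Real.sq_sqrt hn0.le, le_div_iff₀ hn0]
    linarith
  have hD (t : ℝ) : charFun μ (t • ‖x‖⁻¹ • x) - Complex.exp (-t ^ 2 / 2) =
      charFunDiff μ (t • ‖x‖⁻¹ • x) := by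
    rw [charFunDiff]
    have : ‖t • ‖x‖⁻¹ • x‖ ^ 2 = t ^ 2 := by
      rw [norm_smul, norm_smul, norm_inv, norm_norm, inv_mul_cancel₀ hx0.ne', mul_one,
        Real.norm_eq_abs, sq_abs]
    rw [← Complex.ofReal_pow ‖t • ‖x‖⁻¹ • x‖, this, Complex.ofReal_pow]
  have hm : Measurable fun t : ℝ => ‖charFunDiff μ (t • ‖x‖⁻¹ • x)‖ₑ / ‖t‖ₑ *
      ENNReal.ofReal (Real.exp (-t ^ 2 / (2 * T ^ 2))) := by
    have := measurable_charFunDiff (μ := μ)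
    fun_prop
  simp only [smoothedCharDist, hD]
  conv_lhs => rw [← Real.smul_map_volume_mul_left hr.ne']
  rw [lintegral_smul_measure, lintegral_map hm (measurable_const_mul r), smul_eq_mul,
    ← lintegral_const_mul' _ _ ENNReal.ofReal_ne_top]
  refine lintegral_mono fun t => ?_
  rw [← mul_assoc]
  gcongr ?_ * ENNReal.ofReal (Real.exp ?_)
  · rw [smul_smul, enorm_mul, abs_of_pos hr, Real.enorm_of_nonneg hr.le]
    have h1 : r * t * ‖x‖⁻¹ = t / √n := by
      rw [hrdef]
      field_simp
    have h2 : ENNReal.ofReal r ≠ 0 := by simpa using hr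
    rw [h1, ← mul_div_assoc, ENNReal.mul_div_mul_left _ _ h2 ENNReal.ofReal_ne_top]
  · rcases eq_or_ne T 0 with hT | hT
    · simp [hT]
    rw [div_le_div_iff₀ (by positivity) (by positivity)]
    have : 0 ≤ (r ^ 2 - 1 / 4) * (t ^ 2 * T ^ 2) := mul_nonneg (by linarith) (by positivity)
    nlinarith

lemma lintegral_low_frequency_pow_le (h : IsIsotropicPoincare μ l) (hN : 10 ≤ n * l) {T₀ : ℝ}
    (hT0 : 0 ≤ T₀) (hT : T₀ ^ 4 ≤ n / 40) (k : ℕ) (hk : 1 ≤ k) :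
    ∫⁻ x, (∫⁻ t in Set.Icc (-T₀) T₀, ‖charFunDiff μ ((t / √n) • x)‖ₑ / ‖t‖ₑ) ^ (2 * k)
        ∂(stdGaussian (EuclideanSpace ℝ (Fin n))) ≤
      ENNReal.ofReal (2800 * k * T₀ ^ 2 / (n * l)) ^ (2 * k) := by
  have hmass : (volume.restrict (Set.Icc (-T₀) T₀)) Set.univ = ENNReal.ofReal (2 * T₀) := by
    rw [Measure.restrict_apply_univ, Real.volume_Icc]
    congr 1
    ring
  have hm : Measurable (Function.uncurry fun (x : EuclideanSpace ℝ (Fin n)) (t : ℝ) =>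
      ‖charFunDiff μ ((t / √n) • x)‖ₑ / ‖t‖ₑ) :=
    (measurable_charFunDiff_smul _).div (by fun_prop)
  have hN0 : (0 : ℝ) < n * l := by linarith
  refine (lintegral_lintegral_pow_le hm (m := 2 * k)
    (B := ENNReal.ofReal (1400 * k * T₀ / (n * l))) (by omega) ?_).trans (le_of_eq ?_)
  · have hne : ∀ᵐ t ∂(volume.restrict (Set.Icc (-T₀) T₀)), t ≠ (0 : ℝ) := by
      refine ae_restrict_of_ae ?_
      rw [ae_iff]
      simp
    filter_upwards [hne, ae_restrict_mem measurableSet_Icc] with t ht0 htI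
    have htabs : |t| ≤ T₀ := abs_le.2 htI
    have ht4 : t ^ 4 ≤ n / 40 := by
      rw [← Even.pow_abs (by decide : Even 4)]
      exact (pow_le_pow_left₀ (abs_nonneg _) htabs 4).trans hT
    have h1 := lintegral_charFunDiff_pow_le h hN ht0 ht4 k hk
    have htinv : ‖t‖ₑ⁻¹ ≠ ∞ := by simpa using ht0
    simp_rw [div_eq_mul_inv _ ‖t‖ₑ, mul_pow]
    rw [lintegral_mul_const' _ _ (ENNReal.pow_ne_top htinv)]
    calc _ ≤ ENNReal.ofReal (1400 * k * t ^ 2 / (n * l)) ^ (2 * k) * ‖t‖ₑ⁻¹ ^ (2 * k) := by gcongr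
      _ = (ENNReal.ofReal (1400 * k * |t| / (n * l))) ^ (2 * k) := by
          rw [← mul_pow]
          congr 1
          have htp : 0 < |t| := abs_pos.2 ht0
          rw [← ofReal_norm, Real.norm_eq_abs, ← div_eq_mul_inv, ← ENNReal.ofReal_div_of_pos htp,
            ← sq_abs]
          congr 1
          field_simp
      _ ≤ _ := by gcongr
  · rw [hmass, ← ENNReal.ofReal_mul (by positivity)]
    congr 2
    ring

lemma lintegral_high_frequency_le (h : IsIsotropicPoincare μ l) (hn : 1 ≤ n) (hN : 10 ≤ n * l)
    {T₀ T : ℝ} (hT0 : 1 ≤ T₀) (hT : 0 < T) :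
    ∫⁻ x, (∫⁻ t in (Set.Icc (-T₀) T₀)ᶜ, ‖charFunDiff μ ((t / √n) • x)‖ₑ / ‖t‖ₑ *
        ENNReal.ofReal (Real.exp (-t ^ 2 / (8 * T ^ 2))))
        ∂(stdGaussian (EuclideanSpace ℝ (Fin n))) ≤
      ENNReal.ofReal (22 * Real.exp (-T₀ ^ 2 / 32) +
        22 * T * Real.exp (-(3 / 20) * √(n * l))) := by
  set E := Real.exp (-(3 / 20) * √(n * l))
  have hE : 0 < E := Real.exp_pos _
  have hm : Measurable (Function.uncurry fun (x : EuclideanSpace ℝ (Fin n)) (t : ℝ) =>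
      ‖charFunDiff μ ((t / √n) • x)‖ₑ / ‖t‖ₑ *
        ENNReal.ofReal (Real.exp (-t ^ 2 / (8 * T ^ 2)))) :=
    ((measurable_charFunDiff_smul _).div (by fun_prop)).mul (by fun_prop)
  rw [lintegral_lintegral_swap hm.aemeasurable]
  have hb1 : (0 : ℝ) < 1 / 32 := by norm_num
  have hb2 : 0 < 1 / (8 * T ^ 2) := by positivity
  have hI1 := (integrable_exp_neg_mul_sq hb1).const_mul (2 * Real.exp (-T₀ ^ 2 / 32))
  have hI2 := (integrable_exp_neg_mul_sq hb2).const_mul (4 * E)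
  have hpt : ∀ t ∈ (Set.Icc (-T₀) T₀)ᶜ,
      ∫⁻ x, ‖charFunDiff μ ((t / √n) • x)‖ₑ / ‖t‖ₑ *
        ENNReal.ofReal (Real.exp (-t ^ 2 / (8 * T ^ 2)))
        ∂(stdGaussian (EuclideanSpace ℝ (Fin n))) ≤
      ENNReal.ofReal (2 * Real.exp (-T₀ ^ 2 / 32) * Real.exp (-(1 / 32) * t ^ 2) +
        4 * E * Real.exp (-(1 / (8 * T ^ 2)) * t ^ 2)) := by
    intro t ht
    have htT : T₀ < |t| := by
      by_contra hc
      exact ht (abs_le.1 (not_lt.1 hc))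
    have ht1 : (1 : ℝ≥0∞) ≤ ‖t‖ₑ := by
      rw [← ofReal_norm, Real.norm_eq_abs, ENNReal.one_le_ofReal]
      linarith
    rw [lintegral_mul_const' _ _ ENNReal.ofReal_ne_top]
    calc _ ≤ (∫⁻ x, ‖charFunDiff μ ((t / √n) • x)‖ₑ
            ∂(stdGaussian (EuclideanSpace ℝ (Fin n)))) *
            ENNReal.ofReal (Real.exp (-t ^ 2 / (8 * T ^ 2))) := by
          gcongr with x
          exact ENNReal.div_le_of_le_mul (le_mul_of_one_le_right' ht1)
      _ ≤ ENNReal.ofReal (2 * Real.exp (-t ^ 2 / 16) + 4 * E) *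
            ENNReal.ofReal (Real.exp (-t ^ 2 / (8 * T ^ 2))) := by
          gcongr
          exact lintegral_charFunDiff_le h hn hN t
      _ ≤ _ := by
          rw [← ENNReal.ofReal_mul (by positivity)]
          refine ENNReal.ofReal_le_ofReal ?_
          have e1 : Real.exp (-(1 / (8 * T ^ 2)) * t ^ 2) = Real.exp (-t ^ 2 / (8 * T ^ 2)) := by
            congr 1
            ring
          have e2 : Real.exp (-t ^ 2 / 16) ≤
              Real.exp (-T₀ ^ 2 / 32) * Real.exp (-(1 / 32) * t ^ 2) := by
            rw [← Real.exp_add]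
            refine Real.exp_le_exp.2 ?_
            have : T₀ ^ 2 ≤ t ^ 2 := by
              rw [← sq_abs t]
              exact pow_le_pow_left₀ (by linarith) htT.le 2
            linarith
          have e3 : Real.exp (-t ^ 2 / (8 * T ^ 2)) ≤ 1 := by
            refine Real.exp_le_one_iff.2 ?_
            rw [neg_div, neg_nonpos]
            positivity
          rw [e1, add_mul]
          have := mul_le_of_le_one_right (Real.exp_pos (-t ^ 2 / 16)).le e3
          linarith
  refine (setLIntegral_mono' measurableSet_Icc.compl hpt).trans
    ((setLIntegral_le_lintegral _ _).trans ?_)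
  have hI : Integrable fun t : ℝ => 2 * Real.exp (-T₀ ^ 2 / 32) * Real.exp (-(1 / 32) * t ^ 2) +
      4 * E * Real.exp (-(1 / (8 * T ^ 2)) * t ^ 2) := hI1.add hI2
  rw [← ofReal_integral_eq_lintegral_ofReal hI (ae_of_all _ fun t => by positivity)]
  refine ENNReal.ofReal_le_ofReal ?_
  rw [integral_add hI1 hI2, integral_const_mul, integral_const_mul, integral_gaussian,
    integral_gaussian]
  have hpi := Real.pi_lt_d2
  have s1 : √(Real.pi / (1 / 32)) ≤ 11 := by
    refine Real.sqrt_le_iff.2 ⟨by norm_num, ?_⟩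
    linarith
  have s2 : √(Real.pi / (1 / (8 * T ^ 2))) ≤ 11 / 2 * T := by
    refine Real.sqrt_le_iff.2 ⟨by positivity, ?_⟩
    rw [div_div_eq_mul_div, div_one]
    nlinarith [sq_nonneg T]
  have h1 : 2 * Real.exp (-T₀ ^ 2 / 32) * √(Real.pi / (1 / 32)) ≤
      2 * Real.exp (-T₀ ^ 2 / 32) * 11 := by gcongr
  have h2 : 4 * E * √(Real.pi / (1 / (8 * T ^ 2))) ≤ 4 * E * (11 / 2 * T) := by gcongr
  linarith

end Direction

section RandomDirection

variable {n : ℕ} {μ : Measure (EuclideanSpace ℝ (Fin n))} [IsProbabilityMeasure μ] {l : ℝ}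

lemma measurable_smoothedCharDist (T : ℝ) :
    Measurable fun θ : EuclideanSpace ℝ (Fin n) =>
      smoothedCharDist (fun t => charFun μ (t • θ)) T := by
  have := measurable_charFun (μ := μ)
  have hm : Measurable fun p : EuclideanSpace ℝ (Fin n) × ℝ =>
      ‖charFun μ (p.2 • p.1) - Complex.exp (-p.2 ^ 2 / 2)‖ₑ / ‖p.2‖ₑ *
        ENNReal.ofReal (Real.exp (-p.2 ^ 2 / (2 * T ^ 2))) := by
    fun_prop
  exact hm.lintegral_prod_right'

lemma log_sq_le_sqrt {x : ℝ} (hx : 1 ≤ x) : Real.log x ^ 2 ≤ 16 * √x := by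
  have hx0 : 0 ≤ x := by linarith
  have h1 : Real.log x = 4 * Real.log √√x := by
    rw [Real.log_sqrt (Real.sqrt_nonneg _), Real.log_sqrt hx0]
    ring
  have h2 : Real.log √√x ≤ √√x := Real.log_le_self (Real.sqrt_nonneg _)
  have h3 : 0 ≤ Real.log √√x := by
    have := Real.log_nonneg hx
    linarith
  have h4 : √√x ^ 2 = √x := Real.sq_sqrt (Real.sqrt_nonneg _)
  have h5 : Real.log √√x ^ 2 ≤ √x := (pow_le_pow_left₀ h3 h2 2).trans_eq h4
  rw [h1]
  linarith

/-- With the frequency threshold `T₀² = 32 (s + log n + 4)` and the cutoff `N`, the mean contribution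
of the high frequencies (`lintegral_high_frequency_le`) is at most `exp (-s) / N`. -/
lemma high_frequency_bound {N n s L : ℝ} (hN1 : 1 ≤ N) (hNn : N ≤ n) (hL : Real.log n = L)
    (hs : 1 ≤ s) (hsN : 8 * 10 ^ 7 * s ≤ √N) :
    22 * Real.exp (-(32 * (s + L + 4)) / 32) + 22 * N * Real.exp (-(3 / 20) * √N) ≤
      N⁻¹ * Real.exp (-s) := by
  have hN0 : 0 < N := by linarith
  set z := √N
  have hz2 : z ^ 2 = N := Real.sq_sqrt hN0.le
  have h1 : Real.exp (-(32 * (s + L + 4)) / 32) ≤ Real.exp (-s) * N⁻¹ * (1 / 50) := by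
    have e1 : Real.exp (-(32 * (s + L + 4)) / 32) = Real.exp (-s) * n⁻¹ * Real.exp (-4) := by
      have : -(32 * (s + L + 4)) / 32 = -s + -L + -4 := by ring
      rw [this, Real.exp_add, Real.exp_add, ← hL, Real.exp_neg (Real.log n),
        Real.exp_log (by linarith)]
    have e2 : Real.exp (-4) ≤ 1 / 50 := by
      rw [Real.exp_neg, one_div]
      refine inv_anti₀ (by norm_num) ?_
      have : Real.exp 4 = Real.exp 1 ^ 4 := by rw [← Real.exp_nat_mul]; norm_num
      rw [this]
      calc (50 : ℝ) ≤ 2.7 ^ 4 := by norm_num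
        _ ≤ _ := pow_le_pow_left₀ (by norm_num) (by linarith [Real.exp_one_gt_d9]) 4
    rw [e1]
    gcongr
  have h2 : 22 * N * Real.exp (-(3 / 20) * z) ≤ N⁻¹ * Real.exp (-s) * (1 / 2) := by
    have e1 : Real.exp (-(3 / 20) * z) ≤ Real.exp (-s) * Real.exp (-(z / 10)) := by
      rw [← Real.exp_add]
      refine Real.exp_le_exp.2 ?_
      linarith
    have e2 : 44 * N ^ 2 ≤ Real.exp (z / 10) := by
      have := Real.pow_div_factorial_le_exp (z / 10) (by positivity) 6
      refine le_trans ?_ this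
      have hz : (10 : ℝ) ^ 7 ≤ z := by linarith
      have hz' : (10 : ℝ) ^ 14 ≤ z ^ 2 := by
        calc (10 : ℝ) ^ 14 = (10 ^ 7) ^ 2 := by norm_num
          _ ≤ _ := pow_le_pow_left₀ (by norm_num) hz 2
      have e3 : (z / 10) ^ 6 / (Nat.factorial 6 : ℝ) = N ^ 2 * (z ^ 2 / 720000000) := by
        rw [← hz2]
        norm_num [Nat.factorial]
        ring
      rw [e3]
      nlinarith [sq_nonneg N]
    have e3 : Real.exp (-(z / 10)) ≤ (44 * N ^ 2)⁻¹ := by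
      rw [Real.exp_neg]
      exact inv_anti₀ (by positivity) e2
    calc _ ≤ 22 * N * (Real.exp (-s) * (44 * N ^ 2)⁻¹) := by
          gcongr
          exact e1.trans (by gcongr)
      _ = _ := by field_simp; norm_num
  have h3 : 0 < N⁻¹ * Real.exp (-s) := by positivity
  linarith

set_option maxHeartbeats 800000 in
/-- The smoothed distance between the projection of `μ` and the Gaussian law is of the order
`s² log n / (n λ₁)` in all directions but a set of measure `3 exp (-s)`. -/
theorem sphereProb_smoothedCharDist_le (h : IsIsotropicPoincare μ l) (hn : 2 ≤ n) {s : ℝ}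
    (hs : 1 ≤ s) (hlarge : 10 ^ 16 * s ^ 2 * Real.log n ≤ n * l) :
    sphereProb n {θ | ENNReal.ofReal (10 ^ 7 * s ^ 2 * Real.log n / (n * l)) <
      smoothedCharDist (fun t => charFun μ (t • (θ : EuclideanSpace ℝ (Fin n)))) (n * l)} ≤
      ENNReal.ofReal (3 * Real.exp (-s)) := by
  have hl := h.pos
  have hl1 := h.le_one (by omega)
  have hnR : (2 : ℝ) ≤ n := by exact_mod_cast hn
  set N := (n : ℝ) * l with hNdef
  set L := Real.log n with hLdef
  have hL : 0.69 ≤ L := by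
    have h1 := Real.log_le_log two_pos hnR
    linarith [Real.log_two_gt_d9]
  have hs2 : s ≤ s ^ 2 := by nlinarith
  have hNs : 64 * 10 ^ 14 * s ^ 2 ≤ N := by nlinarith
  have hNbig : 64 * 10 ^ 14 ≤ N := by nlinarith
  have hN0 : 0 < N := by linarith
  have hNn : N ≤ n := by nlinarith
  have hsqrt : 8 * 10 ^ 7 * s ≤ √N := by
    refine Real.le_sqrt_of_sq_le ?_
    calc _ = 64 * 10 ^ 14 * s ^ 2 := by ring
      _ ≤ N := hNs
  -- The threshold between low and high frequencies: `exp (-T₀² / 32)` is `exp (-s - 4) / n`.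
  set T₀ := √(32 * (s + L + 4))
  have hT02 : T₀ ^ 2 = 32 * (s + L + 4) := Real.sq_sqrt (by positivity)
  have hT01 : 1 ≤ T₀ := Real.le_sqrt_of_sq_le (by linarith)
  have hT04 : T₀ ^ 4 ≤ n / 40 := by
    have h1 : T₀ ^ 4 = (T₀ ^ 2) ^ 2 := by ring
    rw [h1, hT02]
    have h2 : L ^ 2 ≤ 16 * √n := log_sq_le_sqrt (by linarith)
    have h3 : √(n : ℝ) ^ 2 = n := Real.sq_sqrt (by linarith)
    have h4 : (10 : ℝ) ^ 7 ≤ √n := Real.le_sqrt_of_sq_le (by linarith)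
    have h5 : (s + L + 4) ^ 2 ≤ 3 * (s ^ 2 + L ^ 2 + 16) := by
      nlinarith [sq_nonneg (s - L), sq_nonneg (s - 4), sq_nonneg (L - 4)]
    nlinarith
  have hsL : s + L + 4 ≤ 10 * (s * L) := by nlinarith
  set k := ⌈s⌉₊
  have hks : s ≤ k := Nat.le_ceil s
  have hk2 : (k : ℝ) ≤ 2 * s := by
    have := Nat.ceil_lt_add_one (by linarith : 0 ≤ s)
    linarith
  have hk1 : 1 ≤ k := by
    have : (1 : ℝ) ≤ k := hs.trans hks
    exact_mod_cast this
  set γ := stdGaussian (EuclideanSpace ℝ (Fin n))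
  set W : ℝ → ℝ≥0∞ := fun t => ENNReal.ofReal (Real.exp (-t ^ 2 / (8 * N ^ 2))) with hW
  set Ql : EuclideanSpace ℝ (Fin n) → ℝ≥0∞ := fun x =>
    ∫⁻ t in Set.Icc (-T₀) T₀, ‖charFunDiff μ ((t / √n) • x)‖ₑ / ‖t‖ₑ with hQl
  set Qh : EuclideanSpace ℝ (Fin n) → ℝ≥0∞ := fun x =>
    ∫⁻ t in (Set.Icc (-T₀) T₀)ᶜ, ‖charFunDiff μ ((t / √n) • x)‖ₑ / ‖t‖ₑ * W t with hQh
  have hml : Measurable fun p : EuclideanSpace ℝ (Fin n) × ℝ =>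
      ‖charFunDiff μ ((p.2 / √n) • p.1)‖ₑ / ‖p.2‖ₑ :=
    (measurable_charFunDiff_smul _).div (by fun_prop)
  have hQlm : Measurable Ql := hml.lintegral_prod_right'
  have hQhm : Measurable Qh := by
    have : Measurable fun p : EuclideanSpace ℝ (Fin n) × ℝ =>
      ‖charFunDiff μ ((p.2 / √n) • p.1)‖ₑ / ‖p.2‖ₑ * W p.2 := hml.mul (by fun_prop)
    exact this.lintegral_prod_right'
  set c := 2800 * k * T₀ ^ 2 / N
  have hc : 0 < c := by
    have : (0 : ℝ) < k := by linarith
    positivity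
  -- The three exceptional events: short Gaussian vector, low and high frequencies.
  have hev1 : γ {x | ‖x‖ ^ 2 < n / 4} ≤ ENNReal.ofReal (Real.exp (-s)) := by
    rw [← ofReal_measureReal]
    refine ENNReal.ofReal_le_ofReal ((stdGaussian_real_ball_le n).trans ?_)
    refine Real.exp_le_exp.2 ?_
    linarith
  have hev2 : γ {x | ENNReal.ofReal (Real.exp 1 * c) ≤ Ql x} ≤ ENNReal.ofReal (Real.exp (-s)) := by
    refine (measure_ge_le_exp_neg hQlm hc (2 * k)
      (lintegral_low_frequency_pow_le h (by linarith) (by linarith) hT04 k hk1)).trans ?_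
    refine ENNReal.ofReal_le_ofReal (Real.exp_le_exp.2 ?_)
    push_cast
    linarith
  have hev3 : γ {x | ENNReal.ofReal N⁻¹ ≤ Qh x} ≤ ENNReal.ofReal (Real.exp (-s)) := by
    have h1 := (mul_meas_ge_le_lintegral (μ := γ) hQhm (ENNReal.ofReal N⁻¹)).trans
      (lintegral_high_frequency_le h (by omega) (by linarith) hT01 hN0)
    have h2 : 22 * Real.exp (-T₀ ^ 2 / 32) + 22 * N * Real.exp (-(3 / 20) * √N) ≤
        N⁻¹ * Real.exp (-s) := by
      rw [hT02]
      exact high_frequency_bound (by linarith) hNn rfl hs hsqrt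
    have h3 := h1.trans (ENNReal.ofReal_le_ofReal h2)
    rw [ENNReal.ofReal_mul (by positivity)] at h3
    exact (ENNReal.mul_le_mul_iff_right (by simpa using hN0) ENNReal.ofReal_ne_top).1 h3
  have hmR : MeasurableSet {θ : EuclideanSpace ℝ (Fin n) |
      ENNReal.ofReal (10 ^ 7 * s ^ 2 * L / N) <
        smoothedCharDist (fun t => charFun μ (t • θ)) N} :=
    measurableSet_lt measurable_const (measurable_smoothedCharDist N)
  have hsphere := sphereProb_eq_stdGaussian (n := n) (by omega) hmR
  simp only [Set.mem_ofPred_eq] at hsphere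
  rw [hsphere]
  have hsub : {x : EuclideanSpace ℝ (Fin n) | ENNReal.ofReal (10 ^ 7 * s ^ 2 * L / N) <
      smoothedCharDist (fun t => charFun μ (t • ‖x‖⁻¹ • x)) N} ⊆
      {x | ‖x‖ ^ 2 < n / 4} ∪ {x | ENNReal.ofReal (Real.exp 1 * c) ≤ Ql x} ∪
        {x | ENNReal.ofReal N⁻¹ ≤ Qh x} := by
    intro x hx
    by_contra hcon
    simp only [Set.mem_union, Set.mem_ofPred_eq, not_or, not_lt, not_le] at hcon hx
    obtain ⟨⟨hx1, hx2⟩, hx3⟩ := hcon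
    refine absurd hx (not_lt.2 ?_)
    calc _ ≤ ∫⁻ t : ℝ, ‖charFunDiff μ ((t / √n) • x)‖ₑ / ‖t‖ₑ * W t :=
          smoothedCharDist_direction_le (by omega) N hx1
      _ = (∫⁻ t in Set.Icc (-T₀) T₀, ‖charFunDiff μ ((t / √n) • x)‖ₑ / ‖t‖ₑ * W t) + Qh x :=
          (lintegral_add_compl _ measurableSet_Icc).symm
      _ ≤ Ql x + Qh x := by
          gcongr
          refine lintegral_mono fun t => mul_le_of_le_one_right' ?_
          refine ENNReal.ofReal_le_one.2 (Real.exp_le_one_iff.2 ?_)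
          rw [neg_div, neg_nonpos]
          positivity
      _ ≤ ENNReal.ofReal (Real.exp 1 * c) + ENNReal.ofReal N⁻¹ := add_le_add hx2.le hx3.le
      _ ≤ _ := by
          rw [← ENNReal.ofReal_add (by positivity) (by positivity)]
          refine ENNReal.ofReal_le_ofReal ?_
          have e1 : c = 2800 * 32 * (k * (s + L + 4)) / N := by
            simp only [c]
            rw [hT02]
            ring
          rw [e1, ← mul_div_assoc, inv_eq_one_div, ← add_div]
          gcongr
          have e2 : k * (s + L + 4) ≤ 20 * (s ^ 2 * L) := by
            calc _ ≤ 2 * s * (10 * (s * L)) := by gcongr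
              _ = _ := by ring
          have e3 := Real.exp_one_lt_d9
          have e4 : (0.69 : ℝ) ≤ s ^ 2 * L := by nlinarith
          have e5 : 0 ≤ k * (s + L + 4) := by positivity
          nlinarith
  calc _ ≤ γ ({x | ‖x‖ ^ 2 < n / 4} ∪ {x | ENNReal.ofReal (Real.exp 1 * c) ≤ Ql x} ∪
        {x | ENNReal.ofReal N⁻¹ ≤ Qh x}) := measure_mono hsub
    _ ≤ ENNReal.ofReal (Real.exp (-s)) + ENNReal.ofReal (Real.exp (-s)) +
        ENNReal.ofReal (Real.exp (-s)) :=
        (measure_union_le _ _).trans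
          (add_le_add ((measure_union_le _ _).trans (add_le_add hev1 hev2)) hev3)
    _ = _ := by
        rw [← ENNReal.ofReal_add (by positivity) (by positivity),
          ← ENNReal.ofReal_add (by positivity) (by positivity)]
        congr 1
        ring

end RandomDirection

/-! ### Transfer to random vectors -/

section RandomVector

variable {n : ℕ} {Ω : Type*} [MeasurableSpace Ω] {P : Measure Ω}
  {X : Ω → EuclideanSpace ℝ (Fin n)}

lemma weightedSumCDF_eq (hX : AEMeasurable X P) (θ : EuclideanSpace ℝ (Fin n)) (x : ℝ) :
    weightedSumCDF P X θ x = ((P.map X).map fun y => inner ℝ θ y).real (Set.Iic x) := by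
  have hm : Measurable fun y : EuclideanSpace ℝ (Fin n) => inner ℝ θ y := by fun_prop
  rw [map_measureReal_apply hm measurableSet_Iic, map_measureReal_apply_of_aemeasurable hX
    (hm measurableSet_Iic), weightedSumCDF]
  congr with ω
  simp [PiLp.inner_apply, mul_comm]

lemma charFun_map_inner (μ : Measure (EuclideanSpace ℝ (Fin n))) (θ : EuclideanSpace ℝ (Fin n))
    (t : ℝ) : charFun (μ.map fun y => inner ℝ θ y) t = charFun μ (t • θ) := by
  rw [charFun_apply_real, charFun_apply, integral_map (by fun_prop)
    (by fun_prop)]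
  congr with y
  rw [real_inner_smul_right, real_inner_comm]
  push_cast
  rfl

lemma isIsotropicPoincare_map [IsProbabilityMeasure P] (hX : AEMeasurable X P)
    (hiso : IsIsotropic P X) (hmean : ∀ i : Fin n, ∫ ω, X ω i ∂P = 0) {l : ℝ} (hl : 0 < l)
    (hle : ENNReal.ofReal l ≤ poincareConstant P X) :
    IsIsotropicPoincare (P.map X) l where
  memLp := (memLp_map_measure_iff aestronglyMeasurable_id hX).2 hiso.1
  mean v := by
    rw [integral_map hX (by fun_prop)]
    simp only [PiLp.inner_apply, RCLike.inner_apply, conj_trivial]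
    rw [integral_finsetSum]
    · simp [integral_mul_const, hmean]
    · intro i _
      have := (EuclideanSpace.proj (𝕜 := ℝ) i).comp_memLp' hiso.1
      exact (this.integrable (by norm_num)).mul_const _
  secondMoment i j := by
    rw [integral_map hX (by fun_prop)]
    exact hiso.2 i j
  pos := hl
  poincare u hu := by
    have hum : Measurable u := hu.continuous.measurable
    have hg : Measurable fun x => ‖gradient u x‖ₑ ^ 2 := by
      have : Continuous (gradient u) :=
        (InnerProductSpace.toDual ℝ _).symm.continuous.comp (hu.continuous_fderiv (by simp))
      fun_prop
    rw [lintegral_map' hg.aemeasurable hX]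
    have hev : evariance u (P.map X) = evariance (fun ω => u (X ω)) P := by
      rw [evariance, evariance, lintegral_map' (by fun_prop) hX,
        integral_map hX hum.aestronglyMeasurable]
    rw [hev]
    refine (mul_le_mul_left hle _).trans ?_
    rw [poincareConstant, ENNReal.sSup_mul]
    exact iSup₂_le fun a ha => ha u hu

end RandomVector

/-! ### Normal approximation in random directions -/

section Main

variable {n : ℕ} {Ω : Type*} [MeasurableSpace Ω] {P : Measure Ω} [IsProbabilityMeasure P]
  {X : Ω → EuclideanSpace ℝ (Fin n)}

lemma kolmogorovDist_le_one (θ : EuclideanSpace ℝ (Fin n)) :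
    kolmogorovDist (weightedSumCDF P X θ) stdNormalCDF ≤ 1 := by
  refine ciSup_le fun x => ?_
  have h1 : 0 ≤ weightedSumCDF P X θ x := measureReal_nonneg
  have h2 : weightedSumCDF P X θ x ≤ 1 := measureReal_le_one
  have h3 : 0 ≤ stdNormalCDF x := measureReal_nonneg
  have h4 : stdNormalCDF x ≤ 1 := measureReal_le_one
  rw [abs_le]
  constructor <;> linarith

lemma kolmogorovDist_le_of_smoothedCharDist_le (hX : AEMeasurable X P)
    (hXi : Integrable X P) (θ : EuclideanSpace ℝ (Fin n)) {T j : ℝ} (hT : 0 < T) (hj : 0 ≤ j)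
    (hJ : smoothedCharDist (fun t => charFun (P.map X) (t • θ)) T ≤ ENNReal.ofReal j) :
    kolmogorovDist (weightedSumCDF P X θ) stdNormalCDF ≤ j + 3 / T := by
  have : IsProbabilityMeasure (P.map X) := Measure.isProbabilityMeasure_map hX
  have hm : Measurable fun y : EuclideanSpace ℝ (Fin n) => inner ℝ θ y := by fun_prop
  have : IsProbabilityMeasure ((P.map X).map fun y => inner ℝ θ y) :=
    Measure.isProbabilityMeasure_map hm.aemeasurable
  lift T to NNReal using hT.le
  have hν : Integrable id ((P.map X).map fun y => inner ℝ θ y) := by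
    rw [integrable_map_measure (by fun_prop) hm.aemeasurable,
      integrable_map_measure (by fun_prop) hX]
    exact hXi.const_inner θ
  have hch : (fun t => charFun (P.map X) (t • θ)) =
      charFun ((P.map X).map fun y => inner ℝ θ y) := by
    ext t
    rw [charFun_map_inner]
  rw [hch] at hJ
  refine ciSup_le fun x => ?_
  rw [weightedSumCDF_eq hX]
  exact abs_real_Iic_sub_stdNormalCDF_le (by exact_mod_cast hT.ne') _ hν hj hJ x

lemma sphereProb_le_one (hn : 1 ≤ n) (s : Set (Metric.sphere (0 : EuclideanSpace ℝ (Fin n)) 1)) :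
    sphereProb n s ≤ 1 := by
  refine (measure_mono (Set.subset_univ s)).trans ?_
  have := sphereProb_eq_stdGaussian hn (MeasurableSet.univ (α := EuclideanSpace ℝ (Fin n)))
  simp only [Set.mem_univ, Set.ofPred_true, measure_univ] at this
  exact this.le

lemma poincareConstant_le_one (hn : 1 ≤ n) (hX : AEMeasurable X P) (hiso : IsIsotropic P X)
    (hmean : ∀ i : Fin n, ∫ ω, X ω i ∂P = 0) : poincareConstant P X ≤ 1 := by
  by_contra! hc
  obtain ⟨a, ha1, ha2⟩ := ENNReal.lt_iff_exists_nnreal_btwn.1 hc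
  have ha : (1 : ℝ) < a := by exact_mod_cast ha1
  have : IsProbabilityMeasure (P.map X) := Measure.isProbabilityMeasure_map hX
  have h := isIsotropicPoincare_map hX hiso hmean (l := a) (by linarith)
    (by rw [ENNReal.ofReal_coe_nnreal]; exact ha2.le)
  linarith [h.le_one hn]

end Main

theorem corollary12p1 :
    ∃ C : ℝ, 0 < C ∧
      ∀ (n : ℕ), 2 ≤ n →
      ∀ (Ω : Type*) [MeasurableSpace Ω] (P : Measure Ω) [IsProbabilityMeasure P]
        (X : Ω → EuclideanSpace ℝ (Fin n)),
        AEMeasurable X P →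
        IsIsotropic P X →
        (∀ i : Fin n, ∫ ω, X ω i ∂P = 0) →
        0 < poincareConstant P X →
        ∀ β : ℝ, 0 < β →
          sphereProb n {θ |
            ¬ kolmogorovDist (weightedSumCDF P X θ) stdNormalCDF ≤
              C * β ^ 2 * Real.log n ^ 3 / (n * (poincareConstant P X).toReal)}
          ≤ ENNReal.ofReal (3 * (n : ℝ) ^ (-β)) := by
  refine ⟨10 ^ 16, by norm_num, ?_⟩
  intro n hn Ω _ P _ X hX hiso hmean hpos β hβ
  have hfin : poincareConstant P X ≠ ∞ :=
    ne_top_of_le_ne_top ENNReal.one_ne_top (poincareConstant_le_one (by omega) hX hiso hmean)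
  set l := (poincareConstant P X).toReal with hl
  have hl0 : 0 < l := ENNReal.toReal_pos hpos.ne' hfin
  have hμ : IsProbabilityMeasure (P.map X) := Measure.isProbabilityMeasure_map hX
  have h := isIsotropicPoincare_map hX hiso hmean hl0 (by rw [hl, ENNReal.ofReal_toReal hfin])
  have hnR : (2 : ℝ) ≤ n := by exact_mod_cast hn
  set L := Real.log n with hL
  have hL0 : 0.69 ≤ L := by
    have h1 := Real.log_le_log two_pos hnR
    linarith [Real.log_two_gt_d9]
  set s := β * L with hs
  have hpow : (n : ℝ) ^ (-β) = Real.exp (-s) := by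
    rw [Real.rpow_def_of_pos (by linarith), hs]
    congr 1
    ring
  have hN : 0 < n * l := by positivity
  have hC : 10 ^ 16 * β ^ 2 * L ^ 3 / (n * l) = 10 ^ 16 * s ^ 2 * L / (n * l) := by
    rw [hs]
    ring
  rw [hpow, hC]
  -- For `s < 1` the exceptional set is allowed to be the whole sphere.
  rcases lt_or_ge s 1 with hs1 | hs1
  · refine (sphereProb_le_one (by omega) _).trans ?_
    rw [ENNReal.one_le_ofReal]
    have h1 : Real.exp (-1) ≤ Real.exp (-s) := Real.exp_le_exp.2 (by linarith)
    linarith [Real.exp_neg_one_gt_d9]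
  -- If the claimed bound exceeds `1`, it holds in every direction.
  rcases lt_or_ge (n * l) (10 ^ 16 * s ^ 2 * L) with hlarge | hlarge
  · refine le_of_eq_of_le ?_ zero_le
    have hempty : {θ : Metric.sphere (0 : EuclideanSpace ℝ (Fin n)) 1 |
        ¬ kolmogorovDist (weightedSumCDF P X θ) stdNormalCDF ≤
          10 ^ 16 * s ^ 2 * L / (n * l)} = ∅ := by
      refine Set.eq_empty_of_forall_notMem fun θ hθ => hθ ?_
      refine (kolmogorovDist_le_one _).trans ?_
      rw [le_div_iff₀ hN]
      linarith
    rw [hempty, measure_empty]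
  refine (measure_mono ?_).trans (sphereProb_smoothedCharDist_le h hn hs1 hlarge)
  intro θ hθ
  by_contra hcon
  simp only [Set.mem_ofPred_eq, not_lt] at hcon hθ
  refine hθ ((kolmogorovDist_le_of_smoothedCharDist_le hX (hiso.1.integrable (by norm_num)) θ hN
    (by positivity) hcon).trans ?_)
  rw [← add_div]
  gcongr
  have : 0.69 ≤ s ^ 2 * L := by nlinarith
  linarith
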